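/- Let $d,N,M\ge 1$ be integers and let $a_1,\dots,a_N\in\mathbb R$, $(b_\alpha)_{\alpha\in\mathbb N^d,|\alpha|\le M}\subset\mathbb R$ with $a_N=1$ and $b_\alpha\ne0$ for some $|\alpha|=M$. Let $p_1,\dots,p_N>0$ with $p_1+\dots+p_N=1$, and let $f_n:\mathbb R^d\to\mathbb R$ ($1\le n\le N$) and $F:\mathbb R_+\times\mathbb R^d\to\mathbb R$ be bounded and continuous. Consider the linear Cauchy problem $$\sum_{n=1}^N a_n\partial_t^n u-\sum_{|\alpha|\le M}b_\alpha D^\alpha u-F=0,\qquad \partial_t^{n-1}u(0,\cdot)=p_nf_n,\quad n=1,\dots,N. \tag{1}$$ Let $b(\xi)=\sum_{|\alpha|\le M}i^{|\alpha|}b_\alpha\xi^\alpha$, and let $B(\xi)$ be the $N\times N$ matrix with ones on the superdiagonal, last row $(b(\xi),-a_1,\dots,-a_{N-1})$ and zeros elsewhere. Put $\hat g(t,\xi)=(2\pi)^{-d/2}e^{tB(\xi)^{\mathrm T}}\mathrm e_1\in\mathbb C^N$. Let $T\in(0,\infty]$ and assume: * $\hat g_n(t,\cdot)\in\mathcal S'(\mathbb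 R^d)$ for all $n$ and $t\in[0,T)$. Let $g_n(t,\cdot)=\mathfrak F^{-1}\hat g_n(t,\cdot)\in\mathcal S'$, where $\mathfrak F^{-1}\varphi(x)=(2\pi)^{-d/2}\int e^{i\xi\cdot x}\varphi(\xi)\,d\xi$ for $\varphi\in\mathcal S$. * For all $n$ and $t\in[0,T)$, $g_n(t,\cdot)$ is represented by a finite signed measure $g_n(t,dx)$ with Jordan decomposition $g_n^+-g_n^-$, where $g_n^\pm(t,dx)=\gamma_n^\pm(t,x)\,\mu_n(t,dx)$ for a probability measure $\mu_n(t,\cdot)$ and measurable $\gamma_n^\pm(t,\cdot)\ge0$. Put $\gamma_n=\gamma_n^+-\gamma_n^-$. Then $\gamma_n(t,\cdot)$ is $\mu_n(t,\cdot)$-essentially bounded for every $t\in[0,T)$, $\gamma_N$ is jointly measurable in $(t,x)$, and $s\mapsto|g_N|(s,\mathbb R^d)$ is integrable on $[0,t]$ for every $t\in[0,T)$. * For every $n$ and every bounded continuous $\phi:\mathbb R^d\to\mathbb R$, the map $(t,x)\mapsto (g_n(t,\cdot)*\phi)(x)=\int\phi(x-z)\,g_n(t,dz)$ is continuous on $[0,T)\times\mathbb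 R^d$. On a probability space let $\tau$ and $I$ be independent random variables with $\mathbb P[\tau\in dt]=\rho(t)\mathbf 1_{t\ge0}\,dt$, where $\rho$ is continuous on $[0,\infty)$ and positive on $(0,\infty)$, and $\mathbb P[I=n]=p_n$ for $1\le n\le N$. Put $\bar\rho(t)=\int_t^\infty\rho(s)\,ds$. Let $Z^n=(Z^n_t)_{t\in[0,T)}$, $1\le n\le N$, be $\mathbb R^d$-valued processes such that $Z^n_t$ has law $\mu_n(t,\cdot)$. Assume that they are independent of $(I,\tau)$ in the following sense: there is a $\sigma$-algebra $\mathcal Z$ independent of $(I,\tau)$ such that every $Z^n_t$ is $\mathcal Z$-measurable, and $(t,\omega)\mapsto Z^N_t(\omega)$ is measurable with respect to $\mathcal B([0,T))\otimes\mathcal Z$. For $x\in\mathbb R^d$ put $X^n_t=x-Z^n_t$. Then, for all $t\in[0,T)$ and $x\in\mathbb R^d$, the random variable below is integrable. Let $$u(t,x)=\mathbb E\Big[\mathbf 1_{\{\tau\ge t\}}\frac{\gamma_I(t,Z^I_t)}{\bar\rho(t)}f_I(X^I_t)+\mathbf 1_{\{\tau<t\}}\frac{\gamma_N(\tau,Z^N_\tau)}{\rho(\tau)}F(t-\tau,X^N_\tau)\Big].$$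 For every real $S$ with $0<S<T$, the restriction of $u$ to $[0,S]\times\mathbb R^d$ is the unique solution of (1) in $C^0_b([0,S]\times\mathbb R^d,\mathbb R)$. Here a function $v\in C^0_b([0,S]\times\mathbb R^d,\mathbb R)$ is called a solution of (1) on $[0,S]$ if the following holds for every Schwartz function $\varphi$, where $\langle h,\varphi\rangle=\int_{\mathbb R^d} h\varphi\,dx$. The function $t\mapsto\langle v(t,\cdot),\varphi\rangle$ is of class $C^N$ on $[0,S]$ (with one-sided derivatives at the end points), it satisfies $$\sum_{n=1}^N a_n\partial_t^n\langle v(t,\cdot),\varphi\rangle-\sum_{|\alpha|\le M}b_\alpha(-1)^{|\alpha|}\langle v(t,\cdot),D^\alpha\varphi\rangle-\langle F(t,\cdot),\varphi\rangle=0,\qquad t\in[0,S],$$ and $\partial_t^{n-1}\langle v(t,\cdot),\varphi\rangle|_{t=0}=p_n\langle f_n,\varphi\rangle$ for $n=1,\dots,N$. -/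

import Mathlib

open MeasureTheory ProbabilityTheory Set
open scoped SchwartzMap FourierTransform LineDeriv BoundedContinuousFunction NNReal ENNReal

noncomputable section

namespace CauchyProblem

/-! Conventions. `N ≥ 1` is encoded by `[NeZero N]`. Families indexed by `1, …, N` are indexed by
`Fin N`: the index `n : Fin N` stands for the number `n + 1`, so `0 : Fin N` stands for `1` and
`⊤ : Fin N` stands for `N`. The coefficients `a 1, …, a N` are the values of `a : ℕ → ℝ` on
`{1, …, N}`; other values of `a` are not used. Likewise `b α` is only used for `|α| ≤ M`. -/

/-- The space `ℝ^d` with its Euclidean structure. -/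
abbrev Space (d : ℕ) : Type := EuclideanSpace ℝ (Fin d)

/-- The length `|α|` of a multi-index `α ∈ ℕ^d`. -/
def multiLength {d : ℕ} (α : Fin d → ℕ) : ℕ := ∑ i, α i

/-- The finite set of multi-indices `α ∈ ℕ^d` with `|α| ≤ M`. -/
def multiIndices (d M : ℕ) : Finset (Fin d → ℕ) :=
  (Fintype.piFinset fun _ : Fin d => Finset.range (M + 1)).filter fun α => multiLength α ≤ M

theorem mem_multiIndices {d M : ℕ} (α : Fin d → ℕ) :
    α ∈ multiIndices d M ↔ multiLength α ≤ M := by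
  simp only [multiIndices, Finset.mem_filter, Fintype.mem_piFinset, Finset.mem_range,
    and_iff_right_iff_imp]
  intro h i
  have : α i ≤ multiLength α :=
    Finset.single_le_sum (f := α) (fun _ _ => Nat.zero_le _) (Finset.mem_univ i)
  omega

/-- The partial derivative `D^α φ = ∂_1^{α_1} ⋯ ∂_d^{α_d} φ` of a Schwartz function. -/
def multiDeriv {d : ℕ} (α : Fin d → ℕ) (φ : 𝓢(Space d, ℝ)) : 𝓢(Space d, ℝ) :=
  (List.finRange d).foldr
    (fun i ψ => (fun χ : 𝓢(Space d, ℝ) => ∂_{(EuclideanSpace.single i (1 : ℝ) : Space d)} χ)^[α i] ψ)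
    φ

/-! ### The symbol, the companion matrix and the Green functions -/

/-- The symbol `b(ξ) = ∑_{|α| ≤ M} i^{|α|} b_α ξ^α`. -/
def symbol {d : ℕ} (M : ℕ) (b : (Fin d → ℕ) → ℝ) (ξ : Space d) : ℂ :=
  ∑ α ∈ multiIndices d M, Complex.I ^ multiLength α * (b α : ℂ) * ∏ i, (ξ i : ℂ) ^ α i

/-- The companion matrix `B(ξ)`: ones on the superdiagonal, and last row
`(b(ξ), -a_1, …, -a_{N-1})`. -/
def companion {d : ℕ} (N M : ℕ) (a : ℕ → ℝ) (b : (Fin d → ℕ) → ℝ) (ξ : Space d) :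
    Matrix (Fin N) (Fin N) ℂ :=
  Matrix.of fun i j =>
    if (i : ℕ) + 1 < N then (if (j : ℕ) = (i : ℕ) + 1 then 1 else 0)
    else (if (j : ℕ) = 0 then symbol M b ξ else -(a (j : ℕ) : ℂ))

/-- `ĝ_n(t, ξ)`, the `n`-th component of `(2π)^{-d/2} exp(t B(ξ)ᵀ) e_1`. -/
def greenHat {d : ℕ} (N M : ℕ) [NeZero N] (a : ℕ → ℝ) (b : (Fin d → ℕ) → ℝ)
    (n : Fin N) (t : ℝ) (ξ : Space d) : ℂ :=
  (((2 * Real.pi) ^ (-(d : ℝ) / 2) : ℝ) : ℂ) *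
    (NormedSpace.exp ((t : ℂ) • (companion N M a b ξ).transpose)).mulVec (Pi.single 0 1) n

/-- The linear equivalence `x ↦ (2π)⁻¹ x` of `ℝ^d`. -/
def rescale (d : ℕ) : Space d ≃L[ℝ] Space d :=
  ContinuousLinearEquiv.smulLeft (Units.mk0 ((2 * Real.pi)⁻¹ : ℝ) (by positivity))

/-- The unitary inverse Fourier transform on Schwartz functions,
`φ ↦ (x ↦ (2π)^{-d/2} ∫ exp(i ξ·x) φ(ξ) dξ)`; see `inverseFourier_apply`. -/
def inverseFourier (d : ℕ) : 𝓢(Space d, ℂ) →L[ℂ] 𝓢(Space d, ℂ) :=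
  (((2 * Real.pi) ^ (-(d : ℝ) / 2) : ℝ) : ℂ) •
    (SchwartzMap.compCLMOfContinuousLinearEquiv ℂ (rescale d)).comp
      (FourierTransform.fourierInvCLM ℂ 𝓢(Space d, ℂ))

theorem inverseFourier_apply {d : ℕ} (φ : 𝓢(Space d, ℂ)) (x : Space d) :
    inverseFourier d φ x = (((2 * Real.pi) ^ (-(d : ℝ) / 2) : ℝ) : ℂ) *
      ∫ ξ, Complex.exp (Complex.I * (inner ℝ ξ x : ℝ)) * φ ξ := by
  have h : inverseFourier d φ x = (((2 * Real.pi) ^ (-(d : ℝ) / 2) : ℝ) : ℂ) *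
      (FourierTransformInv.fourierInv φ : 𝓢(Space d, ℂ)) (((2 * Real.pi)⁻¹ : ℝ) • x) := rfl
  rw [h, SchwartzMap.fourierInv_coe, Real.fourierInv_eq']
  congr 1
  refine integral_congr_ae (Filter.Eventually.of_forall fun ξ => ?_)
  simp only [inner_smul_right, smul_eq_mul]
  congr 2
  have : (Real.pi : ℂ) ≠ 0 := by exact_mod_cast Real.pi_ne_zero
  push_cast
  field_simp

/-- The tempered distribution `G` coincides with the function `h` (on test functions). -/
def Represents {d : ℕ} (G : 𝓢'(Space d, ℂ)) (h : Space d → ℂ) : Prop :=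
  ∀ φ : 𝓢(Space d, ℂ), HasCompactSupport φ → G φ = ∫ ξ, h ξ * φ ξ

/-- The distribution represented by the function `h` belongs to `𝓢'`. -/
def IsTempered {d : ℕ} (h : Space d → ℂ) : Prop :=
  ∃ G : 𝓢'(Space d, ℂ), Represents G h

open Classical in
/-- The tempered distribution represented by `h` (and `0` if `h` is not tempered). -/
def toTempered {d : ℕ} (h : Space d → ℂ) : 𝓢'(Space d, ℂ) :=
  if hh : IsTempered h then hh.choose else 0

/-- The Green function `g_n(t, ·) = 𝔉⁻¹ ĝ_n(t, ·)`, a tempered distribution, evaluated at `φ`: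
`⟨𝔉⁻¹ ĝ_n(t, ·), φ⟩ = ⟨ĝ_n(t, ·), 𝔉⁻¹ φ⟩`. -/
def green {d : ℕ} (N M : ℕ) [NeZero N] (a : ℕ → ℝ) (b : (Fin d → ℕ) → ℝ)
    (n : Fin N) (t : ℝ) (φ : 𝓢(Space d, ℂ)) : ℂ :=
  toTempered (greenHat N M a b n t) (inverseFourier d φ)

/-! ### Signed measures, and the assumptions on the Green functions -/

/-- The half-open time interval `[0, T)`, for `T ∈ (0, ∞]`. -/
def timeSet (T : EReal) : Set ℝ := {t | 0 ≤ t ∧ (t : EReal) < T}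

/-- The integral `∫ φ(z) g(dz)` against a signed measure `g = g⁺ - g⁻` (Jordan decomposition). -/
def signedIntegral {X V : Type*} [MeasurableSpace X] [NormedAddCommGroup V] [NormedSpace ℝ V]
    (g : SignedMeasure X) (φ : X → V) : V :=
  (∫ z, φ z ∂g.toJordanDecomposition.posPart) - ∫ z, φ z ∂g.toJordanDecomposition.negPart

/-- The convolution `(g * φ)(x) = ∫ φ(x - z) g(dz)`. -/
def signedConv {d : ℕ} (g : SignedMeasure (Space d)) (φ : Space d → ℝ) (x : Space d) : ℝ :=
  signedIntegral g fun z => φ (x - z)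

/-- The density `γ_n = γ_n⁺ - γ_n⁻`. -/
def density {d N : ℕ} (γp γm : Fin N → ℝ → Space d → ℝ≥0) (n : Fin N) (t : ℝ) (z : Space d) : ℝ :=
  (γp n t z : ℝ) - (γm n t z : ℝ)

/-- For all `t ∈ [0, T)`, the functions `ĝ_n(t, ·)` are tempered distributions. -/
def GreenHatTempered {d : ℕ} (N M : ℕ) [NeZero N] (a : ℕ → ℝ) (b : (Fin d → ℕ) → ℝ)
    (T : EReal) : Prop :=
  ∀ n : Fin N, ∀ t ∈ timeSet T, IsTempered (greenHat N M a b n t)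

/-- The Green functions `g_n(t, ·)`, `t ∈ [0, T)`, are represented by signed measures `g n t`
which are dominated by the probability measures `μ n t`, with densities `γ_n⁺`, `γ_n⁻`. A
`SignedMeasure` has finite total mass. -/
structure GreenMeasures {d : ℕ} (N M : ℕ) [NeZero N] (a : ℕ → ℝ) (b : (Fin d → ℕ) → ℝ) (T : EReal)
    (g : Fin N → ℝ → SignedMeasure (Space d)) (μ : Fin N → ℝ → Measure (Space d))
    (γp γm : Fin N → ℝ → Space d → ℝ≥0) : Prop where
  /-- `g_n(t, ·)` is represented by the signed measure `g n t`. -/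
  represents : ∀ n, ∀ t ∈ timeSet T, ∀ φ : 𝓢(Space d, ℂ),
    green N M a b n t φ = signedIntegral (g n t) φ
  /-- `(t, x) ↦ (g_n(t, ·) * φ)(x)` is continuous on `[0, T) × ℝ^d`, for `φ` bounded continuous. -/
  continuous_conv : ∀ n, ∀ φ : Space d →ᵇ ℝ,
    ContinuousOn (fun q : ℝ × Space d => signedConv (g n q.1) φ q.2) (timeSet T ×ˢ univ)
  prob : ∀ n, ∀ t ∈ timeSet T, IsProbabilityMeasure (μ n t)
  measurable_pos : ∀ n, ∀ t ∈ timeSet T, Measurable (γp n t)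
  measurable_neg : ∀ n, ∀ t ∈ timeSet T, Measurable (γm n t)
  /-- `g_n⁺(t, dx) = γ_n⁺(t, x) μ_n(t, dx)`. -/
  pos_density : ∀ n, ∀ t ∈ timeSet T,
    (g n t).toJordanDecomposition.posPart = (μ n t).withDensity fun z => (γp n t z : ℝ≥0∞)
  /-- `g_n⁻(t, dx) = γ_n⁻(t, x) μ_n(t, dx)`. -/
  neg_density : ∀ n, ∀ t ∈ timeSet T,
    (g n t).toJordanDecomposition.negPart = (μ n t).withDensity fun z => (γm n t z : ℝ≥0∞)
  /-- `γ_n(t, ·)` is (essentially) bounded, for every `t`. -/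
  bounded : ∀ n, ∀ t ∈ timeSet T, ∃ C : ℝ, ∀ᵐ z ∂(μ n t), |density γp γm n t z| ≤ C
  /-- The density `γ_N` is jointly measurable. -/
  measurable_last :
    Measurable fun q : timeSet T × Space d => density γp γm (⊤ : Fin N) q.1 q.2
  /-- The total mass of `|g_N|(s, ·)` is integrable in `s ∈ [0, t]`, for every `t ∈ [0, T)`. -/
  integrable_mass : ∀ t ∈ timeSet T,
    IntegrableOn (fun s => ((g ⊤ s).totalVariation univ).toReal) (Icc 0 t)

/-! ### Solutions of the Cauchy problem -/

/-- The pairing `⟨u(t, ·), φ⟩ = ∫ u(t, x) φ(x) dx`. -/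
def pairing {d : ℕ} (u : ℝ → Space d → ℝ) (φ : 𝓢(Space d, ℝ)) (t : ℝ) : ℝ :=
  ∫ x, u t x * φ x

/-- `u` is a solution in `C^0_b([0, S] × ℝ^d)` of the Cauchy problem
`∑ a_n ∂_t^n u - ∑ b_α D^α u - F = 0`, `∂_t^{n-1} u(0, ·) = p_n f_n`, `n = 1, …, N`.
As `u` is only continuous, the equation holds in the sense of (tempered) distributions
in the space variable: for all Schwartz functions `φ`, the function `t ↦ ⟨u(t, ·), φ⟩` is of class
`C^N` on `[0, S]`, and the equation and the initial conditions hold after pairing with `φ`, where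
`⟨D^α u, φ⟩ = (-1)^{|α|} ⟨u, D^α φ⟩`. -/
structure IsBoundedSolution {d : ℕ} (N M : ℕ) (a : ℕ → ℝ) (b : (Fin d → ℕ) → ℝ)
    (p : Fin N → ℝ) (f : Fin N → Space d → ℝ) (F : ℝ → Space d → ℝ)
    (S : ℝ) (u : ℝ → Space d → ℝ) : Prop where
  continuousOn : ContinuousOn (fun q : ℝ × Space d => u q.1 q.2) (Icc 0 S ×ˢ univ)
  bounded : ∃ C : ℝ, ∀ t ∈ Icc 0 S, ∀ x, |u t x| ≤ C
  contDiffOn : ∀ φ : 𝓢(Space d, ℝ), ContDiffOn ℝ N (pairing u φ) (Icc 0 S)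
  equation : ∀ φ : 𝓢(Space d, ℝ), ∀ t ∈ Icc 0 S,
    (∑ n ∈ Finset.Icc 1 N, a n * iteratedDerivWithin n (pairing u φ) (Icc 0 S) t)
      - (∑ α ∈ multiIndices d M, b α * ((-1) ^ multiLength α * pairing u (multiDeriv α φ) t))
      - pairing F φ t = 0
  initial : ∀ φ : 𝓢(Space d, ℝ), ∀ n : Fin N,
    iteratedDerivWithin n (pairing u φ) (Icc 0 S) 0 = p n * ∫ x, f n x * φ x

/-! ### The probabilistic representation -/

/-- The tail `ρ̄(t) = ∫_t^∞ ρ(s) ds`. -/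
def tail (ρ : ℝ → ℝ) (t : ℝ) : ℝ := ∫ s in Ioi t, ρ s

/-- The processes `Z^n` have one-dimensional laws `μ_n(t, ·)`, `t ∈ [0, T)`, and are independent of
`(I, τ)`: they are measurable with respect to a σ-algebra `𝒵` which is independent of `(I, τ)`. The
process `Z^N`, which is to be evaluated at the random time `τ`, is jointly measurable in
`(t, ω)`, with respect to the product of the Borel σ-algebra of `[0, T)` and `𝒵`. -/
def IndependentDisplacements {Ω : Type*} [mΩ : MeasurableSpace Ω] (P : Measure Ω) {d N : ℕ}
    [NeZero N] (T : EReal) (μ : Fin N → ℝ → Measure (Space d))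
    (τ : Ω → ℝ) (I : Ω → Fin N) (Z : Fin N → ℝ → Ω → Space d) : Prop :=
  (∀ n, ∀ t ∈ timeSet T, Measurable (Z n t) ∧ P.map (Z n t) = μ n t) ∧
  ∃ 𝒵 : MeasurableSpace Ω, 𝒵 ≤ mΩ ∧
    Indep 𝒵 (MeasurableSpace.comap (fun ω => (I ω, τ ω)) inferInstance) P ∧
    (∀ n, ∀ t ∈ timeSet T, Measurable[𝒵] (Z n t)) ∧
    Measurable[MeasurableSpace.prod inferInstance 𝒵]
      (fun q : timeSet T × Ω => Z (⊤ : Fin N) q.1 q.2)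

/-- The random variables: `τ` has the density `ρ` on `[0, ∞)`, continuous on `[0, ∞)` and positive
on `(0, ∞)`, the index `I` has law `(p_n)`, `τ` and `I` are independent, and the processes `Z^n` are
independent of `(I, τ)`, with laws `μ_n(t, ·)`. -/
structure IsSampling {Ω : Type*} [MeasurableSpace Ω] (P : Measure Ω) {d N : ℕ} [NeZero N]
    (T : EReal) (p : Fin N → ℝ) (ρ : ℝ → ℝ) (μ : Fin N → ℝ → Measure (Space d))
    (τ : Ω → ℝ) (I : Ω → Fin N) (Z : Fin N → ℝ → Ω → Space d) : Prop where
  continuousOn_density : ContinuousOn ρ (Ici 0)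
  density_pos : ∀ t, 0 < t → 0 < ρ t
  measurable_time : Measurable τ
  measurable_index : Measurable I
  law_time : P.map τ = (volume.restrict (Ici 0)).withDensity fun t => ENNReal.ofReal (ρ t)
  law_index : ∀ n, P (I ⁻¹' {n}) = ENNReal.ofReal (p n)
  indep_time_index : IndepFun τ I P
  displacements : IndependentDisplacements P T μ τ I Z

open Classical in
/-- The random variable
`1_{τ ≥ t} γ_I(t, Z^I_t) / ρ̄(t) f_I(X^I_t) + 1_{τ < t} γ_N(τ, Z^N_τ) / ρ(τ) F(t - τ, X^N_τ)`,
where `X^n_s = x - Z^n_s`. -/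
def sample {Ω : Type*} {d N : ℕ} [NeZero N] (γ : Fin N → ℝ → Space d → ℝ) (ρ : ℝ → ℝ)
    (f : Fin N → Space d → ℝ) (F : ℝ → Space d → ℝ)
    (τ : Ω → ℝ) (I : Ω → Fin N) (Z : Fin N → ℝ → Ω → Space d)
    (t : ℝ) (x : Space d) (ω : Ω) : ℝ :=
  (if t ≤ τ ω then γ (I ω) t (Z (I ω) t ω) / tail ρ t * f (I ω) (x - Z (I ω) t ω) else 0)
    + (if τ ω < t then γ ⊤ (τ ω) (Z ⊤ (τ ω) ω) / ρ (τ ω) * F (t - τ ω) (x - Z ⊤ (τ ω) ω) else 0)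

end CauchyProblem

end

open CauchyProblem

open MeasureTheory ProbabilityTheory Set
open scoped SchwartzMap FourierTransform LineDeriv BoundedContinuousFunction NNReal ENNReal

noncomputable section

namespace CauchyProblem

/-! The expectation is Duhamel's formula in disguise. On `{τ ≥ t}` the independence of `I`, `τ` and
the displacements produces the weights `p n`, and division by the tail cancels the probability of
the event; what is left is the sum of `p_n (g_n(t) * f_n)(x)`. On `{τ < t}` the density of `τ`
cancels the division by `ρ(τ)` and leaves the time integral of `(g_N(s) * F(t - s))(x)`. This is
`sample_expectation`. It remains to show that `duhamel` is a bounded solution, and that there is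
only one.

Existence. The characteristic function of `g_n(t)` is the `n`-th component of `exp(t Bᵀ) e_1`
(`greenExp_eq_signedChar`). Its linear ODE in `t`, carried through Fourier inversion, becomes a
first-order system for the pairings of `g_n(t) * f` with test functions, in which the symbol acts as
the formal adjoint `adjointOp` on the test function (`greenPairing_evolution`). By pure algebra of
the companion system, each component then solves the scalar equation of order `N`, and its only
nonzero derivative of order below `N` at time zero is the one of its own index (`sum_chain`,
`chain_initial`). The source term is handled by Leibniz's rule. Estimates uniform on `[0, S]` come
from weak continuity in time through Banach–Steinhaus (`exists_signedIntegral_bound`); duality turns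
them into `L¹` bounds on correlations (`integral_abs_correlation_le`), so that data which are merely
bounded and continuous can be paired.

Uniqueness. For the difference `w` of two solutions and `L` the formal adjoint, the functions
`y_m(t) = ⟨w(t), L^m φ⟩` satisfy `∑ a_n y_m^{(n)} = y_{m+1}` with zero initial data. If the Fourier
transform of `φ` has compact support, `‖L^m φ‖₁` grows at most geometrically
(`exists_integral_norm_adjointOp_pow_le`), and iterating an exponential ODE estimate forces `y_0 =
0` (`eq_zero_of_hierarchy`). Translates and dilates of one such `φ` form an approximate identity,
hence `w = 0`. -/

/-! ### Differential operators on Schwartz functions -/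

section Operators

variable {d : ℕ} {V W : Type*} [NormedAddCommGroup V] [NormedSpace ℝ V] [NormedAddCommGroup W]
  [NormedSpace ℝ W]

/-- The `i`-th partial derivative, as a linear endomorphism of the Schwartz space. -/
def partialDeriv (V : Type*) [NormedAddCommGroup V] [NormedSpace ℝ V] {d : ℕ} (i : Fin d) :
    Module.End ℝ 𝓢(Space d, V) :=
  (LineDeriv.lineDerivOpCLM ℝ 𝓢(Space d, V) (EuclideanSpace.single i (1 : ℝ) : Space d)).toLinearMap

/-- The ordered product `D_1^{α_1} ⋯ D_d^{α_d}` of endomorphisms. -/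
def multiPow {X : Type*} [AddCommGroup X] [Module ℝ X] (D : Fin d → Module.End ℝ X)
    (α : Fin d → ℕ) : Module.End ℝ X :=
  ((List.finRange d).map fun i => D i ^ α i).prod

/-- Both ordered products run through the same list, so the relation for single factors passes to
powers and then along the list; additivity of `A` plays no role. The instances are translation,
change of scalars and the Fourier transform. -/
theorem multiPow_intertwine {X Y : Type*} [AddCommGroup X] [Module ℝ X] [AddCommGroup Y]
    [Module ℝ Y] {D : Fin d → Module.End ℝ X} {D' : Fin d → Module.End ℝ Y} {A : X → Y}
    (h : ∀ i v, A (D i v) = D' i (A v)) (α : Fin d → ℕ) (v : X) :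
    A (multiPow D α v) = multiPow D' α (A v) := by
  unfold multiPow
  induction List.finRange d generalizing v with
  | nil => simp
  | cons i l ih =>
    have hp : ∀ (k : ℕ) v, A ((D i ^ k) v) = (D' i ^ k) (A v) := by
      intro k
      induction k with
      | zero => simp
      | succ k ihk => intro v; rw [pow_succ, pow_succ, Module.End.mul_apply, ihk, h]; rfl
    simp only [List.map_cons, List.prod_cons, Module.End.mul_apply]
    rw [hp, ih]

theorem multiDeriv_eq (α : Fin d → ℕ) (φ : 𝓢(Space d, ℝ)) :
    multiDeriv α φ = multiPow (partialDeriv ℝ) α φ := by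
  unfold multiDeriv multiPow
  induction List.finRange d with
  | nil => simp
  | cons i l ih =>
    simp only [List.foldr_cons, List.map_cons, List.prod_cons, Module.End.mul_apply]
    rw [ih, Module.End.pow_apply]
    rfl

/-- The formal adjoint `∑ b_α (-1)^{|α|} D^α` of `∑ b_α D^α`. -/
def adjointOp (V : Type*) [NormedAddCommGroup V] [NormedSpace ℝ V] (M : ℕ)
    (b : (Fin d → ℕ) → ℝ) : Module.End ℝ 𝓢(Space d, V) :=
  ∑ α ∈ multiIndices d M, (b α * (-1) ^ multiLength α) • multiPow (partialDeriv V) α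

theorem adjointOp_intertwine (M : ℕ) (b : (Fin d → ℕ) → ℝ) {A : 𝓢(Space d, V) →ₗ[ℝ] 𝓢(Space d, W)}
    (h : ∀ i v, A (partialDeriv V i v) = partialDeriv W i (A v)) (ψ : 𝓢(Space d, V)) :
    A (adjointOp V M b ψ) = adjointOp W M b (A ψ) := by
  simp only [adjointOp, LinearMap.sum_apply, LinearMap.smul_apply, map_sum, map_smul]
  exact Finset.sum_congr rfl fun α _ => by rw [multiPow_intertwine h]

theorem partialDeriv_apply (i : Fin d) (ψ : 𝓢(Space d, V)) (x : Space d) :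
    partialDeriv V i ψ x = fderiv ℝ ψ x (EuclideanSpace.single i 1) :=
  SchwartzMap.lineDerivOp_apply_eq_fderiv _ _ _

theorem adjointOp_postcomp (M : ℕ) (b : (Fin d → ℕ) → ℝ) (A : V →L[ℝ] W) (ψ : 𝓢(Space d, V)) :
    (adjointOp V M b ψ).postcompCLM A = adjointOp W M b (ψ.postcompCLM A) := by
  refine adjointOp_intertwine M b (A := (SchwartzMap.postcompCLM A).toLinearMap) ?_ ψ
  intro i v
  ext x
  simp only [ContinuousLinearMap.coe_coe, SchwartzMap.postcompCLM_apply, partialDeriv_apply]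
  have : (fun y => (SchwartzMap.postcompCLM A) v y) = fun y => A (v y) := by
    ext y; simp
  rw [show ⇑((SchwartzMap.postcompCLM A) v) = fun y => A (v y) from this]
  have h2 := (A.hasFDerivAt (x := v x)).comp x (v.differentiableAt (x := x)).hasFDerivAt
  have h3 : fderiv ℝ (fun y => A (v y)) x = A.comp (fderiv ℝ v x) := h2.fderiv
  rw [h3]; rfl

/-- Constant coefficients commute with translations. This upgrades an identity tested at the origin
to one for the correlation at every point. -/
theorem adjointOp_translate (M : ℕ) (b : (Fin d → ℕ) → ℝ) (c : Space d) (ψ : 𝓢(Space d, V)) :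
    (adjointOp V M b ψ).compSubConstCLM ℝ c = adjointOp V M b (ψ.compSubConstCLM ℝ c) := by
  refine adjointOp_intertwine M b (A := (SchwartzMap.compSubConstCLM ℝ c).toLinearMap) ?_ ψ
  intro i v
  ext x
  simp only [ContinuousLinearMap.coe_coe, SchwartzMap.compSubConstCLM_apply, partialDeriv_apply]
  rw [show ⇑((SchwartzMap.compSubConstCLM ℝ c) v) = fun y => v (y - c) from rfl,
    fderiv_comp_sub]

/-- Multiplication by `2πi ξ_i`. -/
def fourierMul (i : Fin d) : Module.End ℝ 𝓢(Space d, ℂ) :=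
  ((2 * Real.pi * Complex.I : ℂ) • SchwartzMap.smulLeftCLM ℂ
    (fun ξ : Space d => inner ℝ ξ (EuclideanSpace.single i 1)) : 
      𝓢(Space d, ℂ) →L[ℝ] 𝓢(Space d, ℂ)).toLinearMap

theorem fourierMul_apply (i : Fin d) (χ : 𝓢(Space d, ℂ)) (ξ : Space d) :
    fourierMul i χ ξ = (2 * Real.pi * Complex.I) * ξ i * χ ξ := by
  have : (fun ξ : Space d => inner ℝ ξ (EuclideanSpace.single i (1 : ℝ) : Space d)).HasTemperateGrowth := by
    fun_prop
  have h : fourierMul i χ ξ = (2 * Real.pi * Complex.I : ℂ) • SchwartzMap.smulLeftCLM ℂ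
    (fun ξ : Space d => inner ℝ ξ (EuclideanSpace.single i (1 : ℝ) : Space d)) χ ξ := rfl
  rw [h, SchwartzMap.smulLeftCLM_apply_apply this, EuclideanSpace.inner_single_right, smul_eq_mul,
    Complex.real_smul]
  simp [mul_assoc]

theorem multiPow_fourierMul_apply (α : Fin d → ℕ) (χ : 𝓢(Space d, ℂ)) (ξ : Space d) :
    multiPow fourierMul α χ ξ =
      (2 * Real.pi * Complex.I) ^ multiLength α * (∏ i, (ξ i : ℂ) ^ α i) * χ ξ := by
  have key : ∀ l : List (Fin d), (l.map fun i => fourierMul i ^ α i).prod χ ξ =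
      (l.map fun i => (2 * Real.pi * Complex.I : ℂ) ^ α i * (ξ i : ℂ) ^ α i).prod * χ ξ := by
    intro l
    induction l with
    | nil => simp
    | cons i l ih =>
      have hp : ∀ (k : ℕ) (χ : 𝓢(Space d, ℂ)), (fourierMul i ^ k) χ ξ =
          (2 * Real.pi * Complex.I : ℂ) ^ k * (ξ i : ℂ) ^ k * χ ξ := by
        intro k
        induction k with
        | zero => simp
        | succ k ihk =>
          intro χ
          rw [pow_succ, Module.End.mul_apply, ihk, fourierMul_apply]
          ring
      simp only [List.map_cons, List.prod_cons, Module.End.mul_apply]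
      rw [hp, ih]
      ring
  rw [multiPow, key, ← List.ofFn_eq_map, List.prod_ofFn, Finset.prod_mul_distrib,
    Finset.prod_pow_eq_pow_sum]
  rfl

/-- With the kernel `exp(-2πi x·ξ)`, `D^α` becomes `(2πi)^{|α|} ξ^α`, and `(-1)^{|α|} (2πi)^{|α|}
ξ^α = i^{|α|} (-2πξ)^α`. The sign of the adjoint and the normalization are thus both absorbed in the
argument of the symbol. -/
theorem fourier_adjointOp (M : ℕ) (b : (Fin d → ℕ) → ℝ) (ψ : 𝓢(Space d, ℂ)) (ξ : Space d) :
    𝓕 (adjointOp ℂ M b ψ) ξ = symbol M b (-(2 * Real.pi) • ξ) * 𝓕 ψ ξ := by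
  have h1 : 𝓕 (adjointOp ℂ M b ψ) = ∑ α ∈ multiIndices d M,
      (b α * (-1) ^ multiLength α) • multiPow fourierMul α (𝓕 ψ) := by
    change (FourierTransform.fourierCLM ℝ 𝓢(Space d, ℂ)) (adjointOp ℂ M b ψ) = _
    simp only [adjointOp, LinearMap.sum_apply, LinearMap.smul_apply, map_sum, map_smul]
    refine Finset.sum_congr rfl fun α _ => ?_
    rw [multiPow_intertwine (D' := fourierMul)
      (A := (FourierTransform.fourierCLM ℝ 𝓢(Space d, ℂ)))]
    · rfl
    · intro i v
      exact SchwartzMap.fourier_lineDerivOp_eq v _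
  rw [h1, symbol, Finset.sum_mul]
  simp only [sum_apply, smul_apply, multiPow_fourierMul_apply]
  refine Finset.sum_congr rfl fun α _ => ?_
  have h2 : ∏ i, (((-(2 * Real.pi) • ξ) i : ℝ) : ℂ) ^ α i =
      (-(2 * Real.pi)) ^ multiLength α * ∏ i, (ξ i : ℂ) ^ α i := by
    rw [multiLength, ← Finset.prod_pow_eq_pow_sum, ← Finset.prod_mul_distrib]
    refine Finset.prod_congr rfl fun i _ => ?_
    rw [← mul_pow]; simp
  rw [h2, Complex.real_smul]
  push_cast
  rw [mul_pow, neg_pow (2 * (Real.pi : ℂ))]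
  ring

end Operators

/-! ### Band-limited Schwartz functions -/

section BandLimited

variable {d : ℕ}

theorem integral_norm_convolution_le (f g : 𝓢(Space d, ℂ)) :
    ∫ x, ‖SchwartzMap.convolution (ContinuousLinearMap.mul ℂ ℂ) f g x‖ ≤
      (∫ x, ‖f x‖) * ∫ x, ‖g x‖ := by
  have hi := (f.integrable (μ := volume)).norm.integrable_convolution (ContinuousLinearMap.mul ℝ ℝ)
    (g.integrable (μ := volume)).norm
  have h1 := integral_convolution (ContinuousLinearMap.mul ℝ ℝ) (f.integrable (μ := volume)).norm
    (g.integrable (μ := volume)).norm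
  simp only [ContinuousLinearMap.mul_apply'] at h1
  rw [← h1]
  refine integral_mono (SchwartzMap.integrable _).norm hi fun x => ?_
  simp only [SchwartzMap.convolution_apply, convolution]
  refine (norm_integral_le_integral_norm _).trans (le_of_eq ?_)
  simp

/-- A Bernstein-type inequality. Let `θ` have Fourier transform equal to one on the support of `𝓕
ψ`. Then `L^{m+1} ψ` is the convolution of `L^m ψ` with `L θ`, so each power of the operator `L`
costs at most the factor `R = ‖L θ‖₁`. -/
theorem exists_integral_norm_adjointOp_pow_le (M : ℕ) (b : (Fin d → ℕ) → ℝ) (ψ : 𝓢(Space d, ℂ))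
    (hψ : HasCompactSupport (𝓕 ψ : 𝓢(Space d, ℂ))) :
    ∃ R : ℝ, 0 ≤ R ∧ ∀ m : ℕ, ∫ x, ‖(adjointOp ℂ M b ^ m) ψ x‖ ≤ (∫ x, ‖ψ x‖) * R ^ m := by
  obtain ⟨r, hr⟩ := hψ.isCompact.isBounded.subset_closedBall (0 : Space d)
  -- The maximum with `1` keeps the inner radius positive, since `r` may be zero or negative.
  let β : ContDiffBump (0 : Space d) := ⟨max r 1, max r 1 + 1, by positivity, by linarith⟩
  let ϑ₀ : Space d → ℂ := fun x => (β x : ℂ)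
  have hϑc : HasCompactSupport ϑ₀ := by
    refine β.hasCompactSupport.comp_left (g := fun t : ℝ => (t : ℂ)) (by simp)
  have hϑs : ContDiff ℝ ((⊤ : ℕ∞) : WithTop ℕ∞) ϑ₀ := Complex.ofRealCLM.contDiff.comp β.contDiff
  let ϑ : 𝓢(Space d, ℂ) := hϑc.toSchwartzMap hϑs
  let θ : 𝓢(Space d, ℂ) := 𝓕⁻ ϑ
  have hθ : 𝓕 θ = ϑ := FourierTransform.fourier_fourierInv_eq ϑ
  have hϑ1 : ∀ ξ, 𝓕 ψ ξ * ϑ ξ = 𝓕 ψ ξ := by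
    intro ξ
    by_cases h : 𝓕 ψ ξ = 0
    · simp [h]
    · have hmem : ξ ∈ Metric.closedBall (0 : Space d) r := hr (subset_tsupport _ h)
      have : ϑ ξ = 1 := by
        change ((β ξ : ℝ) : ℂ) = 1
        rw [β.one_of_mem_closedBall (Metric.closedBall_subset_closedBall (le_max_left r 1) hmem)]
        simp
      rw [this, mul_one]
  have hpow : ∀ (m : ℕ) ξ, 𝓕 ((adjointOp ℂ M b ^ m) ψ) ξ =
      symbol M b (-(2 * Real.pi) • ξ) ^ m * 𝓕 ψ ξ := by
    intro m ξ
    induction m with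
    | zero => simp
    | succ m ih => rw [pow_succ', Module.End.mul_apply, fourier_adjointOp, ih]; ring
  refine ⟨∫ x, ‖adjointOp ℂ M b θ x‖, by positivity, fun m => ?_⟩
  induction m with
  | zero => simp
  | succ m ih =>
    have h1 : (adjointOp ℂ M b ^ (m + 1)) ψ = SchwartzMap.convolution (ContinuousLinearMap.mul ℂ ℂ)
        ((adjointOp ℂ M b ^ m) ψ) (adjointOp ℂ M b θ) := by
      have h2 : 𝓕 ((adjointOp ℂ M b ^ (m + 1)) ψ) = 𝓕 (SchwartzMap.convolution
          (ContinuousLinearMap.mul ℂ ℂ) ((adjointOp ℂ M b ^ m) ψ) (adjointOp ℂ M b θ)) := by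
        rw [SchwartzMap.fourier_convolution]
        ext ξ
        rw [SchwartzMap.pairing_apply_apply, hpow, hpow, fourier_adjointOp, hθ]
        simp only [ContinuousLinearMap.mul_apply']
        rw [pow_succ, ← hϑ1 ξ]
        -- After the rewriting the left side carries one factor `ϑ ξ` and the right side two; the
        -- surplus one is absorbed by `𝓕 ψ ξ`.
        linear_combination (-symbol M b (-(2 * Real.pi) • ξ) ^ (m + 1) * ϑ ξ) * hϑ1 ξ
      have h3 := congrArg (fun f : 𝓢(Space d, ℂ) => 𝓕⁻ f) h2
      simpa using h3
    rw [h1]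
    refine (integral_norm_convolution_le _ _).trans ?_
    rw [pow_succ, ← mul_assoc]
    gcongr

end BandLimited

/-! ### Chains of derivatives -/

section Chain

variable {V : Type*}

/-- The `m`-th formal time derivative of the `j`-th component of a solution `X` of the system
`X_0' = X_{N-1} ∘ L`, `X_{j+1}' = X_j - a_{j+1} X_{N-1}`. -/
def chain (N : ℕ) (a : ℕ → ℝ) (L : V → V) (X : ℕ → V → ℝ) : ℕ → ℕ → V → ℝ
  | 0, j, φ => X j φ
  | m + 1, 0, φ => chain N a L X m (N - 1) (L φ)
  | m + 1, j + 1, φ => chain N a L X m j φ - a (j + 1) * chain N a L X m (N - 1) φ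

variable {N : ℕ} {a : ℕ → ℝ} {L : V → V}

/-- Solving `X_{j+1}' = X_j - a_{j+1} X_{N-1}` for `X_j` and descending from `j = N - 1` expresses
every component through derivatives of the last one. Here `i = N - 1 - j`, and `a N = 1` is the
coefficient at the start of the descent. -/
theorem chain_eq_sum_last (ha : a N = 1) (X : ℕ → V → ℝ) (i : ℕ) :
    ∀ (m j : ℕ), j + i + 1 = N → ∀ φ, chain N a L X m j φ =
      ∑ k ∈ Finset.range (i + 1), a (j + 1 + k) * chain N a L X (m + k) (N - 1) φ := by
  induction i with
  | zero => intro m j hj φ; obtain rfl : N - 1 = j := by omega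
            simp [show N - 1 + 1 = N by omega, ha]
  | succ i ih =>
    intro m j hj φ
    have h := ih (m + 1) (j + 1) (by omega) φ
    rw [chain, sub_eq_iff_eq_add] at h
    rw [h, Finset.sum_range_succ' _ (i + 1)]
    congr 1
    refine Finset.sum_congr rfl fun k _ => ?_
    rw [show j + 1 + 1 + k = j + 1 + (k + 1) by ring, show m + 1 + k = m + (k + 1) by ring]

/-- For the last component this is the expansion of `X_0`, differentiated once, because `X_0' =
X_{N-1} ∘ L`. The other components are constant-coefficient combinations of derivatives of the last
one, so they inherit the equation. -/
theorem sum_chain (hN : 0 < N) (ha : a N = 1) (X : ℕ → V → ℝ) (m j : ℕ) (hj : j < N) (φ : V) :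
    ∑ k ∈ Finset.range N, a (k + 1) * chain N a L X (m + (k + 1)) j φ =
      chain N a L X m j (L φ) := by
  have last : ∀ m φ, ∑ k ∈ Finset.range N, a (k + 1) * chain N a L X (m + (k + 1)) (N - 1) φ =
      chain N a L X m (N - 1) (L φ) := by
    intro m φ
    have h := chain_eq_sum_last (L := L) ha X (N - 1) (m + 1) 0 (by omega) φ
    rw [chain, show N - 1 + 1 = N by omega] at h
    rw [h]
    refine Finset.sum_congr rfl fun k _ => ?_
    rw [show 0 + 1 + k = k + 1 by ring, show m + (k + 1) = m + 1 + k by ring]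
  obtain ⟨i, hi⟩ : ∃ i, j + i + 1 = N := ⟨N - j - 1, by omega⟩
  rw [chain_eq_sum_last ha X i m j hi (L φ)]
  simp_rw [← last, chain_eq_sum_last (L := L) ha X i _ j hi φ, Finset.mul_sum]
  rw [Finset.sum_comm]
  refine Finset.sum_congr rfl fun k _ => Finset.sum_congr rfl fun l _ => ?_
  rw [show m + (l + 1) + k = m + k + (l + 1) by ring]
  ring

/-- Each time derivative shifts the initial vector by one slot. Before order `N` the feedback terms
vanish, since the datum reaches the last slot only at order `N - 1`. -/
theorem chain_initial {X : ℕ → V → ℝ} {c : V → ℝ}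
    (hX : ∀ j < N, ∀ φ, X j φ = if j = 0 then c φ else 0) :
    ∀ m < N, ∀ j < N, ∀ φ, chain N a L X m j φ = if j = m then c φ else 0 := by
  intro m
  induction m with
  | zero => intro _ j hj φ; rw [chain, hX j hj]
  | succ m ih =>
    intro hm j hj φ
    have hl : ∀ φ, chain N a L X m (N - 1) φ = 0 := fun φ => by
      rw [ih (by omega) _ (by omega), if_neg (by omega)]
    cases j with
    | zero => rw [chain, hl, if_neg (by omega)]
    | succ j => rw [chain, hl, ih (by omega) j (by omega)]; simp

/-- The first-order system is assumed for all test vectors at once, so it may be applied again with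
`L φ` in place of `φ`; this makes the formal derivatives genuine ones of every order. -/
theorem chain_hasDerivWithinAt {X : ℝ → ℕ → V → ℝ} {s : Set ℝ} {t : ℝ} (hN : 0 < N)
    (hX : ∀ j < N, ∀ φ, HasDerivWithinAt (fun r => X r j φ) (chain N a L (X t) 1 j φ) s t) (m : ℕ) :
    ∀ j < N, ∀ φ, HasDerivWithinAt (fun r => chain N a L (X r) m j φ)
      (chain N a L (X t) (m + 1) j φ) s t := by
  induction m with
  | zero => simpa only [chain] using hX
  | succ m ih =>
    intro j hj φ
    cases j with
    | zero => simp only [chain]; exact ih (N - 1) (by omega) (L φ)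
    | succ j =>
      rw [chain]
      exact (ih j (by omega) φ).sub ((ih (N - 1) (by omega) φ).const_mul _)

theorem chain_continuous {Y : Type*} [TopologicalSpace Y] {X : Y → ℕ → V → ℝ} (hN : 0 < N)
    (hX : ∀ j < N, ∀ φ, Continuous fun y => X y j φ) (m : ℕ) :
    ∀ j < N, ∀ φ, Continuous fun y => chain N a L (X y) m j φ := by
  induction m with
  | zero => simpa only [chain] using hX
  | succ m ih =>
    intro j hj φ
    cases j with
    | zero => simp only [chain]; exact ih (N - 1) (by omega) (L φ)
    | succ j =>
      simp only [chain]
      exact (ih j (by omega) φ).sub ((ih (N - 1) (by omega) φ).const_mul _)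

end Chain

/-! ### Calculus on an interval -/

section Calculus

theorem intervalIntegral_triangle_swap {k : ℝ → ℝ → ℝ} (hk : Continuous (Function.uncurry k))
    {t : ℝ} (ht : 0 ≤ t) :
    ∫ s in (0)..t, ∫ σ in s..t, k s σ = ∫ σ in (0)..t, ∫ s in (0)..σ, k s σ := by
  set μ : Measure ℝ := volume.restrict (Ioc 0 t)
  have hA : MeasurableSet {q : ℝ × ℝ | q.1 < q.2} := measurableSet_lt measurable_fst measurable_snd
  have hi : Integrable (Function.uncurry fun s σ => ({q : ℝ × ℝ | q.1 < q.2}.indicator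
      (Function.uncurry k)) (s, σ)) (μ.prod μ) := by
    change Integrable ({q : ℝ × ℝ | q.1 < q.2}.indicator (Function.uncurry k)) (μ.prod μ)
    refine Integrable.indicator ?_ hA
    rw [Measure.prod_restrict]
    exact (hk.continuousOn.integrableOn_compact (isCompact_Icc.prod isCompact_Icc)).mono_set
      (Set.prod_mono Ioc_subset_Icc_self Ioc_subset_Icc_self)
  have h := integral_integral_swap hi
  rw [intervalIntegral.integral_of_le ht, intervalIntegral.integral_of_le ht]
  convert h using 1
  · refine setIntegral_congr_fun measurableSet_Ioc fun s hs => ?_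
    simp only [intervalIntegral.integral_of_le hs.2]
    have : ∀ σ, ({q : ℝ × ℝ | q.1 < q.2}.indicator (Function.uncurry k)) (s, σ) =
        (Ioi s).indicator (k s) σ := fun σ => by simp [indicator, Function.uncurry]
    simp only [this]
    rw [integral_indicator measurableSet_Ioi, Measure.restrict_restrict measurableSet_Ioi]
    congr 2
    ext σ
    simp only [mem_inter_iff, mem_Ioc, mem_Ioi]
    exact ⟨fun h => ⟨h.1, hs.1.trans h.1, h.2⟩, fun h => ⟨h.1, h.2.2⟩⟩
  · refine setIntegral_congr_fun measurableSet_Ioc fun σ hσ => ?_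
    simp only [intervalIntegral.integral_of_le hσ.1.le]
    have : ∀ s, ({q : ℝ × ℝ | q.1 < q.2}.indicator (Function.uncurry k)) (s, σ) =
        (Iio σ).indicator (fun s => k s σ) s := fun s => by simp [indicator, Function.uncurry]
    simp only [this]
    rw [integral_indicator measurableSet_Iio, Measure.restrict_restrict measurableSet_Iio,
      integral_Ioc_eq_integral_Ioo]
    congr 2
    ext s
    simp only [mem_inter_iff, mem_Ioc, mem_Ioo, mem_Iio]
    exact ⟨fun h => ⟨h.2, h.1, h.2.le.trans hσ.2⟩, fun h => ⟨h.2.1, h.1⟩⟩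

theorem continuous_intervalIntegral_upper {k : ℝ → ℝ → ℝ} (hk : Continuous (Function.uncurry k)) :
    Continuous fun t => ∫ s in (0)..t, k t s :=
  intervalIntegral.continuous_parametric_intervalIntegral_of_continuous hk continuous_id

/-- Leibniz's rule for a convolution in time. -/
theorem hasDerivWithinAt_convolution {S : ℝ} {h h' : ℝ → ℝ → ℝ}
    (hh : Continuous (Function.uncurry h)) (hh' : Continuous (Function.uncurry h'))
    (hd : ∀ s ∈ Icc 0 S, ∀ r ∈ Icc 0 S, HasDerivWithinAt (fun r => h r s) (h' r s) (Icc 0 S) r)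
    {t : ℝ} (ht : t ∈ Icc 0 S) :
    HasDerivWithinAt (fun t => ∫ s in (0)..t, h (t - s) s)
      (h 0 t + ∫ s in (0)..t, h' (t - s) s) (Icc 0 S) t := by
  have hc0 : Continuous fun s => h 0 s := hh.comp (by fun_prop : Continuous fun s : ℝ => ((0:ℝ), s))
  have hk : Continuous (Function.uncurry fun s σ : ℝ => h' (σ - s) s) :=
    hh'.comp (by fun_prop : Continuous fun q : ℝ × ℝ => (q.2 - q.1, q.1))
  have hk' : Continuous (Function.uncurry fun σ s : ℝ => h' (σ - s) s) :=
    hh'.comp (by fun_prop : Continuous fun q : ℝ × ℝ => (q.1 - q.2, q.2))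
  have hG : Continuous fun σ => h 0 σ + ∫ s in (0)..σ, h' (σ - s) s :=
    hc0.add (continuous_intervalIntegral_upper hk')
  -- Expanding `h (t - s) s` as `h 0 s` plus the integral of `h'` and exchanging integrals over the
  -- triangle exhibits the convolution as the primitive of a continuous function, to which the
  -- fundamental theorem applies.
  have key : ∀ t ∈ Icc 0 S, ∫ s in (0)..t, h (t - s) s =
      ∫ σ in (0)..t, (h 0 σ + ∫ s in (0)..σ, h' (σ - s) s) := by
    intro t ht
    have h1 : ∀ s ∈ uIcc 0 t, h (t - s) s = h 0 s + ∫ σ in s..t, h' (σ - s) s := by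
      intro s hs
      rw [uIcc_of_le ht.1] at hs
      have hcs : ContinuousOn (fun r => h r s) (Icc 0 (t - s)) :=
        (hh.comp (by fun_prop : Continuous fun r : ℝ => (r, s))).continuousOn
      have hcs' : Continuous fun r => h' r s :=
        hh'.comp (by fun_prop : Continuous fun r : ℝ => (r, s))
      have := intervalIntegral.integral_eq_sub_of_hasDerivAt_of_le (a := 0) (b := t - s)
        (f := fun r => h r s) (f' := fun r => h' r s) (by linarith [hs.2]) hcs
        (fun r hr => (hd s ⟨hs.1, hs.2.trans ht.2⟩ r
          ⟨hr.1.le, by linarith [hr.2, hs.1, ht.2]⟩).hasDerivAt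
          (Icc_mem_nhds hr.1 (by linarith [hr.2, hs.1, ht.2])))
        (hcs'.intervalIntegrable _ _)
      rw [intervalIntegral.integral_comp_sub_right (fun r => h' r s), sub_self, this]
      ring
    rw [intervalIntegral.integral_congr h1]
    have hc2 : Continuous fun s => ∫ σ in s..t, h' (σ - s) s :=
      by
        have := intervalIntegral.continuous_parametric_intervalIntegral_of_continuous
          (μ := volume) (a₀ := t) hk (s := fun s : ℝ => s) continuous_id
        simp_rw [intervalIntegral.integral_symm t]
        exact this.neg
    rw [intervalIntegral.integral_add (hc0.intervalIntegrable _ _) (hc2.intervalIntegrable _ _),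
      intervalIntegral_triangle_swap hk ht.1,
      intervalIntegral.integral_add (hc0.intervalIntegrable _ _)
        ((continuous_intervalIntegral_upper hk').intervalIntegrable _ _)]
  refine HasDerivWithinAt.congr_of_mem (f := fun t => ∫ σ in (0)..t,
    (h 0 σ + ∫ s in (0)..σ, h' (σ - s) s)) ?_ key ht
  exact (intervalIntegral.integral_hasDerivAt_right (hG.intervalIntegrable _ _)
    (hG.stronglyMeasurableAtFilter _ _) hG.continuousAt).hasDerivWithinAt

/-- A finite chain of derivatives on an interval with continuous last member. -/
theorem contDiffOn_iteratedDerivWithin_of_chain {S : ℝ} (hS : 0 < S) (n : ℕ) {E : ℕ → ℝ → ℝ}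
    (hE : ∀ k < n, ∀ t ∈ Icc 0 S, HasDerivWithinAt (E k) (E (k + 1) t) (Icc 0 S) t)
    (hc : ContinuousOn (E n) (Icc 0 S)) :
    ContDiffOn ℝ n (E 0) (Icc 0 S) ∧
      ∀ k ≤ n, ∀ t ∈ Icc 0 S, iteratedDerivWithin k (E 0) (Icc 0 S) t = E k t := by
  have hu := uniqueDiffOn_Icc hS
  have hi : ∀ k ≤ n, ∀ t ∈ Icc 0 S, iteratedDerivWithin k (E 0) (Icc 0 S) t = E k t := by
    intro k
    induction k with
    | zero => intro _ t _; simp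
    | succ k ih =>
      intro hk t ht
      rw [iteratedDerivWithin_succ, derivWithin_congr (ih (by omega)) (ih (by omega) t ht)]
      exact (hE k (by omega) t ht).derivWithin (hu t ht)
  refine ⟨?_, hi⟩
  refine (contDiffOn_iff_continuousOn_differentiableOn_deriv hu).2 ⟨fun m hm => ?_, fun m hm => ?_⟩
  · have hm' : m ≤ n := by exact_mod_cast hm
    refine ContinuousOn.congr ?_ (hi m hm')
    rcases hm'.lt_or_eq with h | rfl
    · exact fun t ht => (hE m h t ht).continuousWithinAt
    · exact hc
  · have hm' : m < n := by exact_mod_cast hm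
    exact fun t ht => ((hE m hm' t ht).differentiableWithinAt.congr (hi m hm'.le)
      (hi m hm'.le t ht))

end Calculus

/-! ### Integration against signed measures -/

section Signed

variable {d : ℕ} {V : Type*} [NormedAddCommGroup V] [NormedSpace ℝ V]

theorem signedIntegral_add {g : SignedMeasure (Space d)} {f₁ f₂ : Space d → V}
    (h₁ : Integrable f₁ g.totalVariation) (h₂ : Integrable f₂ g.totalVariation) :
    signedIntegral g (fun z => f₁ z + f₂ z) = signedIntegral g f₁ + signedIntegral g f₂ := by
  have h₁' := integrable_add_measure.1 h₁
  have h₂' := integrable_add_measure.1 h₂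
  simp only [signedIntegral]
  rw [integral_add h₁'.1 h₂'.1, integral_add h₁'.2 h₂'.2]
  abel

theorem signedIntegral_smul (g : SignedMeasure (Space d)) (c : ℝ) (f : Space d → V) :
    signedIntegral g (fun z => c • f z) = c • signedIntegral g f := by
  simp only [signedIntegral, integral_smul, smul_sub]

theorem norm_signedIntegral_le (g : SignedMeasure (Space d)) {f : Space d → V} {C : ℝ}
    (hC : ∀ z, ‖f z‖ ≤ C) :
    ‖signedIntegral g f‖ ≤ C * (g.totalVariation univ).toReal := by
  have h1 := norm_integral_le_of_norm_le_const (μ := g.toJordanDecomposition.posPart)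
    (Filter.Eventually.of_forall hC)
  have h2 := norm_integral_le_of_norm_le_const (μ := g.toJordanDecomposition.negPart)
    (Filter.Eventually.of_forall hC)
  rw [SignedMeasure.totalVariation, Measure.add_apply,
    ENNReal.toReal_add (measure_ne_top _ _) (measure_ne_top _ _), mul_add]
  exact (norm_sub_le _ _).trans (add_le_add h1 h2)

instance (g : SignedMeasure (Space d)) : IsFiniteMeasure g.totalVariation := by
  unfold SignedMeasure.totalVariation; infer_instance

/-- Integration against a signed measure as a functional on bounded continuous functions. -/
def signedCLM (g : SignedMeasure (Space d)) : (Space d →ᵇ ℝ) →L[ℝ] ℝ :=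
  LinearMap.mkContinuous
    { toFun := fun f => signedIntegral g f
      map_add' := fun f₁ f₂ => signedIntegral_add (f₁.integrable _) (f₂.integrable _)
      map_smul' := fun c f => signedIntegral_smul g c f }
    (g.totalVariation univ).toReal
    (fun f => by
      rw [mul_comm]
      exact norm_signedIntegral_le g f.norm_coe_le_norm)

/-- A pointwise bounded family of signed measures is bounded in the dual of the bounded continuous
functions. -/
theorem exists_signedIntegral_bound {ι : Type*} (g : ι → SignedMeasure (Space d))
    (h : ∀ f : Space d →ᵇ ℝ, ∃ C, ∀ i, |signedIntegral (g i) f| ≤ C) :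
    ∃ C, 0 ≤ C ∧ ∀ i, ∀ f : Space d →ᵇ ℝ, |signedIntegral (g i) f| ≤ C * ‖f‖ := by
  obtain ⟨C, hC⟩ := banach_steinhaus (g := fun i => signedCLM (g i)) h
  exact ⟨max C 0, le_max_right _ _, fun i f =>
    ((signedCLM (g i)).le_opNorm f).trans (mul_le_mul_of_nonneg_right
      ((hC i).trans (le_max_left _ _)) (norm_nonneg f))⟩

theorem continuous_signedIntegral {Y : Type*} [TopologicalSpace Y] [FirstCountableTopology Y]
    (g : SignedMeasure (Space d)) {k : Y → Space d → V} (hk : Continuous (Function.uncurry k))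
    {C : ℝ} (hC : ∀ y z, ‖k y z‖ ≤ C) [SecondCountableTopology V] [MeasurableSpace V]
    [BorelSpace V] : Continuous fun y => signedIntegral g (k y) := by
  have key : ∀ ν : Measure (Space d), IsFiniteMeasure ν → Continuous fun y => ∫ z, k y z ∂ν := by
    intro ν _
    refine continuous_of_dominated (bound := fun _ => C) (fun y => ?_)
      (fun y => Filter.Eventually.of_forall (hC y)) (integrable_const C)
      (Filter.Eventually.of_forall fun z => ?_)
    · exact (hk.comp (by fun_prop : Continuous fun z => (y, z))).aestronglyMeasurable
    · exact hk.comp (by fun_prop : Continuous fun y => (y, z))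
  exact (key _ inferInstance).sub (key _ inferInstance)

/-- Fubini's theorem for a signed measure and the Lebesgue measure. -/
theorem integral_signedIntegral_swap {Y : Type*} [MeasurableSpace Y] {μ : Measure Y} [SFinite μ]
    (g : SignedMeasure (Space d)) {k : Y → Space d → V}
    (hk : Integrable (Function.uncurry k) (μ.prod g.totalVariation)) [CompleteSpace V] :
    ∫ y, signedIntegral g (k y) ∂μ = signedIntegral g fun z => ∫ y, k y z ∂μ := by
  have h1 : Integrable (Function.uncurry k) (μ.prod g.toJordanDecomposition.posPart) :=
    hk.mono_measure (Measure.prod_mono le_rfl (Measure.le_add_right le_rfl))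
  have h2 : Integrable (Function.uncurry k) (μ.prod g.toJordanDecomposition.negPart) :=
    hk.mono_measure (Measure.prod_mono le_rfl (Measure.le_add_left le_rfl))
  simp only [signedIntegral]
  have h1' : Integrable (fun y => ∫ z, k y z ∂g.toJordanDecomposition.posPart) μ :=
    h1.integral_prod_left
  have h2' : Integrable (fun y => ∫ z, k y z ∂g.toJordanDecomposition.negPart) μ :=
    h2.integral_prod_left
  rw [integral_sub h1' h2', integral_integral_swap h1, integral_integral_swap h2]

theorem integrable_signedIntegral {Y : Type*} [MeasurableSpace Y] {μ : Measure Y} [SFinite μ]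
    (g : SignedMeasure (Space d)) {k : Y → Space d → V}
    (hk : Integrable (Function.uncurry k) (μ.prod g.totalVariation)) :
    Integrable (fun y => signedIntegral g (k y)) μ := by
  have h1 : Integrable (Function.uncurry k) (μ.prod g.toJordanDecomposition.posPart) :=
    hk.mono_measure (Measure.prod_mono le_rfl (Measure.le_add_right le_rfl))
  have h2 : Integrable (Function.uncurry k) (μ.prod g.toJordanDecomposition.negPart) :=
    hk.mono_measure (Measure.prod_mono le_rfl (Measure.le_add_left le_rfl))
  exact h1.integral_prod_left.sub h2.integral_prod_left

/-- The bounded continuous function `z ↦ φ(y + z)`. -/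
def shifted (φ : 𝓢(Space d, ℝ)) (y : Space d) : 𝓢(Space d, ℝ) :=
  φ.compSubConstCLM ℝ (-y)

theorem shifted_apply (φ : 𝓢(Space d, ℝ)) (y z : Space d) : shifted φ y z = φ (y + z) := by
  simp [shifted, add_comm]

/-- The correlation `y ↦ ∫ φ(y + z) g(dz)`. -/
def correlation (g : SignedMeasure (Space d)) (φ : 𝓢(Space d, ℝ)) (y : Space d) : ℝ :=
  signedIntegral g (shifted φ y)

theorem exists_norm_le_schwartz (φ : 𝓢(Space d, V)) : ∃ C, 0 ≤ C ∧ ∀ x, ‖φ x‖ ≤ C :=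
  ⟨_, apply_nonneg _ φ, SchwartzMap.norm_le_seminorm ℝ φ⟩

theorem integrable_prod_shifted (g : SignedMeasure (Space d)) (φ : 𝓢(Space d, ℝ)) :
    Integrable (Function.uncurry fun y z => shifted φ y z)
      ((volume : Measure (Space d)).prod g.totalVariation) := by
  have hc : Continuous (Function.uncurry fun y z => shifted φ y z) := by
    simp only [Function.uncurry_def, shifted_apply]
    exact φ.continuous.comp (continuous_fst.add continuous_snd)
  rw [integrable_prod_iff' hc.aestronglyMeasurable]
  simp only [Function.uncurry, shifted_apply]
  refine ⟨Filter.Eventually.of_forall fun z => φ.integrable.comp_add_right z, ?_⟩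
  simp_rw [integral_add_right_eq_self fun y => ‖φ y‖]
  exact integrable_const _

theorem continuous_correlation (g : SignedMeasure (Space d)) (φ : 𝓢(Space d, ℝ)) :
    Continuous (correlation g φ) := by
  obtain ⟨C, _, hC⟩ := exists_norm_le_schwartz φ
  refine continuous_signedIntegral g (k := fun y z => shifted φ y z) (C := C) ?_ ?_
  · simp only [Function.uncurry_def, shifted_apply]
    exact φ.continuous.comp (continuous_fst.add continuous_snd)
  · intro y z; rw [shifted_apply]; exact hC _

theorem integrable_correlation (g : SignedMeasure (Space d)) (φ : 𝓢(Space d, ℝ)) :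
    Integrable (correlation g φ) :=
  integrable_signedIntegral g (integrable_prod_shifted g φ)

/-- Fubini and a translation: correlation is the adjoint of convolution. The pairing with `g * f`
becomes an integral of the bounded `f` against an `L¹` function that depends only on `g` and `φ`. -/
theorem integral_bounded_mul_correlation (g : SignedMeasure (Space d)) (f : Space d →ᵇ ℝ)
    (φ : 𝓢(Space d, ℝ)) :
    ∫ y, f y * correlation g φ y = ∫ x, signedConv g f x * φ x := by
  have hp := integrable_prod_shifted g φ
  have hi1 : Integrable (Function.uncurry fun y z => f y * shifted φ y z)
      ((volume : Measure (Space d)).prod g.totalVariation) :=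
    hp.bdd_mul (c := ‖f‖) (f.continuous.comp continuous_fst).aestronglyMeasurable
      (Filter.Eventually.of_forall fun q => f.norm_coe_le_norm _)
  have hi2 : Integrable (Function.uncurry fun x z => f (x - z) * φ x)
      ((volume : Measure (Space d)).prod g.totalVariation) := by
    have : Integrable (fun q : Space d × Space d => φ q.1)
        ((volume : Measure (Space d)).prod g.totalVariation) := φ.integrable.comp_fst _
    exact this.bdd_mul (c := ‖f‖)
      (f.continuous.comp (continuous_fst.sub continuous_snd)).aestronglyMeasurable
      (Filter.Eventually.of_forall fun q => f.norm_coe_le_norm _)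
  calc ∫ y, f y * correlation g φ y = ∫ y, signedIntegral g fun z => f y * shifted φ y z := by
        simp only [correlation, ← smul_eq_mul, signedIntegral_smul]
    _ = signedIntegral g fun z => ∫ y, f y * shifted φ y z := integral_signedIntegral_swap g hi1
    _ = signedIntegral g fun z => ∫ x, f (x - z) * φ x := by
        congr 1
        ext z
        rw [← integral_add_right_eq_self (fun x => f (x - z) * φ x) z]
        simp [shifted_apply]
    _ = ∫ x, signedIntegral g fun z => f (x - z) * φ x := (integral_signedIntegral_swap g hi2).symm
    _ = ∫ x, signedConv g f x * φ x := by
        refine integral_congr_ae (Filter.Eventually.of_forall fun x => ?_)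
        simp only [signedConv, mul_comm _ (φ x), ← smul_eq_mul, signedIntegral_smul]

/-- The reflected translate `z ↦ f(x - z)` of a bounded continuous function. -/
def reflected (f : Space d →ᵇ ℝ) (x : Space d) : Space d →ᵇ ℝ :=
  f.compContinuous ⟨fun z => x - z, by fun_prop⟩

theorem norm_reflected_le (f : Space d →ᵇ ℝ) (x : Space d) : ‖reflected f x‖ ≤ ‖f‖ :=
  (BoundedContinuousFunction.norm_le (norm_nonneg f)).2 fun z => f.norm_coe_le_norm (x - z)

theorem abs_signedConv_le {g : SignedMeasure (Space d)} {C : ℝ} (hC0 : 0 ≤ C)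
    (hC : ∀ f : Space d →ᵇ ℝ, |signedIntegral g f| ≤ C * ‖f‖) (f : Space d →ᵇ ℝ) (x : Space d) :
    |signedConv g f x| ≤ C * ‖f‖ :=
  (hC (reflected f x)).trans (mul_le_mul_of_nonneg_left (norm_reflected_le f x) hC0)

theorem continuous_signedConv (g : SignedMeasure (Space d)) (f : Space d →ᵇ ℝ) :
    Continuous (signedConv g f) :=
  continuous_signedIntegral g (k := fun x z => f (x - z)) (C := ‖f‖)
    (f.continuous.comp (continuous_fst.sub continuous_snd)) fun _ _ => f.norm_coe_le_norm _

/-- The correlation is bounded in `L¹` by the norm of the signed measure as a functional on the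
bounded continuous functions. -/
theorem integral_abs_correlation_le {g : SignedMeasure (Space d)} {C : ℝ} (hC0 : 0 ≤ C)
    (hC : ∀ f : Space d →ᵇ ℝ, |signedIntegral g f| ≤ C * ‖f‖) (φ : 𝓢(Space d, ℝ)) :
    ∫ y, |correlation g φ y| ≤ C * ∫ x, |φ x| := by
  set h := correlation g φ with hdef
  have hcont : Continuous h := continuous_correlation g φ
  have hint : Integrable h := integrable_correlation g φ
  have hε : ∀ k : ℕ, (0 : ℝ) < 1 / ((k : ℝ) + 1) := fun k => Nat.one_div_pos_of_nat
  have hpos : ∀ (k : ℕ) y, 0 < |h y| + 1 / ((k : ℝ) + 1) := fun k y => by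
    have := hε k; positivity
  have hle : ∀ (k : ℕ) y, ‖h y / (|h y| + 1 / ((k : ℝ) + 1))‖ ≤ 1 := fun k y => by
    rw [Real.norm_eq_abs, abs_div, abs_of_pos (hpos k y)]
    exact div_le_one_of_le₀ (by linarith [hε k]) (hpos k y).le
  -- Continuous approximations of the sign of `h`, of norm at most one. They are needed because `C`
  -- controls `g` on continuous test functions only.
  let f : ℕ → Space d →ᵇ ℝ := fun k => BoundedContinuousFunction.ofNormedAddCommGroup
    (fun y => h y / (|h y| + 1 / ((k : ℝ) + 1)))
    (hcont.div (hcont.abs.add continuous_const) fun y => (hpos k y).ne') 1 (hle k)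
  have hf1 : ∀ k, ‖f k‖ ≤ 1 := fun k =>
    (BoundedContinuousFunction.norm_le zero_le_one).2 (hle k)
  have hlim : Filter.Tendsto (fun k => ∫ y, f k y * h y) Filter.atTop (nhds (∫ y, |h y|)) := by
    refine tendsto_integral_of_dominated_convergence (fun y => |h y|)
      (fun k => ((f k).continuous.mul hcont).aestronglyMeasurable) hint.abs (fun k => ?_) ?_
    · refine Filter.Eventually.of_forall fun y => ?_
      rw [norm_mul, ← Real.norm_eq_abs]
      exact mul_le_of_le_one_left (norm_nonneg _) (hle k y)
    · refine Filter.Eventually.of_forall fun y => ?_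
      change Filter.Tendsto (fun k : ℕ => h y / (|h y| + 1 / ((k : ℝ) + 1)) * h y) _ _
      by_cases h0 : h y = 0
      · simp [h0]
      · have h1 : Filter.Tendsto (fun k : ℕ => h y / (|h y| + 1 / ((k : ℝ) + 1)) * h y)
            Filter.atTop (nhds (h y / (|h y| + 0) * h y)) :=
          ((tendsto_const_nhds).div (tendsto_const_nhds.add tendsto_one_div_add_atTop_nhds_zero_nat)
            (by simpa using h0)).mul_const _
        convert h1 using 2
        rw [add_zero, div_mul_eq_mul_div, eq_div_iff (by simpa using h0), abs_mul_abs_self]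
  refine le_of_tendsto' hlim fun k => ?_
  rw [hdef, integral_bounded_mul_correlation, ← integral_const_mul]
  have hb : ∀ x, |signedConv g (f k) x| ≤ C := fun x =>
    (abs_signedConv_le hC0 hC (f k) x).trans (mul_le_of_le_one_right hC0 (hf1 k))
  refine integral_mono (φ.integrable.bdd_mul (c := C)
    (continuous_signedConv g (f k)).aestronglyMeasurable (Filter.Eventually.of_forall hb))
    (φ.integrable.abs.const_mul C) fun x => (le_abs_self _).trans ?_
  rw [abs_mul]
  exact mul_le_mul_of_nonneg_right (hb x) (abs_nonneg _)

end Signed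

/-! ### The fundamental matrix -/

section Fundamental

variable {d : ℕ}

/-- The first row of `exp(t B(ξ))`. -/
def greenExp (N M : ℕ) [NeZero N] (a : ℕ → ℝ) (b : (Fin d → ℕ) → ℝ) (n : Fin N) (t : ℝ)
    (ξ : Space d) : ℂ :=
  (NormedSpace.exp ((t : ℂ) • (companion N M a b ξ).transpose)).mulVec (Pi.single 0 1) n

theorem greenHat_eq (N M : ℕ) [NeZero N] (a : ℕ → ℝ) (b : (Fin d → ℕ) → ℝ) (n : Fin N) (t : ℝ)
    (ξ : Space d) : greenHat N M a b n t ξ =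
      (((2 * Real.pi) ^ (-(d : ℝ) / 2) : ℝ) : ℂ) * greenExp N M a b n t ξ := rfl

theorem continuous_symbol (M : ℕ) (b : (Fin d → ℕ) → ℝ) : Continuous (symbol M b) := by
  unfold symbol
  fun_prop

theorem continuous_companion (N M : ℕ) (a : ℕ → ℝ) (b : (Fin d → ℕ) → ℝ) :
    Continuous (companion N M a b) := by
  refine continuous_matrix fun i j => ?_
  have := continuous_symbol M b
  simp only [companion, Matrix.of_apply]
  split_ifs <;> fun_prop

section

attribute [local instance] Matrix.linftyOpNormedRing Matrix.linftyOpNormedAlgebra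

theorem continuous_matrix_exp {N : ℕ} :
    Continuous (NormedSpace.exp : Matrix (Fin N) (Fin N) ℂ → Matrix (Fin N) (Fin N) ℂ) :=
  NormedSpace.exp_continuous

theorem hasDerivAt_matrix_exp_apply {N : ℕ} (A : Matrix (Fin N) (Fin N) ℂ) (v : Fin N → ℂ)
    (i : Fin N) (t : ℝ) :
    HasDerivAt (fun t : ℝ => (NormedSpace.exp ((t : ℂ) • A)).mulVec v i)
      (∑ j, A i j * (NormedSpace.exp ((t : ℂ) • A)).mulVec v j) t := by
  let T : Matrix (Fin N) (Fin N) ℂ →ₗ[ℂ] ℂ :=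
    { toFun := fun B => B.mulVec v i
      map_add' := fun B C => by simp [Matrix.add_mulVec]
      map_smul' := fun c B => by simp [Matrix.smul_mulVec] }
  have h2 : HasDerivAt (fun u : ℂ => T (NormedSpace.exp (u • A)))
      (T (A * NormedSpace.exp ((t : ℂ) • A))) (t : ℂ) :=
    (LinearMap.toContinuousLinearMap T).hasFDerivAt.comp_hasDerivAt (t : ℂ)
      (hasDerivAt_exp_smul_const' (𝕂 := ℂ) A (t : ℂ))
  have h3 : T (A * NormedSpace.exp ((t : ℂ) • A)) =
      ∑ j, A i j * (NormedSpace.exp ((t : ℂ) • A)).mulVec v j := by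
    change (A * NormedSpace.exp ((t : ℂ) • A)).mulVec v i = _
    rw [← Matrix.mulVec_mulVec]
    rfl
  rw [← h3]
  exact h2.comp_ofReal

end

variable (N M : ℕ) [NeZero N] (a : ℕ → ℝ) (b : (Fin d → ℕ) → ℝ)

theorem continuous_greenExp (n : Fin N) :
    Continuous fun q : ℝ × Space d => greenExp N M a b n q.1 q.2 := by
  have h : Continuous fun q : ℝ × Space d =>
      NormedSpace.exp ((q.1 : ℂ) • (companion N M a b q.2).transpose) := by
    refine continuous_matrix_exp.comp ?_
    have := continuous_companion N M a b
    fun_prop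
  exact (continuous_apply n).comp (h.matrix_mulVec continuous_const)

theorem greenExp_zero (n : Fin N) (ξ : Space d) :
    greenExp N M a b n 0 ξ = if (n : ℕ) = 0 then 1 else 0 := by
  rw [greenExp, Complex.ofReal_zero, zero_smul, NormedSpace.exp_zero, Matrix.one_mulVec,
    Pi.single_apply]
  simp only [Fin.ext_iff, Fin.val_zero]

theorem coe_top_fin : ((⊤ : Fin N) : ℕ) = N - 1 := by
  obtain ⟨m, rfl⟩ := Nat.exists_eq_succ_of_ne_zero (NeZero.ne N)
  simp [Fin.top_eq_last]

/-- The first column of the companion matrix has the symbol in its last row and zeros elsewhere;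
this also covers `N = 1`, where `0 = ⊤`. -/
theorem hasDerivAt_greenExp_zero (t : ℝ) (ξ : Space d) :
    HasDerivAt (fun t => greenExp N M a b 0 t ξ) (symbol M b ξ * greenExp N M a b ⊤ t ξ) t := by
  refine (hasDerivAt_matrix_exp_apply (companion N M a b ξ).transpose (Pi.single 0 1)
    0 t).congr_deriv ?_
  rw [Finset.sum_eq_single (⊤ : Fin N)]
  · have := coe_top_fin N
    have := NeZero.pos N
    rw [Matrix.transpose_apply, companion, Matrix.of_apply,
      if_neg (show ¬ ((⊤ : Fin N) : ℕ) + 1 < N by omega), if_pos (Fin.val_zero N)]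
    rfl
  · intro k _ hk
    have h1 : (k : ℕ) + 1 < N := by
      have := coe_top_fin N
      have : (k : ℕ) ≠ ((⊤ : Fin N) : ℕ) := fun h => hk (Fin.ext h)
      have := k.2
      omega
    simp [companion, h1]
  · simp

theorem hasDerivAt_greenExp_succ (j : ℕ) (hj : j + 1 < N) (t : ℝ) (ξ : Space d) :
    HasDerivAt (fun t => greenExp N M a b ⟨j + 1, hj⟩ t ξ)
      (greenExp N M a b ⟨j, by omega⟩ t ξ - a (j + 1) * greenExp N M a b ⊤ t ξ) t := by
  refine (hasDerivAt_matrix_exp_apply (companion N M a b ξ).transpose (Pi.single 0 1)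
    ⟨j + 1, hj⟩ t).congr_deriv ?_
  have htop := coe_top_fin N
  have hne : (⟨j, by omega⟩ : Fin N) ≠ ⊤ := fun h => by
    have := congrArg Fin.val h
    simp only [htop] at this
    omega
  rw [← Finset.sum_subset (Finset.subset_univ {(⟨j, by omega⟩ : Fin N), ⊤})]
  · rw [Finset.sum_pair hne]
    have : ¬ ((⊤ : Fin N) : ℕ) + 1 < N := by omega
    rw [Matrix.transpose_apply, Matrix.transpose_apply, companion, Matrix.of_apply, Matrix.of_apply,
      if_pos hj, if_pos rfl, if_neg this, if_neg (Nat.succ_ne_zero j), one_mul, neg_mul,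
      ← sub_eq_add_neg]
    rfl
  · intro k _ hk
    simp only [Finset.mem_insert, Finset.mem_singleton, not_or] at hk
    have h1 : (k : ℕ) + 1 < N := by
      have : (k : ℕ) ≠ ((⊤ : Fin N) : ℕ) := fun h => hk.2 (Fin.ext h)
      have := k.2
      omega
    have h2 : ¬ j = (k : ℕ) := fun h => hk.1 (Fin.ext h.symm)
    simp [companion, h1, h2]

end Fundamental

/-! ### Characteristic functions of signed measures -/

section Characteristic

variable {d : ℕ}

/-- The characteristic function `ξ ↦ ∫ exp(-i ξ·z) g(dz)`. -/
def signedChar (g : SignedMeasure (Space d)) (ξ : Space d) : ℂ :=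
  signedIntegral g fun z => Complex.exp (-Complex.I * (inner ℝ ξ z : ℝ))

theorem norm_exp_neg_I_mul (r : ℝ) : ‖Complex.exp (-Complex.I * r)‖ = 1 := by
  rw [show -Complex.I * r = ((-r : ℝ) : ℂ) * Complex.I by push_cast; ring,
    Complex.norm_exp_ofReal_mul_I]

theorem continuous_signedChar (g : SignedMeasure (Space d)) : Continuous (signedChar g) :=
  continuous_signedIntegral g
    (k := fun ξ z => Complex.exp (-Complex.I * (inner ℝ ξ z : ℝ))) (C := 1)
    (by simp only [Function.uncurry_def]; fun_prop) fun _ _ => (norm_exp_neg_I_mul _).le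

theorem signedIntegral_mul_const (g : SignedMeasure (Space d)) (f : Space d → ℂ) (c : ℂ) :
    signedIntegral g (fun z => f z * c) = signedIntegral g f * c := by
  simp only [signedIntegral, integral_mul_const, sub_mul]

theorem integral_signedChar_mul (g : SignedMeasure (Space d)) {χ : Space d → ℂ}
    (hχ : Integrable χ) (c : ℝ) :
    ∫ ξ, signedChar g (c • ξ) * χ ξ = signedIntegral g fun z =>
      ∫ ξ, Complex.exp (-Complex.I * (inner ℝ (c • ξ) z : ℝ)) * χ ξ := by
  rw [← integral_signedIntegral_swap]
  · refine integral_congr_ae (Filter.Eventually.of_forall fun ξ => ?_)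
    simp only [signedChar, signedIntegral_mul_const]
  · have : Integrable (fun q : Space d × Space d => χ q.1)
        ((volume : Measure (Space d)).prod g.totalVariation) := hχ.comp_fst _
    refine this.bdd_mul (c := 1) ?_ (Filter.Eventually.of_forall fun q =>
      (norm_exp_neg_I_mul _).le)
    exact Continuous.aestronglyMeasurable (by fun_prop)

/-- Fourier inversion for `ψ` and Fubini; the argument `-2πξ` converts the kernel `exp(2πi ξ·z)` to
that of `signedChar`. -/
theorem signedIntegral_eq_integral_fourier (g : SignedMeasure (Space d)) (ψ : 𝓢(Space d, ℂ)) :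
    signedIntegral g ψ = ∫ ξ, signedChar g (-(2 * Real.pi) • ξ) * 𝓕 ψ ξ := by
  rw [integral_signedChar_mul g (𝓕 ψ).integrable]
  congr 1
  ext z
  have h : ψ z = 𝓕⁻ (𝓕 ψ) z := by rw [FourierTransform.fourierInv_fourier_eq]
  rw [h, SchwartzMap.fourierInv_coe, Real.fourierInv_eq']
  refine integral_congr_ae (Filter.Eventually.of_forall fun ξ => ?_)
  simp only [smul_eq_mul]
  congr 2
  rw [real_inner_smul_left]
  push_cast
  ring

/-- The real and imaginary parts of the exponential are admissible test functions of norm at most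
one, whence the factor two. The bound is uniform in frequency although the symbol is not. -/
theorem norm_signedChar_le {g : SignedMeasure (Space d)} {C : ℝ} (hC0 : 0 ≤ C)
    (hC : ∀ f : Space d →ᵇ ℝ, |signedIntegral g f| ≤ C * ‖f‖) (ξ : Space d) :
    ‖signedChar g ξ‖ ≤ 2 * C := by
  let f₁ : Space d →ᵇ ℝ := BoundedContinuousFunction.ofNormedAddCommGroup
    (fun z => Real.cos (inner ℝ ξ z : ℝ)) (by fun_prop) 1 fun z => Real.abs_cos_le_one _
  let f₂ : Space d →ᵇ ℝ := BoundedContinuousFunction.ofNormedAddCommGroup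
    (fun z => -Real.sin (inner ℝ ξ z : ℝ)) (by fun_prop) 1
    fun z => by rw [norm_neg]; exact Real.abs_sin_le_one _
  have h1 : ‖f₁‖ ≤ 1 := (BoundedContinuousFunction.norm_le zero_le_one).2
    fun z => Real.abs_cos_le_one _
  have h2 : ‖f₂‖ ≤ 1 := (BoundedContinuousFunction.norm_le zero_le_one).2
    fun z => by
      change ‖-Real.sin (inner ℝ ξ z : ℝ)‖ ≤ 1
      rw [norm_neg]; exact Real.abs_sin_le_one _
  have key : ∀ ν : Measure (Space d), IsFiniteMeasure ν →
      ∫ z, Complex.exp (-Complex.I * (inner ℝ ξ z : ℝ)) ∂ν =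
        ((∫ z, f₁ z ∂ν : ℝ) : ℂ) + ((∫ z, f₂ z ∂ν : ℝ) : ℂ) * Complex.I := by
    intro ν _
    rw [← integral_complex_ofReal, ← integral_complex_ofReal, ← integral_mul_const, ← integral_add]
    · refine integral_congr_ae (Filter.Eventually.of_forall fun z => ?_)
      change Complex.exp (-Complex.I * ((inner ℝ ξ z : ℝ) : ℂ)) = ((Real.cos _ : ℝ) : ℂ) + ((-Real.sin _ : ℝ) : ℂ) * Complex.I
      rw [show -Complex.I * ((inner ℝ ξ z : ℝ) : ℂ) = ((-(inner ℝ ξ z : ℝ) : ℝ) : ℂ) * Complex.I by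
        push_cast; ring, Complex.exp_mul_I, ← Complex.ofReal_cos, ← Complex.ofReal_sin]
      simp
    · exact (f₁.integrable ν).ofReal
    · exact (f₂.integrable ν).ofReal.mul_const _
  have h3 : signedChar g ξ = ((signedIntegral g f₁ : ℝ) : ℂ) +
      ((signedIntegral g f₂ : ℝ) : ℂ) * Complex.I := by
    simp only [signedChar, signedIntegral]
    rw [key _ inferInstance, key _ inferInstance]
    push_cast
    ring
  rw [h3]
  refine (norm_add_le _ _).trans ?_
  rw [norm_mul, Complex.norm_I, mul_one, Complex.norm_real, Complex.norm_real, two_mul]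
  exact add_le_add ((hC f₁).trans (mul_le_of_le_one_right hC0 h1))
    ((hC f₂).trans (mul_le_of_le_one_right hC0 h2))

/-- The Schwartz function whose unitary inverse Fourier transform is `χ`. -/
theorem exists_inverseFourier_eq (χ : 𝓢(Space d, ℂ)) :
    ∃ φ : 𝓢(Space d, ℂ), inverseFourier d φ = χ ∧
      ∀ z, φ z = (((2 * Real.pi) ^ (-(d : ℝ) / 2) : ℝ) : ℂ) *
        ∫ ξ, Complex.exp (-Complex.I * (inner ℝ ((1 : ℝ) • ξ) z : ℝ)) * χ ξ := by
  have hpi : (0 : ℝ) < 2 * Real.pi := by positivity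
  set c : ℝ := (2 * Real.pi) ^ (-(d : ℝ) / 2) with hc
  have hcpos : 0 < c := Real.rpow_pos_of_pos hpi _
  have hc0 : (c : ℂ) ≠ 0 := by exact_mod_cast hcpos.ne'
  set χ' : 𝓢(Space d, ℂ) := SchwartzMap.compCLMOfContinuousLinearEquiv ℂ (rescale d).symm
    ((c : ℂ)⁻¹ • χ) with hχ'
  have hsymm : ∀ ξ, (rescale d).symm ξ = (2 * Real.pi) • ξ := fun ξ => by
    rw [ContinuousLinearEquiv.symm_apply_eq]
    change ξ = (2 * Real.pi)⁻¹ • ((2 * Real.pi) • ξ)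
    rw [inv_smul_smul₀ hpi.ne']
  have hχv : ∀ ξ, χ' ξ = (c : ℂ)⁻¹ * χ ((2 * Real.pi) • ξ) := fun ξ => by
    rw [← hsymm]; rfl
  refine ⟨𝓕 χ', ?_, fun z => ?_⟩
  · have : inverseFourier d (𝓕 χ') = (c : ℂ) •
        (SchwartzMap.compCLMOfContinuousLinearEquiv ℂ (rescale d) (𝓕⁻ (𝓕 χ'))) := rfl
    rw [this, FourierTransform.fourierInv_fourier_eq, hχ']
    ext x
    change (c : ℂ) * ((c : ℂ)⁻¹ * χ ((rescale d).symm ((rescale d) x))) = χ x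
    rw [ContinuousLinearEquiv.symm_apply_apply, mul_inv_cancel_left₀ hc0]
  · have h1 : 𝓕 χ' z = ∫ ξ, (c : ℂ)⁻¹ * ((fun η => Complex.exp (-Complex.I *
        (inner ℝ ((1 : ℝ) • η) z : ℝ)) * χ η) ((2 * Real.pi) • ξ)) := by
      rw [SchwartzMap.fourier_coe, Real.fourier_eq']
      refine integral_congr_ae (Filter.Eventually.of_forall fun ξ => ?_)
      simp only [smul_eq_mul, hχv, one_smul, real_inner_smul_left]
      rw [mul_left_comm]
      congr 3
      push_cast
      ring
    rw [h1, integral_const_mul, Measure.integral_comp_smul volume (fun η => Complex.exp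
      (-Complex.I * (inner ℝ ((1 : ℝ) • η) z : ℝ)) * χ η) (2 * Real.pi), finrank_euclideanSpace, Fintype.card_fin,
      abs_of_pos (by positivity), Complex.real_smul, ← mul_assoc]
    congr 1
    -- The Jacobian of the dilation by `2π` is the square of the unitary constant; one factor
    -- cancels the `c⁻¹` in `χ'`.
    have h2 : ((2 * Real.pi) ^ d)⁻¹ = c * c := by
      rw [hc, ← Real.rpow_add hpi, ← Real.rpow_natCast, ← Real.rpow_neg hpi.le]
      congr 1
      ring
    rw [h2]
    push_cast
    rw [inv_mul_cancel_left₀ hc0]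

/-- The chosen tempered distribution is known explicitly only on compactly supported test functions.
Every such `χ` is the inverse transform of some Schwartz `φ`, so both sides agree as locally
integrable functions, hence almost everywhere, hence everywhere by continuity. -/
theorem greenExp_eq_signedChar {N M : ℕ} [NeZero N] {a : ℕ → ℝ} {b : (Fin d → ℕ) → ℝ} {n : Fin N}
    {t : ℝ} {g : SignedMeasure (Space d)} (hT : IsTempered (greenHat N M a b n t))
    (hg : ∀ φ : 𝓢(Space d, ℂ), green N M a b n t φ = signedIntegral g φ) (ξ : Space d) :
    greenExp N M a b n t ξ = signedChar g ξ := by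
  have hpi : (0 : ℝ) < 2 * Real.pi := by positivity
  set c : ℝ := (2 * Real.pi) ^ (-(d : ℝ) / 2) with hc
  have hc0 : (c : ℂ) ≠ 0 := by exact_mod_cast (Real.rpow_pos_of_pos hpi _).ne'
  have hcont : Continuous (greenExp N M a b n t) :=
    (continuous_greenExp N M a b n).comp (by fun_prop : Continuous fun ξ : Space d => (t, ξ))
  have hrep : Represents (toTempered (greenHat N M a b n t)) (greenHat N M a b n t) := by
    rw [toTempered, dif_pos hT]
    exact hT.choose_spec
  have hae : ∀ᵐ ξ, greenExp N M a b n t ξ = signedChar g ξ := by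
    refine ae_eq_of_integral_contDiff_smul_eq hcont.locallyIntegrable
      (continuous_signedChar g).locallyIntegrable fun χ₀ hχs hχc => ?_
    have hc' : HasCompactSupport fun x => (χ₀ x : ℂ) :=
      hχc.comp_left (g := fun t : ℝ => (t : ℂ)) (by simp)
    let χ : 𝓢(Space d, ℂ) := hc'.toSchwartzMap (Complex.ofRealCLM.contDiff.comp hχs)
    obtain ⟨φ, hφ, hφv⟩ := exists_inverseFourier_eq χ
    have h1 := hg φ
    rw [green, hφ, hrep χ hc', show (φ : Space d → ℂ) = fun z => (∫ ξ, Complex.exp (-Complex.I *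
      (inner ℝ ((1 : ℝ) • ξ) z : ℝ)) * χ ξ) * (c : ℂ) from funext fun z => by rw [hφv, mul_comm],
      signedIntegral_mul_const, ← integral_signedChar_mul g χ.integrable] at h1
    simp only [greenHat_eq, mul_assoc, one_smul] at h1
    rw [integral_const_mul, mul_comm (∫ ξ, _)] at h1
    have h2 := mul_left_cancel₀ hc0 h1
    simp only [Complex.real_smul]
    calc ∫ x, (χ₀ x : ℂ) * greenExp N M a b n t x = ∫ x, greenExp N M a b n t x * χ x :=
          integral_congr_ae (Filter.Eventually.of_forall fun x => mul_comm _ _)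
      _ = ∫ x, signedChar g x * χ x := h2
      _ = _ := integral_congr_ae (Filter.Eventually.of_forall fun x => mul_comm _ _)
  exact congrFun ((hcont.ae_eq_iff_eq volume (continuous_signedChar g)).1 hae) ξ

end Characteristic

/-! ### The evolution of the Green measures -/

section Evolution

variable {d : ℕ}

/-- A family of signed measures on the time interval `[0, S]`, extended constantly to `ℝ`, whose
characteristic functions are the components of `exp(t B(ξ)ᵀ) e_1`, and which is weakly continuous
and bounded. -/
structure IsGreenFamily (N M : ℕ) [NeZero N] (a : ℕ → ℝ) (b : (Fin d → ℕ) → ℝ) (S C : ℝ)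
    (K : Fin N → ℝ → SignedMeasure (Space d)) : Prop where
  nonneg_time : 0 ≤ S
  nonneg : 0 ≤ C
  bound : ∀ n t, ∀ f : Space d →ᵇ ℝ, |signedIntegral (K n t) f| ≤ C * ‖f‖
  cont : ∀ n, ∀ f : Space d →ᵇ ℝ, Continuous fun q : ℝ × Space d => signedConv (K n q.1) f q.2
  char : ∀ n, ∀ t ∈ Icc 0 S, ∀ ξ, greenExp N M a b n t ξ = signedChar (K n t) ξ
  clamp : ∀ n t, K n t = K n (max 0 (min t S))

theorem integral_eq_add_intervalIntegral {t : ℝ} (ht : 0 ≤ t) {k₀ k : ℝ → Space d → ℂ}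
    {B : Space d → ℝ} (hk : Continuous (Function.uncurry k))
    (hd : ∀ s ξ, HasDerivAt (fun s => k₀ s ξ) (k s ξ) s) (hB : Integrable B)
    (hkB : ∀ s ∈ Icc 0 t, ∀ ξ, ‖k s ξ‖ ≤ B ξ) (h0 : Integrable (k₀ 0)) :
    ∫ ξ, k₀ t ξ = (∫ ξ, k₀ 0 ξ) + ∫ s in (0)..t, ∫ ξ, k s ξ := by
  have hi : Integrable (Function.uncurry k)
      ((volume.restrict (uIoc 0 t)).prod (volume : Measure (Space d))) := by
    have h1 : Integrable (fun q : ℝ × Space d => B q.2)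
        ((volume.restrict (uIoc 0 t)).prod (volume : Measure (Space d))) := by
      rw [uIoc_of_le ht]
      exact hB.comp_snd _
    refine h1.mono' hk.aestronglyMeasurable ?_
    have h2 : ∀ᵐ s ∂(volume.restrict (uIoc 0 t)), s ∈ Icc 0 t := by
      rw [uIoc_of_le ht]
      exact (ae_restrict_mem measurableSet_Ioc).mono fun s hs => ⟨hs.1.le, hs.2⟩
    filter_upwards [(Measure.quasiMeasurePreserving_fst (ν := (volume : Measure (Space d)))).ae h2]
      with q hq using hkB q.1 hq q.2
  rw [intervalIntegral_integral_swap hi, ← integral_add h0]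
  · refine integral_congr_ae (Filter.Eventually.of_forall fun ξ => ?_)
    have hc : Continuous fun s => k s ξ := hk.comp (by fun_prop : Continuous fun s : ℝ => (s, ξ))
    have := intervalIntegral.integral_eq_sub_of_hasDerivAt (a := 0) (b := t)
      (fun s _ => hd s ξ) (hc.intervalIntegrable _ _)
    simp only [this]
    ring
  · simp only [intervalIntegral.integral_of_le ht]
    rw [uIoc_of_le ht] at hi
    exact hi.integral_prod_right

theorem signedIntegral_ofReal (g : SignedMeasure (Space d)) (ψ : 𝓢(Space d, ℝ)) :
    signedIntegral g (ψ.postcompCLM Complex.ofRealCLM) = ((signedIntegral g ψ : ℝ) : ℂ) := by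
  have : ⇑(ψ.postcompCLM Complex.ofRealCLM) = fun z => ((ψ z : ℝ) : ℂ) := by
    ext z; simp
  simp only [signedIntegral, this, integral_complex_ofReal]
  push_cast
  rfl

variable {N M : ℕ} [NeZero N] {a : ℕ → ℝ} {b : (Fin d → ℕ) → ℝ} {S C : ℝ}
  {K : Fin N → ℝ → SignedMeasure (Space d)}

namespace IsGreenFamily

theorem signedIntegral_eq (h : IsGreenFamily N M a b S C K) (n : Fin N) {t : ℝ}
    (ht : t ∈ Icc 0 S) (ψ : 𝓢(Space d, ℂ)) :
    signedIntegral (K n t) ψ =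
      ∫ ξ, greenExp N M a b n t (-(2 * Real.pi) • ξ) * 𝓕 ψ ξ := by
  rw [signedIntegral_eq_integral_fourier]
  simp only [h.char n t ht]

theorem norm_greenExp_le (h : IsGreenFamily N M a b S C K) (n : Fin N) {t : ℝ}
    (ht : t ∈ Icc 0 S) (ξ : Space d) : ‖greenExp N M a b n t ξ‖ ≤ 2 * C := by
  rw [h.char n t ht]
  exact norm_signedChar_le h.nonneg (h.bound n t) ξ

theorem continuous_integrand (n : Fin N) (χ : 𝓢(Space d, ℂ)) :
    Continuous fun q : ℝ × Space d => greenExp N M a b n q.1 (-(2 * Real.pi) • q.2) * χ q.2 :=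
  ((continuous_greenExp N M a b n).comp (by fun_prop :
    Continuous fun q : ℝ × Space d => (q.1, -(2 * Real.pi) • q.2))).mul
    (χ.continuous.comp continuous_snd)

theorem integrable_integrand (h : IsGreenFamily N M a b S C K) (n : Fin N) {t : ℝ}
    (ht : t ∈ Icc 0 S) (χ : 𝓢(Space d, ℂ)) :
    Integrable fun ξ => greenExp N M a b n t (-(2 * Real.pi) • ξ) * χ ξ :=
  χ.integrable.bdd_mul (c := 2 * C)
    ((continuous_greenExp N M a b n).comp (by fun_prop :
      Continuous fun ξ : Space d => (t, -(2 * Real.pi) • ξ))).aestronglyMeasurable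
    (Filter.Eventually.of_forall fun ξ => h.norm_greenExp_le n ht _)

theorem integral_fourier_eq (ψ : 𝓢(Space d, ℂ)) : ∫ ξ, 𝓕 ψ ξ = ψ 0 := by
  have h : ψ 0 = 𝓕⁻ (𝓕 ψ) 0 := by rw [FourierTransform.fourierInv_fourier_eq]
  rw [h, SchwartzMap.fourierInv_coe, Real.fourierInv_eq']
  simp

/-- The ODE of `greenExp` is integrated in time and then in frequency. The unbounded symbol is moved
onto `ψ`, where it becomes the adjoint operator; since `greenExp` is bounded by `2 * C`, the
integrand is dominated by a Schwartz function. -/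
theorem complex_evolution_zero (h : IsGreenFamily N M a b S C K) {t : ℝ} (ht : t ∈ Icc 0 S)
    (ψ : 𝓢(Space d, ℂ)) :
    signedIntegral (K 0 t) ψ =
      ψ 0 + ∫ s in (0)..t, signedIntegral (K ⊤ s) (adjointOp ℂ M b ψ) := by
  have hsub : ∀ s ∈ Icc 0 t, s ∈ Icc 0 S := fun s hs => ⟨hs.1, hs.2.trans ht.2⟩
  have hfun : ∀ s ξ, symbol M b (-(2 * Real.pi) • ξ) * greenExp N M a b ⊤ s (-(2 * Real.pi) • ξ) *
      𝓕 ψ ξ = greenExp N M a b ⊤ s (-(2 * Real.pi) • ξ) * 𝓕 (adjointOp ℂ M b ψ) ξ := by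
    intro s ξ
    rw [fourier_adjointOp]
    ring
  have key := integral_eq_add_intervalIntegral ht.1
    (k₀ := fun s ξ => greenExp N M a b 0 s (-(2 * Real.pi) • ξ) * 𝓕 ψ ξ)
    (k := fun s ξ => greenExp N M a b ⊤ s (-(2 * Real.pi) • ξ) * 𝓕 (adjointOp ℂ M b ψ) ξ)
    (B := fun ξ => 2 * C * ‖𝓕 (adjointOp ℂ M b ψ) ξ‖)
    (continuous_integrand ⊤ _)
    (fun s ξ => by
      rw [← hfun]
      exact (hasDerivAt_greenExp_zero N M a b s _).mul_const _)
    ((SchwartzMap.integrable _).norm.const_mul _)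
    (fun s hs ξ => by
      rw [norm_mul]
      exact mul_le_mul_of_nonneg_right (h.norm_greenExp_le ⊤ (hsub s hs) _) (norm_nonneg _))
    (h.integrable_integrand 0 ⟨le_rfl, h.nonneg_time⟩ _)
  rw [h.signedIntegral_eq 0 ht, key]
  congr 1
  · simp only [greenExp_zero, Fin.val_zero, if_true, one_mul, integral_fourier_eq]
  · refine intervalIntegral.integral_congr fun s hs => ?_
    rw [uIcc_of_le ht.1] at hs
    exact (h.signedIntegral_eq ⊤ (hsub s hs) _).symm

theorem complex_evolution_succ (h : IsGreenFamily N M a b S C K) {t : ℝ} (ht : t ∈ Icc 0 S)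
    (j : ℕ) (hj : j + 1 < N) (ψ : 𝓢(Space d, ℂ)) :
    signedIntegral (K ⟨j + 1, hj⟩ t) ψ =
      ∫ s in (0)..t, (signedIntegral (K ⟨j, by omega⟩ s) ψ -
        a (j + 1) * signedIntegral (K ⊤ s) ψ) := by
  have hsub : ∀ s ∈ Icc 0 t, s ∈ Icc 0 S := fun s hs => ⟨hs.1, hs.2.trans ht.2⟩
  set χ := 𝓕 ψ with hχ
  have hc : Continuous (Function.uncurry fun s ξ =>
      greenExp N M a b ⟨j, by omega⟩ s (-(2 * Real.pi) • ξ) * χ ξ -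
        a (j + 1) * (greenExp N M a b ⊤ s (-(2 * Real.pi) • ξ) * χ ξ)) :=
    (continuous_integrand _ χ).sub (continuous_const.mul (continuous_integrand ⊤ χ))
  have hB : Integrable fun ξ => (1 + |a (j + 1)|) * (2 * C) * ‖χ ξ‖ :=
    χ.integrable.norm.const_mul _
  have hd : ∀ s ξ, HasDerivAt (fun s => greenExp N M a b ⟨j + 1, hj⟩ s (-(2 * Real.pi) • ξ) * χ ξ)
      (greenExp N M a b ⟨j, by omega⟩ s (-(2 * Real.pi) • ξ) * χ ξ -
        a (j + 1) * (greenExp N M a b ⊤ s (-(2 * Real.pi) • ξ) * χ ξ)) s := fun s ξ => by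
    refine ((hasDerivAt_greenExp_succ N M a b j hj s _).mul_const _).congr_deriv ?_
    ring
  have hle : ∀ s ∈ Icc 0 t, ∀ ξ, ‖greenExp N M a b ⟨j, by omega⟩ s (-(2 * Real.pi) • ξ) * χ ξ -
      a (j + 1) * (greenExp N M a b ⊤ s (-(2 * Real.pi) • ξ) * χ ξ)‖ ≤
        (1 + |a (j + 1)|) * (2 * C) * ‖χ ξ‖ := fun s hs ξ => by
    rw [← mul_assoc, ← sub_mul, norm_mul]
    refine mul_le_mul_of_nonneg_right ((norm_sub_le _ _).trans ?_) (norm_nonneg _)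
    rw [norm_mul, Complex.norm_real, Real.norm_eq_abs, add_mul, one_mul]
    exact add_le_add (h.norm_greenExp_le _ (hsub s hs) _) (mul_le_mul_of_nonneg_left
      (h.norm_greenExp_le _ (hsub s hs) _) (abs_nonneg _))
  have key := integral_eq_add_intervalIntegral ht.1 hc hd hB hle
    (h.integrable_integrand _ ⟨le_rfl, h.nonneg_time⟩ χ)
  rw [h.signedIntegral_eq _ ht, key]
  simp only [greenExp_zero, Nat.succ_ne_zero, if_false, zero_mul, integral_zero, zero_add]
  refine intervalIntegral.integral_congr fun s hs => ?_
  rw [uIcc_of_le ht.1] at hs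
  simp only [h.signedIntegral_eq _ (hsub s hs)]
  rw [integral_sub (h.integrable_integrand _ (hsub s hs) _)
    ((h.integrable_integrand ⊤ (hsub s hs) _).const_mul _), integral_const_mul]

theorem evolution_zero (h : IsGreenFamily N M a b S C K) {t : ℝ} (ht : t ∈ Icc 0 S)
    (ψ : 𝓢(Space d, ℝ)) :
    signedIntegral (K 0 t) ψ =
      ψ 0 + ∫ s in (0)..t, signedIntegral (K ⊤ s) (adjointOp ℝ M b ψ) := by
  have := h.complex_evolution_zero ht (ψ.postcompCLM Complex.ofRealCLM)
  rw [← adjointOp_postcomp] at this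
  simp only [signedIntegral_ofReal, SchwartzMap.postcompCLM_apply, Complex.ofRealCLM_apply,
    intervalIntegral.integral_ofReal] at this
  exact_mod_cast this

theorem evolution_succ (h : IsGreenFamily N M a b S C K) {t : ℝ} (ht : t ∈ Icc 0 S)
    (j : ℕ) (hj : j + 1 < N) (ψ : 𝓢(Space d, ℝ)) :
    signedIntegral (K ⟨j + 1, hj⟩ t) ψ =
      ∫ s in (0)..t, (signedIntegral (K ⟨j, by omega⟩ s) ψ -
        a (j + 1) * signedIntegral (K ⊤ s) ψ) := by
  have := h.complex_evolution_succ ht j hj (ψ.postcompCLM Complex.ofRealCLM)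
  simp only [signedIntegral_ofReal] at this
  norm_cast at this
  rw [intervalIntegral.integral_ofReal] at this
  exact_mod_cast this

theorem correlation_zero (h : IsGreenFamily N M a b S C K) {t : ℝ} (ht : t ∈ Icc 0 S)
    (φ : 𝓢(Space d, ℝ)) (y : Space d) :
    correlation (K 0 t) φ y =
      φ y + ∫ s in (0)..t, correlation (K ⊤ s) (adjointOp ℝ M b φ) y := by
  have := h.evolution_zero ht (shifted φ y)
  rw [shifted_apply, add_zero, shifted, ← adjointOp_translate] at this
  exact this

theorem correlation_succ (h : IsGreenFamily N M a b S C K) {t : ℝ} (ht : t ∈ Icc 0 S)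
    (j : ℕ) (hj : j + 1 < N) (φ : 𝓢(Space d, ℝ)) (y : Space d) :
    correlation (K ⟨j + 1, hj⟩ t) φ y =
      ∫ s in (0)..t, (correlation (K ⟨j, by omega⟩ s) φ y -
        a (j + 1) * correlation (K ⊤ s) φ y) :=
  h.evolution_succ ht j hj (shifted φ y)

/-- A correlation at `y` is a convolution with the reflected function at `-y`, so the joint
continuity of convolutions applies. -/
theorem continuous_correlation (h : IsGreenFamily N M a b S C K) (n : Fin N)
    (φ : 𝓢(Space d, ℝ)) :
    Continuous fun q : ℝ × Space d => correlation (K n q.1) φ q.2 := by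
  let φ' : Space d →ᵇ ℝ := φ.toBoundedContinuousFunction.compContinuous ⟨fun z => -z, by fun_prop⟩
  have h1 : ∀ q : ℝ × Space d, correlation (K n q.1) φ q.2 = signedConv (K n q.1) φ' (-q.2) := by
    intro q
    simp only [correlation, signedConv]
    congr 1
    ext z
    change shifted φ q.2 z = φ (-(-q.2 - z))
    rw [shifted_apply]
    congr 1
    abel
  simp only [h1]
  exact (h.cont n φ').comp (by fun_prop : Continuous fun q : ℝ × Space d => (q.1, -q.2))

/-- The pairing `⟨g_n(t) * f, φ⟩`. -/
def _root_.CauchyProblem.greenPairing (K : Fin N → ℝ → SignedMeasure (Space d)) (f : Space d →ᵇ ℝ)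
    (t : ℝ) (j : ℕ) (φ : 𝓢(Space d, ℝ)) : ℝ :=
  ∫ y, f y * correlation (K (Fin.ofNat N j) t) φ y

theorem abs_greenPairing_le (h : IsGreenFamily N M a b S C K) (f : Space d →ᵇ ℝ) (t : ℝ) (j : ℕ)
    (φ : 𝓢(Space d, ℝ)) : |greenPairing K f t j φ| ≤ ‖f‖ * (C * ∫ x, |φ x|) := by
  have h1 := integral_abs_correlation_le h.nonneg (h.bound (Fin.ofNat N j) t) φ
  refine (abs_integral_le_integral_abs).trans ?_
  refine le_trans ?_ (mul_le_mul_of_nonneg_left h1 (norm_nonneg f))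
  rw [← integral_const_mul]
  refine integral_mono_of_nonneg (Filter.Eventually.of_forall fun _ => abs_nonneg _)
    ((integrable_correlation _ φ).abs.const_mul _) (Filter.Eventually.of_forall fun y => ?_)
  simp only [abs_mul]
  exact mul_le_mul_of_nonneg_right (f.norm_coe_le_norm y) (abs_nonneg _)

theorem greenPairing_eq (f : Space d →ᵇ ℝ) (t : ℝ) (j : ℕ) (φ : 𝓢(Space d, ℝ)) :
    greenPairing K f t j φ = ∫ x, signedConv (K (Fin.ofNat N j) t) f x * φ x :=
  integral_bounded_mul_correlation _ _ _

theorem continuous_greenPairing (h : IsGreenFamily N M a b S C K) (f : Space d →ᵇ ℝ) (j : ℕ)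
    (φ : 𝓢(Space d, ℝ)) : Continuous fun t => greenPairing K f t j φ := by
  simp only [greenPairing_eq]
  refine continuous_of_dominated (bound := fun x => C * ‖f‖ * |φ x|) (fun t => ?_) (fun t => ?_)
    (φ.integrable.abs.const_mul _) (Filter.Eventually.of_forall fun x => ?_)
  · exact ((continuous_signedConv _ f).mul φ.continuous).aestronglyMeasurable
  · refine Filter.Eventually.of_forall fun x => ?_
    rw [norm_mul]
    exact mul_le_mul_of_nonneg_right (abs_signedConv_le h.nonneg (h.bound _ t) f x) (abs_nonneg _)
  · exact ((h.cont _ f).comp (by fun_prop : Continuous fun t : ℝ => (t, x))).mul continuous_const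

/-- The `L¹` bound on correlations is uniform in time, which justifies Fubini for a factor `f` that
is only bounded. -/
theorem integrable_prod_correlation (h : IsGreenFamily N M a b S C K) (f : Space d →ᵇ ℝ)
    (n : Fin N) (φ : 𝓢(Space d, ℝ)) (t : ℝ) :
    Integrable (Function.uncurry fun s y => f y * correlation (K n s) φ y)
      ((volume.restrict (uIoc 0 t)).prod (volume : Measure (Space d))) := by
  have hc := (f.continuous.comp continuous_snd).mul (h.continuous_correlation n φ)
  have hi : Integrable (fun q : ℝ × Space d => correlation (K n q.1) φ q.2)
      ((volume.restrict (uIoc 0 t)).prod (volume : Measure (Space d))) := by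
    have hsm : StronglyMeasurable fun s => ∫ y, ‖correlation (K n s) φ y‖ :=
      StronglyMeasurable.integral_prod_right'
        (f := fun q : ℝ × Space d => ‖correlation (K n q.1) φ q.2‖)
        (h.continuous_correlation n φ).norm.stronglyMeasurable
    have h1 : ∀ s, Integrable fun y => correlation (K n s) φ y := fun s => integrable_correlation _ φ
    have h2 : ∀ s, ‖∫ y, ‖correlation (K n s) φ y‖‖ ≤ C * ∫ x, |φ x| := fun s => by
      rw [Real.norm_of_nonneg (integral_nonneg fun y => norm_nonneg _)]
      exact integral_abs_correlation_le h.nonneg (h.bound n s) φ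
    have : IsFiniteMeasure ((volume : Measure ℝ).restrict (uIoc 0 t)) :=
      inferInstanceAs (IsFiniteMeasure (volume.restrict (Ioc (min 0 t) (max 0 t))))
    have h3 : Integrable (fun s => ∫ y, ‖correlation (K n s) φ y‖) (volume.restrict (uIoc 0 t)) :=
      Integrable.of_bound hsm.aestronglyMeasurable _ (Filter.Eventually.of_forall h2)
    exact (integrable_prod_iff (h.continuous_correlation n φ).aestronglyMeasurable).2
      ⟨Filter.Eventually.of_forall h1, h3⟩
  exact hi.bdd_mul (c := ‖f‖) (f.continuous.comp continuous_snd).aestronglyMeasurable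
    (Filter.Eventually.of_forall fun q => f.norm_coe_le_norm _)

theorem ofNat_eq {j : ℕ} (hj : j < N) : Fin.ofNat N j = ⟨j, hj⟩ :=
  Fin.ext (Nat.mod_eq_of_lt hj)

theorem ofNat_last : Fin.ofNat N (N - 1) = ⊤ :=
  Fin.ext (by rw [coe_top_fin]; exact Nat.mod_eq_of_lt (Nat.sub_lt (NeZero.pos N) one_pos))

/-- The integrated evolution equation of the pairings. -/
theorem greenPairing_evolution (h : IsGreenFamily N M a b S C K) (f : Space d →ᵇ ℝ) {t : ℝ}
    (ht : t ∈ Icc 0 S) {j : ℕ} (hj : j < N) (φ : 𝓢(Space d, ℝ)) :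
    greenPairing K f t j φ = (if j = 0 then ∫ x, f x * φ x else 0) +
      ∫ s in (0)..t, chain N a (adjointOp ℝ M b) (greenPairing K f s) 1 j φ := by
  have hp : ∀ (n : Fin N) φ, Integrable (fun y => f y * ∫ s in (0)..t, correlation (K n s) φ y) := by
    intro n φ
    have := h.integrable_prod_correlation f n φ t
    rw [uIoc_of_le ht.1] at this
    simp only [intervalIntegral.integral_of_le ht.1, ← integral_const_mul]
    exact this.integral_prod_right
  have hs : ∀ (n : Fin N) φ, ∫ y, f y * ∫ s in (0)..t, correlation (K n s) φ y =
      ∫ s in (0)..t, ∫ y, f y * correlation (K n s) φ y := by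
    intro n φ
    rw [intervalIntegral_integral_swap (h.integrable_prod_correlation f n φ t)]
    simp only [intervalIntegral.integral_const_mul]
  have hcy : ∀ (n : Fin N) φ y, IntervalIntegrable (fun s => correlation (K n s) φ y) volume 0 t :=
    fun n φ y => ((h.continuous_correlation n φ).comp
      (by fun_prop : Continuous fun s : ℝ => (s, y))).intervalIntegrable _ _
  cases j with
  | zero =>
    have e : Fin.ofNat N 0 = 0 := ofNat_eq hj
    simp only [chain, greenPairing, ofNat_last, if_true, e]
    rw [← hs, ← integral_add (φ.integrable.bdd_mul (c := ‖f‖) f.continuous.aestronglyMeasurable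
      (Filter.Eventually.of_forall f.norm_coe_le_norm)) (hp _ _)]
    refine integral_congr_ae (Filter.Eventually.of_forall fun y => ?_)
    simp only [h.correlation_zero ht, mul_add]
  | succ j =>
    have hc1 := h.continuous_greenPairing f j φ
    have hc2 := h.continuous_greenPairing f (N - 1) φ
    simp only [chain, Nat.succ_ne_zero, if_false, zero_add]
    rw [intervalIntegral.integral_sub (hc1.intervalIntegrable _ _)
      ((hc2.intervalIntegrable _ _).const_mul _), intervalIntegral.integral_const_mul]
    simp only [greenPairing, ofNat_last, ofNat_eq hj, ofNat_eq (show j < N by omega)]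
    rw [← hs, ← hs, ← integral_const_mul, ← integral_sub (hp _ _) ((hp _ _).const_mul _)]
    refine integral_congr_ae (Filter.Eventually.of_forall fun y => ?_)
    simp only [h.correlation_succ ht]
    rw [intervalIntegral.integral_sub (hcy _ _ _) ((hcy _ _ _).const_mul _),
      intervalIntegral.integral_const_mul]
    ring

end IsGreenFamily

end Evolution

/-! ### Existence -/

section Existence

variable {d N M : ℕ} {a : ℕ → ℝ} {b : (Fin d → ℕ) → ℝ} {S C : ℝ}
  {K : Fin N → ℝ → SignedMeasure (Space d)} {Φ : ℝ → Space d →ᵇ ℝ} {B : ℝ}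

theorem pairing_adjointOp {v : ℝ → Space d → ℝ} {t : ℝ}
    (hi : ∀ ψ : 𝓢(Space d, ℝ), Integrable fun x => v t x * ψ x) (φ : 𝓢(Space d, ℝ)) :
    pairing v (adjointOp ℝ M b φ) t = ∑ α ∈ multiIndices d M,
      b α * ((-1) ^ multiLength α * pairing v (multiDeriv α φ) t) := by
  simp only [pairing, adjointOp, LinearMap.sum_apply, LinearMap.smul_apply, sum_apply,
    smul_apply, smul_eq_mul, Finset.mul_sum, ← integral_const_mul, multiDeriv_eq]
  rw [integral_finsetSum]
  · refine Finset.sum_congr rfl fun α _ => integral_congr_ae (Filter.Eventually.of_forall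
      fun x => ?_)
    ring
  · intro α _
    simp only [mul_left_comm _ (b α * (-1) ^ multiLength α)]
    exact (hi _).const_mul _

variable [NeZero N]

/-- The solution formula `∑ p_n (g_n(t) * f_n)(x) + ∫_0^t (g_N(s) * Φ(t - s))(x) ds`. -/
def duhamel (K : Fin N → ℝ → SignedMeasure (Space d)) (p : Fin N → ℝ) (f : Fin N → Space d →ᵇ ℝ)
    (Φ : ℝ → Space d →ᵇ ℝ) (t : ℝ) (x : Space d) : ℝ :=
  (∑ n, p n * signedConv (K n t) (f n) x) + ∫ s in (0)..t, signedConv (K ⊤ s) (Φ (t - s)) x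

namespace IsGreenFamily

theorem continuous_signedConv_param (g : SignedMeasure (Space d))
    (hΦ : Continuous fun q : ℝ × Space d => Φ q.1 q.2) (hB : ∀ r, ‖Φ r‖ ≤ B) :
    Continuous fun q : ℝ × Space d => signedConv g (Φ q.1) q.2 :=
  continuous_signedIntegral g (k := fun (q : ℝ × Space d) z => Φ q.1 (q.2 - z)) (C := B)
    (hΦ.comp (by fun_prop : Continuous fun r : (ℝ × Space d) × Space d => (r.1.1, r.1.2 - r.2)))
    fun q z => ((Φ q.1).norm_coe_le_norm _).trans (hB q.1)

/-- A Carathéodory argument: continuity in `(r, x)` for each fixed measure, and measurability in the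
time of the measure for each fixed function. Weak continuity alone is not used for joint continuity
when both vary. -/
theorem measurable_signedConv_param (h : IsGreenFamily N M a b S C K) (n : Fin N)
    (hΦ : Continuous fun q : ℝ × Space d => Φ q.1 q.2) (hB : ∀ r, ‖Φ r‖ ≤ B) :
    Measurable fun q : (ℝ × Space d) × ℝ => signedConv (K n q.2) (Φ q.1.1) q.1.2 :=
  measurable_uncurry_of_continuous_of_measurable
    (u := fun (q : ℝ × Space d) s => signedConv (K n s) (Φ q.1) q.2)
    (fun s => continuous_signedConv_param (K n s) hΦ hB)
    fun q => ((h.cont n (Φ q.1)).comp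
      (by fun_prop : Continuous fun s : ℝ => (s, q.2))).measurable

theorem abs_signedConv_source_le (h : IsGreenFamily N M a b S C K) (hB : ∀ r, ‖Φ r‖ ≤ B)
    (n : Fin N) (s r : ℝ) (x : Space d) : |signedConv (K n s) (Φ r) x| ≤ C * B :=
  (abs_signedConv_le h.nonneg (h.bound n s) (Φ r) x).trans
    (mul_le_mul_of_nonneg_left (hB r) h.nonneg)

theorem continuous_duhamel_source (h : IsGreenFamily N M a b S C K)
    (hΦ : Continuous fun q : ℝ × Space d => Φ q.1 q.2) (hB : ∀ r, ‖Φ r‖ ≤ B) :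
    Continuous fun q : ℝ × Space d =>
      ∫ s in (0)..q.1, signedConv (K ⊤ s) (Φ (q.1 - s)) q.2 := by
  -- The upper limit is made a variable of its own, independent of the time in the integrand, and is
  -- put back on the diagonal at the end.
  have key : Continuous fun p : (ℝ × Space d) × ℝ =>
      ∫ s in (0)..p.2, signedConv (K ⊤ s) (Φ (p.1.1 - s)) p.1.2 := by
    refine continuous_iff_continuousAt.2 fun ⟨q₀, t₀⟩ => ?_
    refine intervalIntegral.continuousAt_parametric_primitive_of_dominated
      (F := fun (q : ℝ × Space d) s => signedConv (K ⊤ s) (Φ (q.1 - s)) q.2)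
      (fun _ => C * B) (min 0 t₀ - 1) (max 0 t₀ + 1) (fun q => ?_)
      (Filter.Eventually.of_forall fun q => Filter.Eventually.of_forall fun s =>
        h.abs_signedConv_source_le hB _ _ _ _) intervalIntegrable_const
      (Filter.Eventually.of_forall fun s => ?_) ?_ ?_ (by simp)
    · exact ((h.measurable_signedConv_param ⊤ hΦ hB).comp (by fun_prop :
        Measurable fun s : ℝ => ((q.1 - s, q.2), s))).aestronglyMeasurable
    · exact ((continuous_signedConv_param (K ⊤ s) hΦ hB).comp (by fun_prop :
        Continuous fun q : ℝ × Space d => (q.1 - s, q.2))).continuousAt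
    · constructor <;> [have := min_le_left 0 t₀; have := le_max_left 0 t₀] <;> linarith
    · constructor <;> [have := min_le_right 0 t₀; have := le_max_right 0 t₀] <;> linarith
  exact key.comp (by fun_prop : Continuous fun q : ℝ × Space d => (q, q.1))

theorem continuous_duhamel (h : IsGreenFamily N M a b S C K) (p : Fin N → ℝ)
    (f : Fin N → Space d →ᵇ ℝ)
    (hΦ : Continuous fun q : ℝ × Space d => Φ q.1 q.2) (hB : ∀ r, ‖Φ r‖ ≤ B) :
    Continuous fun q : ℝ × Space d => duhamel K p f Φ q.1 q.2 :=
  (continuous_finsetSum _ fun n _ => continuous_const.mul (h.cont n (f n))).add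
    (h.continuous_duhamel_source hΦ hB)

theorem abs_duhamel_le (h : IsGreenFamily N M a b S C K) (p : Fin N → ℝ)
    (f : Fin N → Space d →ᵇ ℝ) (hB : ∀ r, ‖Φ r‖ ≤ B) {t : ℝ} (ht : t ∈ Icc 0 S) (x : Space d) :
    |duhamel K p f Φ t x| ≤ (∑ n, |p n| * (C * ‖f n‖)) + C * B * S := by
  have hB0 : 0 ≤ B := (norm_nonneg _).trans (hB 0)
  refine (abs_add_le _ _).trans (add_le_add ?_ ?_)
  · refine (Finset.abs_sum_le_sum_abs _ _).trans (Finset.sum_le_sum fun n _ => ?_)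
    rw [abs_mul]
    exact mul_le_mul_of_nonneg_left (abs_signedConv_le h.nonneg (h.bound n t) _ x) (abs_nonneg _)
  · refine (intervalIntegral.norm_integral_le_of_norm_le_const (C := C * B)
      (f := fun s => signedConv (K ⊤ s) (Φ (t - s)) x) fun s _ =>
        h.abs_signedConv_source_le hB ⊤ s (t - s) x).trans ?_
    rw [sub_zero, abs_of_nonneg ht.1]
    exact mul_le_mul_of_nonneg_left ht.2 (mul_nonneg h.nonneg hB0)

theorem hasDerivWithinAt_greenPairing (h : IsGreenFamily N M a b S C K) (f : Space d →ᵇ ℝ)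
    {t : ℝ} (ht : t ∈ Icc 0 S) {j : ℕ} (hj : j < N) (φ : 𝓢(Space d, ℝ)) :
    HasDerivWithinAt (fun t => greenPairing K f t j φ)
      (chain N a (adjointOp ℝ M b) (greenPairing K f t) 1 j φ) (Icc 0 S) t := by
  have hc : Continuous fun s => chain N a (adjointOp ℝ M b) (greenPairing K f s) 1 j φ :=
    chain_continuous (NeZero.pos N) (fun j _ φ => h.continuous_greenPairing f j φ) 1 j hj φ
  refine HasDerivWithinAt.congr_of_mem (f := fun t => (if j = 0 then ∫ x, f x * φ x else 0) +
    ∫ s in (0)..t, chain N a (adjointOp ℝ M b) (greenPairing K f s) 1 j φ) ?_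
    (fun s hs => h.greenPairing_evolution f hs hj φ) ht
  exact ((intervalIntegral.integral_hasDerivAt_right (hc.intervalIntegrable _ _)
    (hc.stronglyMeasurableAtFilter _ _) hc.continuousAt).const_add _).hasDerivWithinAt

theorem greenPairing_zero (h : IsGreenFamily N M a b S C K) (f : Space d →ᵇ ℝ)
    {j : ℕ} (hj : j < N) (φ : 𝓢(Space d, ℝ)) :
    greenPairing K f 0 j φ = if j = 0 then ∫ x, f x * φ x else 0 := by
  rw [h.greenPairing_evolution f ⟨le_rfl, h.nonneg_time⟩ hj]
  simp

theorem exists_abs_chain_one_le (h : IsGreenFamily N M a b S C K) (hB : ∀ r, ‖Φ r‖ ≤ B) {j : ℕ}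
    (hj : j < N) (φ : 𝓢(Space d, ℝ)) :
    ∃ D : ℝ≥0, ∀ s t, |chain N a (adjointOp ℝ M b) (greenPairing K (Φ s) t) 1 j φ| ≤ D := by
  have hB0 : 0 ≤ B := (norm_nonneg _).trans (hB 0)
  have h1 : ∀ j φ, ∃ D : ℝ≥0, ∀ s t, |greenPairing K (Φ s) t j φ| ≤ D := fun j φ => by
    have h0 : 0 ≤ C * ∫ x, |φ x| := mul_nonneg h.nonneg (integral_nonneg fun _ => abs_nonneg _)
    refine ⟨⟨B * (C * ∫ x, |φ x|), mul_nonneg hB0 h0⟩, fun s t => ?_⟩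
    exact (h.abs_greenPairing_le _ _ _ _).trans (mul_le_mul_of_nonneg_right (hB s) h0)
  cases j with
  | zero => exact h1 _ _
  | succ j =>
    obtain ⟨D₁, h₁⟩ := h1 j φ
    obtain ⟨D₂, h₂⟩ := h1 (N - 1) φ
    refine ⟨D₁ + ‖a (j + 1)‖₊ * D₂, fun s t => (abs_sub _ _).trans ?_⟩
    push_cast
    refine add_le_add (h₁ s t) ?_
    rw [chain, abs_mul]
    exact mul_le_mul_of_nonneg_left (h₂ s t) (abs_nonneg _)

/-- The pairing is continuous in the parameter of `Φ` and Lipschitz in time with a constant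
independent of that parameter, because its time derivative is uniformly bounded. The clamp is
`1`-Lipschitz and extends this from `[0, S]` to the line. -/
theorem continuous_greenPairing_param (h : IsGreenFamily N M a b S C K)
    (hΦ : Continuous fun q : ℝ × Space d => Φ q.1 q.2) (hB : ∀ r, ‖Φ r‖ ≤ B) {j : ℕ} (hj : j < N)
    (φ : 𝓢(Space d, ℝ)) :
    Continuous fun q : ℝ × ℝ => greenPairing K (Φ q.2) q.1 j φ := by
  obtain ⟨D, hD⟩ := h.exists_abs_chain_one_le hB hj φ
  refine continuous_prod_of_continuous_lipschitzWith
    (fun q : ℝ × ℝ => greenPairing K (Φ q.2) q.1 j φ) D (fun r => ?_) fun s => ?_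
  · refine continuous_of_dominated (bound := fun y => B * |correlation (K (Fin.ofNat N j) r) φ y|)
      (fun s => ?_) (fun s => Filter.Eventually.of_forall fun y => ?_)
      ((integrable_correlation _ φ).abs.const_mul _) (Filter.Eventually.of_forall fun y => ?_)
    · exact ((Φ s).continuous.mul (CauchyProblem.continuous_correlation _ φ)).aestronglyMeasurable
    · rw [norm_mul]
      exact mul_le_mul_of_nonneg_right (((Φ s).norm_coe_le_norm y).trans (hB s)) (abs_nonneg _)
    · change Continuous fun s => Φ s y * correlation (K (Fin.ofNat N j) r) φ y
      exact (hΦ.comp (by fun_prop : Continuous fun s : ℝ => (s, y))).mul continuous_const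
  · have hL : LipschitzOnWith D (fun r => greenPairing K (Φ s) r j φ) (Icc 0 S) :=
      Convex.lipschitzOnWith_of_nnnorm_hasDerivWithin_le (convex_Icc 0 S)
        (fun r hr => h.hasDerivWithinAt_greenPairing (Φ s) hr hj φ)
        (fun r _ => by exact_mod_cast hD s r)
    have hcl : ∀ r, greenPairing K (Φ s) r j φ = greenPairing K (Φ s) (max 0 (min r S)) j φ :=
      fun r => by simp only [greenPairing]; rw [h.clamp _ r]
    have hp : LipschitzWith 1 fun r : ℝ => max 0 (min r S) :=
      (LipschitzWith.id.min_const S).const_max 0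
    have hm : ∀ r : ℝ, max 0 (min r S) ∈ Icc 0 S := fun r =>
      ⟨le_max_left _ _, max_le h.nonneg_time (min_le_right _ _)⟩
    refine LipschitzWith.of_dist_le_mul fun r r' => ?_
    simp only
    rw [hcl r, hcl r']
    refine (hL.dist_le_mul _ (hm r) _ (hm r')).trans (mul_le_mul_of_nonneg_left ?_ D.2)
    simpa using hp.dist_le_mul r r'

theorem integrable_prod_source (h : IsGreenFamily N M a b S C K)
    (hΦ : Continuous fun q : ℝ × Space d => Φ q.1 q.2)
    (hB : ∀ r, ‖Φ r‖ ≤ B) (φ : 𝓢(Space d, ℝ)) {t : ℝ} (ht : 0 ≤ t) :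
    Integrable (Function.uncurry fun s x => signedConv (K ⊤ s) (Φ (t - s)) x * φ x)
      ((volume.restrict (uIoc 0 t)).prod (volume : Measure (Space d))) := by
  have he : Measurable fun q : ℝ × Space d => ((t - q.1, q.2), q.1) := by fun_prop
  have hm : Measurable fun q : ℝ × Space d => signedConv (K ⊤ q.1) (Φ (t - q.1)) q.2 := by
    have := (h.measurable_signedConv_param ⊤ hΦ hB).comp he
    simpa only [Function.comp_def] using this
  have h1 : Integrable (fun q : ℝ × Space d => φ q.2)
      ((volume.restrict (uIoc 0 t)).prod (volume : Measure (Space d))) := by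
    rw [uIoc_of_le ht]
    exact (φ.integrable (μ := volume)).comp_snd (volume.restrict (Ioc 0 t))
  have hb : ∀ q : ℝ × Space d, ‖signedConv (K ⊤ q.1) (Φ (t - q.1)) q.2‖ ≤ C * B := fun q =>
    h.abs_signedConv_source_le hB ⊤ q.1 (t - q.1) q.2
  exact h1.bdd_mul hm.aestronglyMeasurable (Filter.Eventually.of_forall hb)

/-- The substitution `s ↦ t - s` places the running time in the Green measure. Time derivatives then
never fall on the source, which is only continuous. -/
theorem integral_source_mul (h : IsGreenFamily N M a b S C K)
    (hΦ : Continuous fun q : ℝ × Space d => Φ q.1 q.2)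
    (hB : ∀ r, ‖Φ r‖ ≤ B) (φ : 𝓢(Space d, ℝ)) {t : ℝ} (ht : 0 ≤ t) :
    Integrable (fun x => (∫ s in (0)..t, signedConv (K ⊤ s) (Φ (t - s)) x) * φ x) ∧
      ∫ x, (∫ s in (0)..t, signedConv (K ⊤ s) (Φ (t - s)) x) * φ x =
        ∫ s in (0)..t, greenPairing K (Φ s) (t - s) (N - 1) φ := by
  have hi2 := h.integrable_prod_source hΦ hB φ ht
  simp only [← intervalIntegral.integral_mul_const]
  constructor
  · rw [uIoc_of_le ht] at hi2
    simp only [intervalIntegral.integral_of_le ht]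
    exact hi2.integral_prod_right
  · have := intervalIntegral.integral_comp_sub_left
      (fun s => greenPairing K (Φ (t - s)) s (N - 1) φ) (a := 0) (b := t) t
    simp only [sub_sub_cancel, sub_self, sub_zero] at this
    rw [← intervalIntegral_integral_swap hi2, this]
    simp only [greenPairing_eq, ofNat_last]

theorem pairing_duhamel (h : IsGreenFamily N M a b S C K) (p : Fin N → ℝ)
    (f : Fin N → Space d →ᵇ ℝ) (hΦ : Continuous fun q : ℝ × Space d => Φ q.1 q.2)
    (hB : ∀ r, ‖Φ r‖ ≤ B) (φ : 𝓢(Space d, ℝ)) {t : ℝ} (ht : t ∈ Icc 0 S) :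
    pairing (duhamel K p f Φ) φ t = (∑ n : Fin N, p n * greenPairing K (f n) t n φ) +
      ∫ s in (0)..t, greenPairing K (Φ s) (t - s) (N - 1) φ := by
  have hi1 : ∀ n, Integrable fun x => p n * (signedConv (K n t) (f n) x * φ x) := fun n =>
    (φ.integrable.bdd_mul (c := C * ‖f n‖) (continuous_signedConv _ _).aestronglyMeasurable
      (Filter.Eventually.of_forall fun x =>
        abs_signedConv_le h.nonneg (h.bound n t) _ x)).const_mul _
  obtain ⟨hi3, he⟩ := h.integral_source_mul hΦ hB φ ht.1
  have hofNat : ∀ n : Fin N, Fin.ofNat N (n : ℕ) = n := fun n => Fin.ext (Nat.mod_eq_of_lt n.2)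
  simp only [pairing, duhamel, add_mul, Finset.sum_mul, mul_assoc]
  rw [integral_add (integrable_finsetSum _ fun n _ => hi1 n) hi3,
    integral_finsetSum _ fun n _ => hi1 n, he]
  congr 1
  refine Finset.sum_congr rfl fun n _ => ?_
  rw [integral_const_mul, greenPairing_eq, hofNat]

theorem sum_Icc_one_eq (g : ℕ → ℝ) (n : ℕ) :
    ∑ k ∈ Finset.Icc 1 n, g k = ∑ k ∈ Finset.range n, g (k + 1) := by
  rw [Finset.range_eq_Ico, Finset.sum_Ico_add', zero_add]
  rfl

/-- After pairing, the formula is differentiated `N` times along `chain`. The homogeneous part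
satisfies the equation by `sum_chain`, and Leibniz's rule contributes a boundary term only in the
`N`-th derivative; as `a N = 1`, this term is the source. -/
theorem isBoundedSolution_duhamel (h : IsGreenFamily N M a b S C K) (hS : 0 < S) (ha : a N = 1)
    (p : Fin N → ℝ) (f : Fin N → Space d →ᵇ ℝ)
    (hΦ : Continuous fun q : ℝ × Space d => Φ q.1 q.2) (hB : ∀ r, ‖Φ r‖ ≤ B)
    {F : ℝ → Space d → ℝ} (hF : ∀ t ∈ Icc 0 S, ∀ x, F t x = Φ t x) :
    IsBoundedSolution N M a b p (fun n => f n) F S (duhamel K p f Φ) := by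
  set L : 𝓢(Space d, ℝ) → 𝓢(Space d, ℝ) := ⇑(adjointOp ℝ M b) with hL
  have hN := NeZero.pos N
  let H : ℕ → 𝓢(Space d, ℝ) → ℝ → ℝ := fun k φ t =>
    (∑ n : Fin N, p n * chain N a L (greenPairing K (f n) t) k n φ) +
      ∫ s in (0)..t, chain N a L (greenPairing K (Φ s) (t - s)) k (N - 1) φ
  -- The actual `k`-th derivative for `k ≤ N`: the formal one, with the boundary term added at `k =
  -- N`.
  let E : 𝓢(Space d, ℝ) → ℕ → ℝ → ℝ := fun φ k t =>
    H k φ t + if k = N then ∫ x, Φ t x * φ x else 0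
  have hjc : ∀ k φ, Continuous (Function.uncurry fun r s : ℝ =>
      chain N a L (greenPairing K (Φ s) r) k (N - 1) φ) := fun k φ =>
    chain_continuous (X := fun q : ℝ × ℝ => greenPairing K (Φ q.2) q.1) hN
      (fun j hj φ => h.continuous_greenPairing_param hΦ hB hj φ) k (N - 1) (by omega) φ
  have hcΦ : ∀ φ : 𝓢(Space d, ℝ), Continuous fun t => ∫ x, Φ t x * φ x := fun φ =>
    continuous_of_dominated (bound := fun x => B * |φ x|)
      (fun t => ((Φ t).continuous.mul φ.continuous).aestronglyMeasurable)
      (fun t => Filter.Eventually.of_forall fun x => by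
        rw [norm_mul]
        exact mul_le_mul_of_nonneg_right (((Φ t).norm_coe_le_norm x).trans (hB t)) (abs_nonneg _))
      (φ.integrable.abs.const_mul _)
      (Filter.Eventually.of_forall fun x =>
        (hΦ.comp (by fun_prop : Continuous fun s : ℝ => (s, x))).mul continuous_const)
  have hd : ∀ (f : Space d →ᵇ ℝ) (k : ℕ) (j : ℕ), j < N → ∀ φ, ∀ t ∈ Icc 0 S, HasDerivWithinAt
      (fun t => chain N a L (greenPairing K f t) k j φ)
      (chain N a L (greenPairing K f t) (k + 1) j φ) (Icc 0 S) t := fun f k j hj φ t ht =>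
    chain_hasDerivWithinAt hN (fun j hj φ => h.hasDerivWithinAt_greenPairing f ht hj φ) k j hj φ
  have hini : ∀ (f : Space d →ᵇ ℝ), ∀ m < N, ∀ j < N, ∀ φ,
      chain N a L (greenPairing K f 0) m j φ = if j = m then ∫ x, f x * φ x else 0 := fun f =>
    chain_initial (c := fun φ : 𝓢(Space d, ℝ) => ∫ x, f x * φ x)
      fun j hj φ => h.greenPairing_zero f hj φ
  have hE0 : ∀ φ, ∀ t ∈ Icc 0 S, pairing (duhamel K p f Φ) φ t = E φ 0 t := by
    intro φ t ht
    simp only [E, H, if_neg hN.ne, add_zero, chain]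
    exact h.pairing_duhamel p f hΦ hB φ ht
  have hEd : ∀ φ, ∀ k < N, ∀ t ∈ Icc 0 S,
      HasDerivWithinAt (E φ k) (E φ (k + 1) t) (Icc 0 S) t := by
    intro φ k hk t ht
    have h1 : HasDerivWithinAt
        (fun t => ∑ n : Fin N, p n * chain N a L (greenPairing K (f n) t) k n φ)
        (∑ n : Fin N, p n * chain N a L (greenPairing K (f n) t) (k + 1) n φ) (Icc 0 S) t :=
      HasDerivWithinAt.fun_sum fun n _ => (hd (f n) k n n.2 φ t ht).const_mul _
    have h2 := hasDerivWithinAt_convolution (hjc k φ) (hjc (k + 1) φ)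
      (fun s _ r hr => hd (Φ s) k (N - 1) (by omega) φ r hr) ht
    rw [hini _ k hk (N - 1) (by omega)] at h2
    have h3 : E φ k = fun t => (∑ n : Fin N, p n * chain N a L (greenPairing K (f n) t) k n φ) +
        ∫ s in (0)..t, chain N a L (greenPairing K (Φ s) (t - s)) k (N - 1) φ := by
      ext t
      simp only [E, H, if_neg hk.ne, add_zero]
    rw [h3]
    refine (h1.add h2).congr_deriv ?_
    -- The boundary term is the `k`-th derivative at time zero of the last component, which is
    -- nonzero only for `k = N - 1`.
    simp only [E, H, show N - 1 = k ↔ k + 1 = N by omega]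
    ring
  have hEc : ∀ φ, ContinuousOn (E φ N) (Icc 0 S) := by
    intro φ
    simp only [E, H, if_true]
    refine Continuous.continuousOn (Continuous.add (Continuous.add ?_ ?_) (hcΦ φ))
    · exact continuous_finsetSum _ fun n _ => continuous_const.mul
        (chain_continuous hN (fun j _ φ => h.continuous_greenPairing (f n) j φ) N n n.2 φ)
    · exact continuous_intervalIntegral_upper ((hjc N φ).comp
        (by fun_prop : Continuous fun q : ℝ × ℝ => (q.1 - q.2, q.2)))
  have hmain : ∀ φ, ContDiffOn ℝ N (pairing (duhamel K p f Φ) φ) (Icc 0 S) ∧ ∀ k ≤ N,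
      ∀ t ∈ Icc 0 S, iteratedDerivWithin k (pairing (duhamel K p f Φ) φ) (Icc 0 S) t =
        E φ k t := by
    intro φ
    obtain ⟨hc, hi⟩ := contDiffOn_iteratedDerivWithin_of_chain hS N (hEd φ) (hEc φ)
    refine ⟨hc.congr (hE0 φ), fun k hk t ht => ?_⟩
    rw [iteratedDerivWithin_congr (hE0 φ) ht, hi k hk t ht]
  have hLsum : ∀ φ, ∀ t ∈ Icc 0 S, pairing (duhamel K p f Φ) (L φ) t = ∑ α ∈ multiIndices d M,
      b α * ((-1) ^ multiLength α * pairing (duhamel K p f Φ) (multiDeriv α φ) t) := by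
    intro φ t ht
    have hi : ∀ ψ : 𝓢(Space d, ℝ), Integrable fun x => duhamel K p f Φ t x * ψ x := fun ψ =>
      ψ.integrable.bdd_mul (((h.continuous_duhamel p f hΦ hB).comp
        (by fun_prop : Continuous fun x : Space d => (t, x))).aestronglyMeasurable)
        (Filter.Eventually.of_forall fun x => h.abs_duhamel_le p f hB ht x)
    exact pairing_adjointOp hi φ
  refine ⟨(h.continuous_duhamel p f hΦ hB).continuousOn,
    ⟨_, fun t ht x => h.abs_duhamel_le p f hB ht x⟩, fun φ => (hmain φ).1, fun φ t ht => ?_,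
    fun φ n => ?_⟩
  · rw [← hLsum φ t ht, hE0 (L φ) t ht]
    have hsum : ∑ n ∈ Finset.Icc 1 N, a n * iteratedDerivWithin n
        (pairing (duhamel K p f Φ) φ) (Icc 0 S) t =
        ∑ k ∈ Finset.range N, a (k + 1) * E φ (k + 1) t := by
      rw [sum_Icc_one_eq fun n => a n * iteratedDerivWithin n
        (pairing (duhamel K p f Φ) φ) (Icc 0 S) t]
      refine Finset.sum_congr rfl fun n hn => ?_
      rw [(hmain φ).2 (n + 1) (Finset.mem_range.1 hn) t ht]
    have hH : ∑ k ∈ Finset.range N, a (k + 1) * H (k + 1) φ t = H 0 (L φ) t := by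
      have hci : ∀ k, IntervalIntegrable
          (fun s => chain N a L (greenPairing K (Φ s) (t - s)) k (N - 1) φ) volume 0 t := fun k =>
        ((hjc k φ).comp (by fun_prop : Continuous fun s : ℝ => (t - s, s))).intervalIntegrable _ _
      simp only [H, mul_add, Finset.sum_add_distrib, ← intervalIntegral.integral_const_mul]
      rw [← intervalIntegral.integral_finsetSum fun k _ => (hci (k + 1)).const_mul _]
      congr 1
      · simp only [Finset.mul_sum]
        rw [Finset.sum_comm]
        refine Finset.sum_congr rfl fun n _ => ?_
        rw [← sum_chain hN ha _ 0 n n.2 φ, Finset.mul_sum]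
        exact Finset.sum_congr rfl fun k _ => by rw [zero_add]; ring
      · refine intervalIntegral.integral_congr fun s _ => ?_
        have := sum_chain (L := L) hN ha (greenPairing K (Φ s) (t - s)) 0 (N - 1) (by omega) φ
        simpa only [zero_add] using this
    have hlast : ∑ k ∈ Finset.range N, a (k + 1) * (if k + 1 = N then ∫ x, Φ t x * φ x else 0) =
        ∫ x, Φ t x * φ x := by
      rw [Finset.sum_eq_single (N - 1)]
      · rw [show N - 1 + 1 = N by omega, if_pos rfl, ha, one_mul]
      · intro k _ hk
        rw [if_neg (by omega), mul_zero]
      · intro hk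
        exact absurd (Finset.mem_range.2 (by omega)) hk
    have hpF : pairing F φ t = ∫ x, Φ t x * φ x :=
      integral_congr_ae (Filter.Eventually.of_forall fun x => by simp only [hF t ht x])
    rw [hsum, hpF]
    simp only [E, mul_add, Finset.sum_add_distrib, hH, hlast, if_neg hN.ne]
    ring
  · rw [(hmain φ).2 n n.2.le 0 ⟨le_rfl, hS.le⟩]
    simp only [E, H, if_neg n.2.ne, add_zero, intervalIntegral.integral_same]
    rw [Finset.sum_eq_single n]
    · rw [hini _ n n.2 n n.2, if_pos rfl]
    · intro m _ hm
      rw [hini _ n n.2 m m.2, if_neg (fun e => hm (Fin.ext e)), mul_zero]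
    · simp

end IsGreenFamily

end Existence

/-! ### Uniqueness -/

section LinearODE

variable {N : ℕ} {a : ℕ → ℝ} {S : ℝ}

/-- A barrier argument for the vector `Y` of the derivatives of order below `N`. With `A = 1 + ∑ |a
n|` one has `‖Y'‖ ≤ A ‖Y‖ + c exp(l t)`, and the strict inequality `c < κ (l - A)` makes the slope
of `κ exp(l t)` larger than `‖Y'‖` wherever the two would touch. -/
theorem abs_le_exp_of_linear_ode (hN : 0 < N) (ha : a N = 1) (hS : 0 < S) {y : ℝ → ℝ}
    (hy : ContDiffOn ℝ N y (Icc 0 S)) (h0 : ∀ k < N, iteratedDerivWithin k y (Icc 0 S) 0 = 0)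
    {c κ l : ℝ} (hκ0 : 0 < κ) (hκ : c < κ * (l - (1 + ∑ n ∈ Finset.Icc 1 N, |a n|)))
    (hc : ∀ t ∈ Icc 0 S, |∑ n ∈ Finset.Icc 1 N, a n * iteratedDerivWithin n y (Icc 0 S) t| ≤
      c * Real.exp (l * t)) :
    ∀ t ∈ Icc 0 S, |y t| ≤ κ * Real.exp (l * t) := by
  have hu := uniqueDiffOn_Icc hS
  let Y : ℝ → Fin N → ℝ := fun t i => iteratedDerivWithin i y (Icc 0 S) t
  let Y' : ℝ → Fin N → ℝ := fun t i => iteratedDerivWithin (i + 1) y (Icc 0 S) t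
  have hYd : ∀ t ∈ Icc 0 S, HasDerivWithinAt Y (Y' t) (Icc 0 S) t := by
    intro t ht
    refine hasDerivWithinAt_pi.2 fun i => ?_
    have := hy.differentiableOn_iteratedDerivWithin (m := i) (by exact_mod_cast i.2) hu t ht
    have h2 := this.hasDerivWithinAt
    rwa [← iteratedDerivWithin_succ] at h2
  have hle : ∀ t ∈ Icc 0 S, ‖Y' t‖ ≤
      (1 + ∑ n ∈ Finset.Icc 1 N, |a n|) * ‖Y t‖ + c * Real.exp (l * t) := by
    intro t ht
    have hsrc := hc t ht
    have hA : 0 ≤ ∑ n ∈ Finset.Icc 1 N, |a n| := Finset.sum_nonneg fun _ _ => abs_nonneg _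
    have hcn : 0 ≤ c * Real.exp (l * t) := (abs_nonneg _).trans hsrc
    have hcomp : ∀ n < N, |iteratedDerivWithin n y (Icc 0 S) t| ≤ ‖Y t‖ := fun n hn =>
      norm_le_pi_norm (Y t) ⟨n, hn⟩
    have hYn := norm_nonneg (Y t)
    refine (pi_norm_le_iff_of_nonneg (by positivity)).2 fun i => ?_
    change |iteratedDerivWithin (i + 1) y (Icc 0 S) t| ≤ _
    by_cases hi : (i : ℕ) + 1 < N
    · refine (hcomp _ hi).trans ?_
      nlinarith [mul_nonneg hA hYn]
    · have hi' : (i : ℕ) + 1 = N := by omega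
      have hmem : N ∈ Finset.Icc 1 N := Finset.mem_Icc.2 ⟨hN, le_rfl⟩
      -- For the last component of `Y'` the equation is solved for the derivative of order `N`,
      -- whose coefficient is one.
      rw [← Finset.add_sum_erase _ _ hmem, ha, one_mul] at hsrc
      have h2 : |∑ n ∈ (Finset.Icc 1 N).erase N, a n * iteratedDerivWithin n y (Icc 0 S) t| ≤
          (∑ n ∈ Finset.Icc 1 N, |a n|) * ‖Y t‖ := by
        refine (Finset.abs_sum_le_sum_abs _ _).trans ?_
        rw [Finset.sum_mul]
        refine (Finset.sum_le_sum fun n hn => ?_).trans (Finset.sum_le_sum_of_subset_of_nonneg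
          (Finset.erase_subset _ _) fun n _ _ => mul_nonneg (abs_nonneg _) hYn)
        rw [abs_mul]
        have := Finset.mem_erase.1 hn
        have := Finset.mem_Icc.1 this.2
        exact mul_le_mul_of_nonneg_left (hcomp n (by omega)) (abs_nonneg _)
      rw [hi']
      have h3 := abs_sub_abs_le_abs_sub (iteratedDerivWithin N y (Icc 0 S) t)
        (-∑ n ∈ (Finset.Icc 1 N).erase N, a n * iteratedDerivWithin n y (Icc 0 S) t)
      rw [sub_neg_eq_add, abs_neg] at h3
      linarith
  have hB : ∀ t, HasDerivAt (fun t => κ * Real.exp (l * t)) (κ * (Real.exp (l * t) * l)) t := by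
    intro t
    have := ((hasDerivAt_id t).const_mul l).exp.const_mul κ
    simpa using this
  have key := image_norm_le_of_norm_deriv_right_lt_deriv_boundary (f := Y) (f' := Y') (a := 0)
    (b := S) (fun t ht => (hYd t ht).continuousWithinAt)
    (fun t ht => (hYd t ⟨ht.1, ht.2.le⟩).mono_of_mem_nhdsWithin
      (Icc_mem_nhdsGE_of_mem ht)) (B := fun t => κ * Real.exp (l * t)) (B' := fun t => κ * (Real.exp (l * t) * l)) ?_ hB ?_
  · intro t ht
    have h1 := norm_le_pi_norm (Y t) ⟨0, hN⟩
    have h2 : ‖Y t ⟨0, hN⟩‖ = |y t| := by simp [Y]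
    rw [← h2]
    exact h1.trans (key ht)
  · have : Y 0 = 0 := funext fun i => h0 i i.2
    rw [this, norm_zero]
    positivity
  · intro t ht heq
    refine (hle t ⟨ht.1, ht.2.le⟩).trans_lt ?_
    rw [heq]
    have he := Real.exp_pos (l * t)
    nlinarith [mul_lt_mul_of_pos_right hκ he]

/-- Uniqueness for the hierarchy `∑ a_n ∂_t^n y_m = y_{m+1}` with zero initial data, under a
geometric bound on the `y_m`. -/
theorem eq_zero_of_hierarchy (hN : 0 < N) (ha : a N = 1) (hS : 0 < S) {y : ℕ → ℝ → ℝ}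
    (hy : ∀ m, ContDiffOn ℝ N (y m) (Icc 0 S))
    (h0 : ∀ m, ∀ k < N, iteratedDerivWithin k (y m) (Icc 0 S) 0 = 0)
    (hrec : ∀ m, ∀ t ∈ Icc 0 S,
      ∑ n ∈ Finset.Icc 1 N, a n * iteratedDerivWithin n (y m) (Icc 0 S) t = y (m + 1) t)
    {D R : ℝ} (hR : 0 ≤ R) (hD : ∀ m, ∀ t ∈ Icc 0 S, |y m t| ≤ D * R ^ m) :
    ∀ t ∈ Icc 0 S, y 0 t = 0 := by
  set A := 1 + ∑ n ∈ Finset.Icc 1 N, |a n| with hA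
  have hA0 : 0 ≤ A := by
    have : 0 ≤ ∑ n ∈ Finset.Icc 1 N, |a n| := Finset.sum_nonneg fun _ _ => abs_nonneg _
    positivity
  have hD0 : 0 ≤ D := by
    have := (abs_nonneg _).trans (hD 0 0 ⟨le_rfl, hS.le⟩)
    simpa using this
  -- The rate exceeds `A` by more than `2 * (R + 1)`: solving one equation of the hierarchy then
  -- beats the loss `R + 1` from passing to `m + 1` and still gains a factor one half.
  set l := A + 2 * (R + 1) + 1 with hl
  -- The induction on `k` is uniform in `m`, because the bound for `y m` at level `k + 1` comes from
  -- that for `y (m + 1)` at level `k`. Replacing `D`, `R` by `D + 1`, `R + 1` keeps all constants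
  -- positive.
  have key : ∀ k m : ℕ, ∀ t ∈ Icc 0 S,
      |y m t| ≤ (D + 1) * (R + 1) ^ m * (1 / 2) ^ k * Real.exp (l * t) := by
    intro k
    induction k with
    | zero =>
      intro m t ht
      have h1 : 1 ≤ Real.exp (l * t) := Real.one_le_exp (mul_nonneg (by positivity) ht.1)
      calc |y m t| ≤ D * R ^ m := hD m t ht
        _ ≤ (D + 1) * (R + 1) ^ m := by gcongr <;> linarith
        _ ≤ _ := by rw [pow_zero, mul_one]; exact le_mul_of_one_le_right (by positivity) h1
    | succ k ih =>
      intro m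
      have hpos : 0 < (D + 1) * (R + 1) ^ m * (1 / 2) ^ (k + 1) := by positivity
      refine abs_le_exp_of_linear_ode hN ha hS (hy m) (h0 m)
        (c := (D + 1) * (R + 1) ^ (m + 1) * (1 / 2) ^ k) hpos ?_ fun t ht => ?_
      · rw [← hA, show l - A = 2 * (R + 1) + 1 by rw [hl]; ring, mul_add, mul_one]
        have : (D + 1) * (R + 1) ^ (m + 1) * (1 / 2) ^ k =
            (D + 1) * (R + 1) ^ m * (1 / 2) ^ (k + 1) * (2 * (R + 1)) := by ring
        linarith
      · rw [hrec m t ht]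
        exact ih (m + 1) t ht
  intro t ht
  have hlim : Filter.Tendsto (fun k : ℕ => (D + 1) * (R + 1) ^ 0 * (1 / 2 : ℝ) ^ k *
      Real.exp (l * t)) Filter.atTop (nhds ((D + 1) * (R + 1) ^ 0 * 0 * Real.exp (l * t))) :=
    ((tendsto_pow_atTop_nhds_zero_of_lt_one (by norm_num) (by norm_num)).const_mul _).mul_const _
  have := ge_of_tendsto' hlim fun k => key k 0 t ht
  rw [mul_zero, zero_mul] at this
  exact abs_eq_zero.1 (le_antisymm this (abs_nonneg _))

end LinearODE

/-! ### Band-limited approximate identities. -/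

section BandLimitedTests

variable {d : ℕ}

/-- The function `y ↦ η(r (y - x))`. -/
def rescaledTest (η : 𝓢(Space d, ℂ)) (r : ℝ) (hr : r ≠ 0) (x : Space d) : 𝓢(Space d, ℂ) :=
  (SchwartzMap.compCLMOfContinuousLinearEquiv ℝ
    (ContinuousLinearEquiv.smulLeft (Units.mk0 r hr) : Space d ≃L[ℝ] Space d) η).compSubConstCLM ℝ x

theorem rescaledTest_apply (η : 𝓢(Space d, ℂ)) (r : ℝ) (hr : r ≠ 0) (x y : Space d) :
    rescaledTest η r hr x y = η (r • (y - x)) := rfl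

/-- Translation multiplies the transform by a phase and dilation by `r` rescales its argument by
`r⁻¹`; both preserve compact support. -/
theorem hasCompactSupport_fourier_rescaledTest {η : 𝓢(Space d, ℂ)}
    (hη : HasCompactSupport (𝓕 η : 𝓢(Space d, ℂ))) (r : ℝ) (hr : r ≠ 0) (x : Space d) :
    HasCompactSupport (𝓕 (rescaledTest η r hr x) : 𝓢(Space d, ℂ)) := by
  have key : ∀ ξ, 𝓕 (rescaledTest η r hr x) ξ =
      (Complex.exp (((-2 * Real.pi * inner ℝ x ξ : ℝ) : ℂ) * Complex.I) *
        |(r ^ Module.finrank ℝ (Space d))⁻¹|) * 𝓕 η (r⁻¹ • ξ) := by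
    intro ξ
    have h3 := Measure.integral_comp_smul volume (fun v : Space d =>
      Complex.exp (((-2 * Real.pi * inner ℝ v (r⁻¹ • ξ) : ℝ) : ℂ) * Complex.I) • η v) r
    rw [Complex.real_smul] at h3
    rw [SchwartzMap.fourier_coe, Real.fourier_eq', SchwartzMap.fourier_coe, Real.fourier_eq',
      ← integral_add_right_eq_self _ x, mul_assoc, ← h3, ← integral_const_mul]
    refine integral_congr_ae (Filter.Eventually.of_forall fun y => ?_)
    simp only [rescaledTest_apply, add_sub_cancel_right, smul_eq_mul, real_inner_smul_left,
      real_inner_smul_right, inv_mul_cancel_left₀ hr]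
    rw [← mul_assoc, ← Complex.exp_add, inner_add_left]
    congr 2
    push_cast
    ring
  have h1 : HasCompactSupport fun ξ => 𝓕 η (r⁻¹ • ξ) := hη.comp_smul (inv_ne_zero hr)
  have h2 : ⇑(𝓕 (rescaledTest η r hr x) : 𝓢(Space d, ℂ)) = _ := funext key
  rw [h2]
  exact h1.mul_left

/-- The inverse transform of a bump equal to one at the origin, since the transform at zero is the
total integral. -/
theorem exists_bandLimited : ∃ η : 𝓢(Space d, ℂ),
    HasCompactSupport (𝓕 η : 𝓢(Space d, ℂ)) ∧ ∫ x, η x = 1 := by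
  let β : ContDiffBump (0 : Space d) := ⟨1, 2, one_pos, one_lt_two⟩
  have hc : HasCompactSupport fun x => (β x : ℂ) :=
    β.hasCompactSupport.comp_left (g := fun t : ℝ => (t : ℂ)) (by simp)
  let χ : 𝓢(Space d, ℂ) := hc.toSchwartzMap (Complex.ofRealCLM.contDiff.comp β.contDiff)
  have hχ : 𝓕 (𝓕⁻ χ) = χ := FourierTransform.fourier_fourierInv_eq χ
  refine ⟨𝓕⁻ χ, by rw [hχ]; exact hc, ?_⟩
  have h1 : 𝓕 (𝓕⁻ χ) 0 = ∫ x, 𝓕⁻ χ x := by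
    rw [SchwartzMap.fourier_coe, Real.fourier_eq']
    simp
  rw [← h1, hχ]
  change ((β 0 : ℝ) : ℂ) = 1
  rw [β.one_of_mem_closedBall (by simp [β])]
  simp

theorem adjointOp_pow_postcomp_re (M : ℕ) (b : (Fin d → ℕ) → ℝ) (m : ℕ) (η : 𝓢(Space d, ℂ)) :
    ((adjointOp ℂ M b ^ m) η).postcompCLM Complex.reCLM =
      (adjointOp ℝ M b ^ m) (η.postcompCLM Complex.reCLM) := by
  induction m with
  | zero => simp
  | succ m ih => rw [pow_succ', Module.End.mul_apply, adjointOp_postcomp, ih, pow_succ']; rfl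

/-- A bounded continuous function whose pairings with the functions `Re η(r (· - x))` vanish is
zero. -/
theorem eq_zero_of_pairing_rescaledTest {η : 𝓢(Space d, ℂ)} (hη : ∫ x, η x = 1) {w : Space d → ℝ}
    (hw : Continuous w) {D : ℝ} (hD : ∀ x, |w x| ≤ D) (x : Space d)
    (h : ∀ (r : ℝ) (hr : r ≠ 0), ∫ y, w y * (rescaledTest η r hr x y).re = 0) : w x = 0 := by
  have hre : ∫ z, (η z).re = 1 := by
    have := congrArg Complex.re hη
    rw [← Complex.reCLM_apply, ← Complex.reCLM.integral_comp_comm η.integrable] at this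
    simpa using this
  -- With `r = k + 1` and `z = r (y - x)`, the hypothesis becomes an average of `w` at points
  -- tending to `x`, with a fixed weight of integral one.
  have h1 : ∀ k : ℕ, ∫ z, w (((k : ℝ) + 1)⁻¹ • z + x) * (η z).re = 0 := by
    intro k
    have hr : (k : ℝ) + 1 ≠ 0 := by positivity
    have h2 := h _ hr
    rw [← integral_add_right_eq_self _ x] at h2
    simp only [rescaledTest_apply, add_sub_cancel_right] at h2
    have h3 := Measure.integral_comp_smul volume
      (fun z => w (((k : ℝ) + 1)⁻¹ • z + x) * (η z).re) ((k : ℝ) + 1)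
    simp only [inv_smul_smul₀ hr] at h3
    rw [h2] at h3
    have := (smul_eq_zero.1 h3.symm).resolve_left (by positivity)
    exact this
  have hlim : Filter.Tendsto (fun k : ℕ => ∫ z, w (((k : ℝ) + 1)⁻¹ • z + x) * (η z).re)
      Filter.atTop (nhds (∫ z, w x * (η z).re)) := by
    refine tendsto_integral_of_dominated_convergence (fun z => D * ‖η z‖) (fun k => ?_)
      (η.integrable.norm.const_mul _) (fun k => ?_) ?_
    · exact ((hw.comp (by fun_prop)).mul
        (Complex.continuous_re.comp η.continuous)).aestronglyMeasurable
    · refine Filter.Eventually.of_forall fun z => ?_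
      rw [norm_mul]
      exact mul_le_mul (hD _) (Complex.abs_re_le_norm _) (norm_nonneg _)
        ((abs_nonneg _).trans (hD x))
    · refine Filter.Eventually.of_forall fun z => ?_
      refine Filter.Tendsto.mul_const _ ?_
      have h0 : Filter.Tendsto (fun k : ℕ => ((k : ℝ) + 1)⁻¹ • z + x) Filter.atTop
          (nhds ((0 : ℝ) • z + x)) := by
        refine Filter.Tendsto.add_const _ (Filter.Tendsto.smul_const ?_ _)
        simpa using tendsto_one_div_add_atTop_nhds_zero_nat (𝕜 := ℝ)
      rw [zero_smul, zero_add] at h0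
      exact (hw.tendsto x).comp h0
  simp only [h1, integral_const_mul, hre, mul_one] at hlim
  exact (tendsto_nhds_unique hlim tendsto_const_nhds)

end BandLimitedTests

/-! ### Uniqueness of bounded solutions. -/

section Uniqueness

variable {d N M : ℕ} {a : ℕ → ℝ} {b : (Fin d → ℕ) → ℝ} {p : Fin N → ℝ}
  {f : Fin N → Space d → ℝ} {F : ℝ → Space d → ℝ} {S : ℝ} {v w : ℝ → Space d → ℝ}

namespace IsBoundedSolution

theorem continuous_slice (h : IsBoundedSolution N M a b p f F S v) {t : ℝ} (ht : t ∈ Icc 0 S) :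
    Continuous (v t) :=
  continuousOn_univ.1 (h.continuousOn.comp (f := fun x : Space d => (t, x)) (by fun_prop)
    fun x _ => ⟨ht, mem_univ x⟩)

theorem integrable_mul (h : IsBoundedSolution N M a b p f F S v) {t : ℝ} (ht : t ∈ Icc 0 S)
    (φ : 𝓢(Space d, ℝ)) : Integrable fun x => v t x * φ x := by
  obtain ⟨D, hD⟩ := h.bounded
  exact φ.integrable.bdd_mul (c := D) (h.continuous_slice ht).aestronglyMeasurable
    (Filter.Eventually.of_forall (hD t ht))

/-- The weak equation is used with the test functions `L^m φ`, where `φ` is the real part of a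
band-limited `ψ`. The source cancels in the difference, and `L^m φ` is the real part of `L^m ψ`, so
the geometric `L¹` bound for `ψ` controls the whole hierarchy. -/
theorem unique [NeZero N] (hS : 0 < S) (ha : a N = 1) (hv : IsBoundedSolution N M a b p f F S v)
    (hw : IsBoundedSolution N M a b p f F S w) : ∀ t ∈ Icc 0 S, ∀ x, v t x = w t x := by
  have hu := uniqueDiffOn_Icc hS
  have h0S : (0 : ℝ) ∈ Icc 0 S := ⟨le_rfl, hS.le⟩
  obtain ⟨Dv, hDv⟩ := hv.bounded
  obtain ⟨Dw, hDw⟩ := hw.bounded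
  have hD : ∀ t ∈ Icc 0 S, ∀ x, |v t x - w t x| ≤ Dv + Dw := fun t ht x =>
    (abs_sub _ _).trans (add_le_add (hDv t ht x) (hDw t ht x))
  obtain ⟨η, hηc, hη1⟩ := exists_bandLimited (d := d)
  have hiter : ∀ φ, ∀ k ≤ N, ∀ t ∈ Icc 0 S,
      iteratedDerivWithin k (pairing v φ - pairing w φ) (Icc 0 S) t =
      iteratedDerivWithin k (pairing v φ) (Icc 0 S) t -
        iteratedDerivWithin k (pairing w φ) (Icc 0 S) t := fun φ k hk t ht =>
    iteratedDerivWithin_sub ht hu ((hv.contDiffOn φ t ht).of_le (by exact_mod_cast hk))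
      ((hw.contDiffOn φ t ht).of_le (by exact_mod_cast hk))
  have hzero : ∀ (r : ℝ) (hr : r ≠ 0) (x : Space d), ∀ t ∈ Icc 0 S,
      ∫ y, (v t y - w t y) * (rescaledTest η r hr x y).re = 0 := by
    intro r hr x
    set ψ := rescaledTest η r hr x with hψ
    set φ : 𝓢(Space d, ℝ) := ψ.postcompCLM Complex.reCLM with hφ
    obtain ⟨R, hR0, hR⟩ := exists_integral_norm_adjointOp_pow_le M b ψ
      (hasCompactSupport_fourier_rescaledTest hηc r hr x)
    have hdiff : ∀ (φ : 𝓢(Space d, ℝ)), ∀ t ∈ Icc 0 S, (pairing v φ - pairing w φ) t =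
        ∫ y, (v t y - w t y) * φ y := by
      intro φ t ht
      simp only [Pi.sub_apply, pairing, sub_mul]
      rw [integral_sub (hv.integrable_mul ht φ) (hw.integrable_mul ht φ)]
    have key := eq_zero_of_hierarchy (NeZero.pos N) ha hS
      (y := fun m => pairing v ((adjointOp ℝ M b ^ m) φ) - pairing w ((adjointOp ℝ M b ^ m) φ))
      (fun m => (hv.contDiffOn _).sub (hw.contDiffOn _)) (fun m k hk => ?_) (fun m t ht => ?_)
      (D := (Dv + Dw) * ∫ x, ‖ψ x‖) hR0 (fun m t ht => ?_)
    · intro t ht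
      have := key t ht
      rw [hdiff _ t ht] at this
      exact this
    · rw [hiter _ k hk.le 0 h0S, hv.initial _ ⟨k, hk⟩, hw.initial _ ⟨k, hk⟩, sub_self]
    · have h1 := hv.equation ((adjointOp ℝ M b ^ m) φ) t ht
      have h2 := hw.equation ((adjointOp ℝ M b ^ m) φ) t ht
      rw [← pairing_adjointOp (hv.integrable_mul ht)] at h1
      rw [← pairing_adjointOp (hw.integrable_mul ht)] at h2
      rw [pow_succ', Module.End.mul_apply, Pi.sub_apply]
      rw [Finset.sum_congr rfl fun n hn => by
        rw [hiter _ n (Finset.mem_Icc.1 hn).2 t ht, mul_sub], Finset.sum_sub_distrib]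
      linarith
    · have h1 : ∀ y, ((adjointOp ℝ M b ^ m) φ) y = (((adjointOp ℂ M b ^ m) ψ) y).re := fun y => by
        rw [hφ, ← adjointOp_pow_postcomp_re]; rfl
      rw [hdiff _ t ht, mul_assoc]
      have hDn : 0 ≤ Dv + Dw := (abs_nonneg _).trans (hD t ht 0)
      refine (abs_integral_le_integral_abs).trans
        (le_trans ?_ (mul_le_mul_of_nonneg_left (hR m) hDn))
      rw [← integral_const_mul]
      refine integral_mono_of_nonneg (Filter.Eventually.of_forall fun _ => abs_nonneg _)
        ((SchwartzMap.integrable _).norm.const_mul _) (Filter.Eventually.of_forall fun y => ?_)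
      simp only [abs_mul, h1]
      exact mul_le_mul (hD t ht y) (Complex.abs_re_le_norm _) (abs_nonneg _) hDn
  intro t ht x
  have := eq_zero_of_pairing_rescaledTest hη1 (w := fun y => v t y - w t y)
    ((hv.continuous_slice ht).sub (hw.continuous_slice ht)) (hD t ht) x
    fun r hr => hzero r hr x t ht
  exact sub_eq_zero.1 this

end IsBoundedSolution

end Uniqueness

/-! ### The probabilistic representation -/

section Expectation

variable {Ω : Type*} [MeasurableSpace Ω] {P : Measure Ω} [IsProbabilityMeasure P]

/-- Expectation of `1_{τ < t} q(τ, Y) / r(τ)` for a random time `τ` with density `r`, independent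
of `Y`. -/
theorem expectation_random_time {Ω' : Type*} [MeasurableSpace Ω'] {τ : Ω → ℝ} {Y : Ω → Ω'}
    (hτ : Measurable τ) (hY : Measurable Y) (hind : IndepFun τ Y P) {r : ℝ → ℝ≥0}
    (hr : Measurable r)
    (hlaw : P.map τ = (volume.restrict (Ici 0)).withDensity fun s => (r s : ℝ≥0∞))
    (hpos : ∀ s, 0 < s → r s ≠ 0) {t : ℝ} {q : ℝ → Ω' → ℝ} (hq : Measurable (Function.uncurry q))
    (hi : ∀ s ∈ Ioo 0 t, Integrable (fun ω => q s (Y ω)) P) {m : ℝ → ℝ}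
    (hm : IntegrableOn m (Ioo 0 t)) (hmb : ∀ s ∈ Ioo 0 t, ∫ ω, |q s (Y ω)| ∂P ≤ m s) :
    Integrable (fun ω => if τ ω < t then q (τ ω) (Y ω) / r (τ ω) else 0) P ∧
      ∫ ω, (if τ ω < t then q (τ ω) (Y ω) / r (τ ω) else 0) ∂P =
        ∫ s in Ioo 0 t, ∫ ω, q s (Y ω) ∂P := by
  set κ := P.map Y with hκ
  have : IsProbabilityMeasure κ := Measure.isProbabilityMeasure_map hY.aemeasurable
  have : IsProbabilityMeasure (P.map τ) := Measure.isProbabilityMeasure_map hτ.aemeasurable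
  have hqs : ∀ s, Measurable (q s) := fun s => hq.comp (by fun_prop : Measurable fun y => (s, y))
  let k : ℝ × Ω' → ℝ := fun z => if z.1 < t then q z.1 z.2 / r z.1 else 0
  have hk : Measurable k := Measurable.ite (measurableSet_lt measurable_fst measurable_const)
    (hq.div (measurable_coe_nnreal_real.comp (hr.comp measurable_fst))) measurable_const
  have hprod : P.map (fun ω => (τ ω, Y ω)) = (P.map τ).prod κ :=
    (indepFun_iff_map_prod_eq_prod_map_map hτ.aemeasurable hY.aemeasurable).1 hind
  have hτY : Measurable fun ω => (τ ω, Y ω) := hτ.prodMk hY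
  have h0 : ∀ᵐ s ∂(volume.restrict (Ici (0 : ℝ))), 0 < s := by
    rw [← restrict_Ioi_eq_restrict_Ici]
    exact ae_restrict_mem measurableSet_Ioi
  have hκi : ∀ s ∈ Ioo 0 t, Integrable (q s) κ := fun s hs =>
    (integrable_map_measure (hqs s).aestronglyMeasurable hY.aemeasurable).2 (hi s hs)
  have hset : Iio t ∩ Ioi 0 = Ioo 0 t := by ext; simp [and_comm]
  -- The density of the law of `τ` cancels the division by `r`; only `s > 0` matters, as time zero
  -- is a null set.
  have hnorm : ∀ s, 0 < s → r s • ∫ y, ‖k (s, y)‖ ∂κ =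
      (Iio t).indicator (fun s => ∫ y, ‖q s y‖ ∂κ) s := by
    intro s hs
    by_cases hst : s < t
    · have h1 : (r s : ℝ) ≠ 0 := by exact_mod_cast hpos s hs
      simp only [k, hst, if_true, norm_div, integral_div, indicator_of_mem (mem_Iio.2 hst),
        NNReal.smul_def, smul_eq_mul]
      have h2 : ‖(r s : ℝ)‖ = r s := Real.norm_of_nonneg (r s).2
      rw [h2, mul_div_cancel₀ _ h1]
    · simp [k, hst]
  have hval : ∀ s, 0 < s → r s • ∫ y, k (s, y) ∂κ =
      (Iio t).indicator (fun s => ∫ y, q s y ∂κ) s := by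
    intro s hs
    by_cases hst : s < t
    · have h1 : (r s : ℝ) ≠ 0 := by exact_mod_cast hpos s hs
      simp only [k, hst, if_true, integral_div, indicator_of_mem (mem_Iio.2 hst),
        NNReal.smul_def, smul_eq_mul]
      rw [mul_div_cancel₀ _ h1]
    · simp [k, hst]
  have hki : Integrable k ((P.map τ).prod κ) := by
    refine (integrable_prod_iff hk.aestronglyMeasurable).2 ⟨?_, ?_⟩
    · rw [hlaw]
      filter_upwards [(withDensity_absolutelyContinuous _ _).ae_le h0] with s hs
      by_cases hst : s < t
      · simp only [k, hst, if_true]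
        exact (hκi s ⟨hs, hst⟩).div_const _
      · simp [k, hst]
    · have h1 : IntegrableOn (fun s => ∫ y, ‖q s y‖ ∂κ) (Ioo 0 t) := by
        refine Integrable.mono' hm
          (StronglyMeasurable.integral_prod_right' (ν := κ) (f := fun z : ℝ × Ω' => ‖q z.1 z.2‖)
            hq.norm.stronglyMeasurable).aestronglyMeasurable ?_
        filter_upwards [ae_restrict_mem measurableSet_Ioo] with s hs
        rw [Real.norm_of_nonneg (integral_nonneg fun y => norm_nonneg _), hκ,
          integral_map hY.aemeasurable (hqs s).norm.aestronglyMeasurable]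
        exact hmb s hs
      rw [hlaw, integrable_withDensity_iff_integrable_smul hr, integrable_congr (h0.mono hnorm),
        integrable_indicator_iff measurableSet_Iio, IntegrableOn, ← restrict_Ioi_eq_restrict_Ici,
        Measure.restrict_restrict measurableSet_Iio, hset]
      exact h1
  have hki' := hki
  rw [← hprod] at hki'
  refine ⟨(integrable_map_measure hk.aestronglyMeasurable hτY.aemeasurable).1 hki', ?_⟩
  calc ∫ ω, k (τ ω, Y ω) ∂P = ∫ z, k z ∂((P.map τ).prod κ) := by
        rw [← hprod, integral_map hτY.aemeasurable hk.aestronglyMeasurable]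
    _ = ∫ s in Ioo 0 t, ∫ y, q s y ∂κ := by
        rw [integral_prod _ hki, hlaw, integral_withDensity_eq_integral_smul hr,
          integral_congr_ae (h0.mono hval), integral_indicator measurableSet_Iio,
          ← restrict_Ioi_eq_restrict_Ici, Measure.restrict_restrict measurableSet_Iio, hset]
    _ = ∫ s in Ioo 0 t, ∫ ω, q s (Y ω) ∂P :=
        integral_congr_ae (Filter.Eventually.of_forall fun s =>
          integral_map hY.aemeasurable (hqs s).aestronglyMeasurable)

/-- The expectation of an integrable random variable over an independent event. -/
theorem integral_indicator_indep {X : Type*} [MeasurableSpace X] {U : Ω → X} {V : Ω → ℝ}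
    (hU : Measurable U) (hind : IndepFun U V P)
    (hVi : Integrable V P) {A : Set X} (hA : MeasurableSet A) :
    Integrable (fun ω => A.indicator 1 (U ω) * V ω) P ∧
      ∫ ω, A.indicator 1 (U ω) * V ω ∂P = (P (U ⁻¹' A)).toReal * ∫ ω, V ω ∂P := by
  have h1 : Measurable (A.indicator (1 : X → ℝ)) := measurable_one.indicator hA
  have h2 : IndepFun (fun ω => A.indicator (1 : X → ℝ) (U ω)) V P := hind.comp h1 measurable_id
  have h3 : Integrable (fun ω => A.indicator (1 : X → ℝ) (U ω)) P := by
    have := (integrable_const (1 : ℝ) (μ := P)).indicator (hU hA)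
    exact this
  refine ⟨h2.integrable_mul h3 hVi, ?_⟩
  rw [h2.integral_fun_mul_eq_mul_integral h3.aestronglyMeasurable hVi.aestronglyMeasurable]
  congr 1
  have := integral_indicator_one (μ := P) (hU hA)
  exact this

end Expectation

/-! ### Signed measures with densities. -/

section Laws

variable {d : ℕ}

/-- A signed measure whose Jordan decomposition has densities `γ⁺`, `γ⁻` with respect to `μ`, with
bounded difference. -/
theorem signedIntegral_eq_integral_density {g : SignedMeasure (Space d)} {μ : Measure (Space d)}
    {γp γm : Space d → ℝ≥0} (hp : Measurable γp) (hm : Measurable γm)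
    (hgp : g.toJordanDecomposition.posPart = μ.withDensity fun z => (γp z : ℝ≥0∞))
    (hgm : g.toJordanDecomposition.negPart = μ.withDensity fun z => (γm z : ℝ≥0∞))
    (f : Space d →ᵇ ℝ) :
    Integrable (fun z => ((γp z : ℝ) - γm z) * f z) μ ∧
    signedIntegral g f = ∫ z, ((γp z : ℝ) - γm z) * f z ∂μ ∧
    ∫ z, |((γp z : ℝ) - γm z) * f z| ∂μ ≤ ‖f‖ * (g.totalVariation univ).toReal := by
  have key : ∀ {ν : Measure (Space d)} [IsFiniteMeasure ν] {γ : Space d → ℝ≥0}, Measurable γ →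
      ν = μ.withDensity (fun z => (γ z : ℝ≥0∞)) →
      Integrable (fun z => (γ z : ℝ)) μ ∧ ∫ z, (γ z : ℝ) ∂μ = (ν univ).toReal ∧
      Integrable (fun z => (γ z : ℝ) * f z) μ ∧ ∫ z, f z ∂ν = ∫ z, (γ z : ℝ) * f z ∂μ := by
    intro ν _ γ hγ hν
    have h1 : Integrable (fun _ => (1 : ℝ)) ν := integrable_const _
    have h2 : Integrable f ν := f.integrable _
    have h3 : ∫ _, (1 : ℝ) ∂ν = (ν univ).toReal := by simp [Measure.real]
    rw [← h3]
    rw [hν] at h1 h2 ⊢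
    rw [integrable_withDensity_iff_integrable_smul hγ] at h1 h2
    rw [integral_withDensity_eq_integral_smul hγ, integral_withDensity_eq_integral_smul hγ]
    simp only [NNReal.smul_def, smul_eq_mul, mul_one] at h1 h2 ⊢
    exact ⟨h1, trivial, h2, trivial⟩
  obtain ⟨p1, p2, p3, p4⟩ := key hp hgp
  obtain ⟨m1, m2, m3, m4⟩ := key hm hgm
  have hi : Integrable (fun z => ((γp z : ℝ) - γm z) * f z) μ := by
    simp only [sub_mul]
    exact p3.sub m3
  refine ⟨hi, ?_, ?_⟩
  · rw [signedIntegral, p4, m4, ← integral_sub p3 m3]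
    simp only [sub_mul]
  · rw [SignedMeasure.totalVariation, Measure.add_apply,
      ENNReal.toReal_add (measure_ne_top _ _) (measure_ne_top _ _), ← p2, ← m2,
      ← integral_add p1 m1, ← integral_const_mul]
    refine integral_mono hi.abs ((p1.add m1).const_mul _) fun z => ?_
    rw [abs_mul, mul_comm]
    refine mul_le_mul (f.norm_coe_le_norm z) ?_ (abs_nonneg _) (norm_nonneg _)
    rw [abs_le]
    constructor <;> linarith [(γp z).2, (γm z).2]

end Laws

/-! ### Expectations of the two terms of the random variable. -/

section Sampling

variable {d : ℕ} {Ω : Type*} [MeasurableSpace Ω] {P : Measure Ω} {ρ : ℝ → ℝ} {τ : Ω → ℝ}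
  {T : EReal}

theorem ae_time_pos (hτ : Measurable τ)
    (hlaw : P.map τ = (volume.restrict (Ici 0)).withDensity fun t => ENNReal.ofReal (ρ t)) :
    ∀ᵐ ω ∂P, 0 < τ ω := by
  refine ae_of_ae_map hτ.aemeasurable (p := fun s => 0 < s) ?_
  rw [hlaw]
  refine (withDensity_absolutelyContinuous _ _).ae_le ?_
  rw [← restrict_Ioi_eq_restrict_Ici]
  exact ae_restrict_mem measurableSet_Ioi

variable [IsProbabilityMeasure P]

theorem tail_eq_and_pos (hρ : ContinuousOn ρ (Ici 0)) (hpos : ∀ t, 0 < t → 0 < ρ t)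
    (hτ : Measurable τ)
    (hlaw : P.map τ = (volume.restrict (Ici 0)).withDensity fun t => ENNReal.ofReal (ρ t))
    {t : ℝ} (ht : 0 ≤ t) : (P (τ ⁻¹' Ici t)).toReal = tail ρ t ∧ 0 < tail ρ t := by
  have h1 : P (τ ⁻¹' Ici t) = ∫⁻ s in Ioi t, ENNReal.ofReal (ρ s) := by
    rw [← Measure.map_apply hτ measurableSet_Ici, hlaw, withDensity_apply _ measurableSet_Ici,
      Measure.restrict_restrict measurableSet_Ici, Ici_inter_Ici, max_eq_left ht,
      restrict_Ioi_eq_restrict_Ici]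
  have hsub : Ioi t ⊆ Ici 0 := fun s hs => ht.trans (le_of_lt hs)
  have h2 : (P (τ ⁻¹' Ici t)).toReal = tail ρ t := by
    rw [h1, tail, integral_eq_lintegral_of_nonneg_ae]
    · filter_upwards [ae_restrict_mem measurableSet_Ioi] with s hs
      exact (hpos s (ht.trans_lt hs)).le
    · exact (hρ.mono hsub).aestronglyMeasurable measurableSet_Ioi
  refine ⟨h2, ?_⟩
  rw [← h2]
  refine ENNReal.toReal_pos ?_ (measure_ne_top _ _)
  rw [h1]
  intro h0
  rw [lintegral_eq_zero_iff'
    ((hρ.mono hsub).aemeasurable measurableSet_Ioi).ennreal_ofReal] at h0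
  have h3 : ∀ᵐ s ∂(volume.restrict (Ioi t)), False := by
    filter_upwards [h0, ae_restrict_mem measurableSet_Ioi] with s hs hst
    have := hpos s (ht.trans_lt hst)
    simp only [Pi.zero_apply, ENNReal.ofReal_eq_zero] at hs
    exact absurd this (not_lt.2 hs)
  rw [Filter.eventually_false_iff_eq_bot, ae_eq_bot, Measure.restrict_eq_zero] at h3
  simp at h3

theorem measurable_clamped_integrand {Ω' : Type*} [MeasurableSpace Ω'] {Z : ℝ → Ω' → Space d}
    (hZ : Measurable fun q : timeSet T × Ω' => Z q.1 q.2) {γ : ℝ → Space d → ℝ}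
    (hγ : Measurable fun q : timeSet T × Space d => γ q.1 q.2) {Φ : ℝ → Space d → ℝ}
    (hΦ : Continuous fun q : ℝ × Space d => Φ q.1 q.2) {c : ℝ → ℝ} (hc : Measurable c)
    (hcT : ∀ s, c s ∈ timeSet T) (t : ℝ) (x : Space d) :
    Measurable (Function.uncurry fun s ω =>
      γ (c s) (Z (c s) ω) * Φ (t - s) (x - Z (c s) ω)) := by
  have hc' : Measurable fun q : ℝ × Ω' => (⟨c q.1, hcT q.1⟩ : timeSet T) :=
    (hc.comp measurable_fst).subtype_mk
  have h1 : Measurable fun q : ℝ × Ω' => Z (c q.1) q.2 := hZ.comp (hc'.prodMk measurable_snd)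
  have h2 : Measurable fun q : ℝ × Ω' => γ (c q.1) (Z (c q.1) q.2) := hγ.comp (hc'.prodMk h1)
  have h3 : Measurable fun q : ℝ × Ω' => Φ (t - q.1) (x - Z (c q.1) q.2) :=
    hΦ.measurable.comp ((measurable_const.sub measurable_fst).prodMk (measurable_const.sub h1))
  exact h2.mul h3

/-- All randomness of the displacement enters through `Y`, independent of `τ`. This makes it
possible to evaluate `Z` at the random time `τ` by Fubini, with the integrable total mass as
dominating function. -/
theorem expectation_random_part {Ω' : Type*} [MeasurableSpace Ω'] {Y : Ω → Ω'}
    (hρ : ContinuousOn ρ (Ici 0)) (hpos : ∀ t, 0 < t → 0 < ρ t) (hτ : Measurable τ)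
    (hlaw : P.map τ = (volume.restrict (Ici 0)).withDensity fun t => ENNReal.ofReal (ρ t))
    (hY : Measurable Y) (hind : IndepFun τ Y P) {Z : ℝ → Ω' → Space d}
    (hZ : Measurable fun q : timeSet T × Ω' => Z q.1 q.2) {γ : ℝ → Space d → ℝ}
    (hγ : Measurable fun q : timeSet T × Space d => γ q.1 q.2) {g : ℝ → SignedMeasure (Space d)}
    (hg : ∀ s ∈ timeSet T, ∀ f : Space d →ᵇ ℝ,
      Integrable (fun z => γ s z * f z) (P.map fun ω => Z s (Y ω)) ∧
      signedIntegral (g s) f = ∫ z, γ s z * f z ∂(P.map fun ω => Z s (Y ω)) ∧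
      ∫ z, |γ s z * f z| ∂(P.map fun ω => Z s (Y ω)) ≤
        ‖f‖ * ((g s).totalVariation univ).toReal)
    {t : ℝ} (ht : t ∈ timeSet T)
    (hmass : IntegrableOn (fun s => ((g s).totalVariation univ).toReal) (Icc 0 t))
    {Φ : ℝ → Space d →ᵇ ℝ} (hΦ : Continuous fun q : ℝ × Space d => Φ q.1 q.2) {B : ℝ}
    (hB : ∀ r, ‖Φ r‖ ≤ B) (x : Space d) :
    Integrable (fun ω => if τ ω < t then γ (τ ω) (Z (τ ω) (Y ω)) / ρ (τ ω) *
      Φ (t - τ ω) (x - Z (τ ω) (Y ω)) else 0) P ∧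
    ∫ ω, (if τ ω < t then γ (τ ω) (Z (τ ω) (Y ω)) / ρ (τ ω) *
      Φ (t - τ ω) (x - Z (τ ω) (Y ω)) else 0) ∂P =
      ∫ s in (0)..t, signedConv (g s) (Φ (t - s)) x := by
  -- Joint measurability is available only over `timeSet T`; clamping gives an integrand measurable
  -- on the whole line that is unchanged for times in `(0, t)`.
  let c : ℝ → ℝ := fun s => max 0 (min s t)
  have hcT : ∀ s, c s ∈ timeSet T := fun s => ⟨le_max_left _ _,
    lt_of_le_of_lt (EReal.coe_le_coe_iff.2 (max_le ht.1 (min_le_right _ _))) ht.2⟩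
  have hcs : ∀ s ∈ Ioo 0 t, c s = s := fun s hs => by
    simp only [c]; rw [min_eq_left hs.2.le, max_eq_right hs.1.le]
  have hIT : ∀ s ∈ Ioo 0 t, s ∈ timeSet T := fun s hs => hcs s hs ▸ hcT s
  -- A nonnegative measurable version of `ρ` on the line; nothing is known about `ρ` at negative
  -- times.
  let r : ℝ → ℝ≥0 := fun s => (ρ (max s 0)).toNNReal
  have hr : Measurable r := by
    have : Continuous fun s => ρ (max s 0) :=
      hρ.comp_continuous (by fun_prop) fun s => mem_Ici.2 (le_max_right _ _)
    exact (continuous_real_toNNReal.comp this).measurable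
  have hrρ : ∀ s, 0 < s → (r s : ℝ) = ρ s := fun s hs => by
    simp only [r]; rw [max_eq_left hs.le, Real.coe_toNNReal _ (hpos s hs).le]
  have hlaw' : P.map τ = (volume.restrict (Ici 0)).withDensity fun s => (r s : ℝ≥0∞) := by
    rw [hlaw]
    refine withDensity_congr_ae ?_
    filter_upwards [ae_restrict_mem measurableSet_Ici] with s hs
    simp only [r]; rw [max_eq_left hs]; rfl
  have hr0 : ∀ s, 0 < s → r s ≠ 0 := fun s hs h0 => by
    have := hrρ s hs
    rw [h0] at this
    exact (hpos s hs).ne this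
  let q : ℝ → Ω' → ℝ := fun s ω => γ (c s) (Z (c s) ω) * Φ (t - s) (x - Z (c s) ω)
  have hq : Measurable (Function.uncurry q) :=
    measurable_clamped_integrand hZ hγ (Φ := fun r z => Φ r z) hΦ (by fun_prop) hcT t x
  have hZs : ∀ s ∈ timeSet T, Measurable fun ω => Z s (Y ω) := fun s hs =>
    hZ.comp ((measurable_const (a := (⟨s, hs⟩ : timeSet T))).prodMk hY)
  have hγs : ∀ s ∈ timeSet T, Measurable (γ s) := fun s hs =>
    hγ.comp ((measurable_const (a := (⟨s, hs⟩ : timeSet T))).prodMk measurable_id)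
  have hm : ∀ s ∈ timeSet T, AEStronglyMeasurable (fun z => γ s z * reflected (Φ (t - s)) x z)
      (P.map fun ω => Z s (Y ω)) := fun s hs =>
    ((hγs s hs).mul (reflected (Φ (t - s)) x).continuous.measurable).aestronglyMeasurable
  have hqe : ∀ s ∈ Ioo 0 t, ∀ ω, q s (Y ω) =
      γ s (Z s (Y ω)) * reflected (Φ (t - s)) x (Z s (Y ω)) := fun s hs ω => by
    simp only [q, hcs s hs]; rfl
  obtain ⟨h1, h2⟩ := expectation_random_time hτ hY hind hr hlaw' hr0 (t := t) hq
    (m := fun s => B * ((g s).totalVariation univ).toReal)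
    (fun s hs => by
      simp only [hqe s hs]
      exact (integrable_map_measure (hm s (hIT s hs)) (hZs s (hIT s hs)).aemeasurable).1
        (hg s (hIT s hs) _).1)
    ((hmass.mono_set Ioo_subset_Icc_self).const_mul B)
    (fun s hs => by
      simp only [hqe s hs]
      rw [← integral_map (f := fun z => |γ s z * reflected (Φ (t - s)) x z|)
        (hZs s (hIT s hs)).aemeasurable (hm s (hIT s hs)).norm]
      exact (hg s (hIT s hs) _).2.2.trans (mul_le_mul_of_nonneg_right
        ((norm_reflected_le _ _).trans (hB _)) ENNReal.toReal_nonneg))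
  have he : (fun ω => if τ ω < t then q (τ ω) (Y ω) / r (τ ω) else 0) =ᵐ[P]
      fun ω => if τ ω < t then γ (τ ω) (Z (τ ω) (Y ω)) / ρ (τ ω) *
        Φ (t - τ ω) (x - Z (τ ω) (Y ω)) else 0 := by
    filter_upwards [ae_time_pos hτ hlaw] with ω hω
    by_cases h : τ ω < t
    · simp only [h, if_true, q, hcs (τ ω) ⟨hω, h⟩, hrρ (τ ω) hω]
      ring
    · simp only [h, if_false]
  refine ⟨h1.congr he, ?_⟩
  rw [← integral_congr_ae he, h2, intervalIntegral.integral_of_le ht.1, integral_Ioc_eq_integral_Ioo]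
  refine setIntegral_congr_fun measurableSet_Ioo fun s hs => ?_
  simp only [hqe s hs]
  rw [← integral_map (f := fun z => γ s z * reflected (Φ (t - s)) x z)
    (hZs s (hIT s hs)).aemeasurable (hm s (hIT s hs)), ← (hg s (hIT s hs) _).2.1]
  rfl

/-- The variable is split over the events `I = n`, `t ≤ τ`. Each has probability `p n * tail ρ t`
and is independent of `V n`, and the tail cancels. -/
theorem expectation_fixed_part {N : ℕ} {I : Ω → Fin N} {p : Fin N → ℝ} (hp : ∀ n, 0 < p n)
    (hρ : ContinuousOn ρ (Ici 0)) (hpos : ∀ t, 0 < t → 0 < ρ t) (hτ : Measurable τ)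
    (hlaw : P.map τ = (volume.restrict (Ici 0)).withDensity fun t => ENNReal.ofReal (ρ t))
    (hI : Measurable I) (hIlaw : ∀ n, P (I ⁻¹' {n}) = ENNReal.ofReal (p n))
    (hτI : IndepFun τ I P) {V : Fin N → Ω → ℝ} (hV : ∀ n, Integrable (V n) P)
    (hind : ∀ n, IndepFun (fun ω => (I ω, τ ω)) (V n) P) {t : ℝ} (ht : 0 ≤ t) :
    Integrable (fun ω => if t ≤ τ ω then V (I ω) ω / tail ρ t else 0) P ∧
      ∫ ω, (if t ≤ τ ω then V (I ω) ω / tail ρ t else 0) ∂P = ∑ n, p n * ∫ ω, V n ω ∂P := by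
  obtain ⟨htail, htail0⟩ := tail_eq_and_pos hρ hpos hτ hlaw ht
  let A : Fin N → Set (Fin N × ℝ) := fun n => {n} ×ˢ Ici t
  have hA : ∀ n, MeasurableSet (A n) := fun n => (measurableSet_singleton n).prod measurableSet_Ici
  have hPA : ∀ n, (P ((fun ω => (I ω, τ ω)) ⁻¹' A n)).toReal = p n * tail ρ t := fun n => by
    have h1 : (fun ω => (I ω, τ ω)) ⁻¹' A n = τ ⁻¹' Ici t ∩ I ⁻¹' {n} := by
      ext ω; simp [A, and_comm]
    rw [h1, hτI.measure_inter_preimage_eq_mul _ _ measurableSet_Ici (measurableSet_singleton n),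
      hIlaw, ENNReal.toReal_mul, htail, ENNReal.toReal_ofReal (hp n).le, mul_comm]
  have he : (fun ω => if t ≤ τ ω then V (I ω) ω / tail ρ t else 0) =
      fun ω => ∑ n, (A n).indicator 1 (I ω, τ ω) * V n ω / tail ρ t := by
    funext ω
    rw [Finset.sum_eq_single (I ω)]
    · by_cases h : t ≤ τ ω
      · simp [h, A]
      · simp [h, A]
    · intro n _ hn
      simp [A, Ne.symm hn]
    · simp
  have key := fun n => integral_indicator_indep (hI.prodMk hτ) (hind n) (hV n) (hA n)
  rw [he]
  refine ⟨integrable_finsetSum _ fun n _ => (key n).1.div_const _, ?_⟩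
  rw [integral_finsetSum _ fun n _ => (key n).1.div_const _]
  refine Finset.sum_congr rfl fun n _ => ?_
  rw [integral_div, (key n).2, hPA]
  field_simp

end Sampling

/-! ### Identification of the expectation with Duhamel's formula. -/

section Representation

variable {d N M : ℕ} {a : ℕ → ℝ} {b : (Fin d → ℕ) → ℝ} {p : Fin N → ℝ} {T : EReal}
  {g : Fin N → ℝ → SignedMeasure (Space d)} {μ : Fin N → ℝ → Measure (Space d)}
  {γp γm : Fin N → ℝ → Space d → ℝ≥0} {S : ℝ}

theorem mem_timeSet_of_mem_Icc (hS : (S : EReal) < T) {t : ℝ} (ht : t ∈ Icc 0 S) : t ∈ timeSet T :=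
  ⟨ht.1, (EReal.coe_le_coe_iff.2 ht.2).trans_lt hS⟩

theorem clamp_mem_Icc (hS : 0 ≤ S) (t : ℝ) : max 0 (min t S) ∈ Icc 0 S :=
  ⟨le_max_left _ _, max_le hS (min_le_right _ _)⟩

theorem clamp_eq_self {t : ℝ} (ht : t ∈ Icc 0 S) : max 0 (min t S) = t := by
  rw [min_eq_left ht.2, max_eq_right ht.1]

/-- For a fixed test function the integral is continuous in `t`, hence bounded on the compact
interval `[0, S]`; Banach–Steinhaus makes the bound uniform over test functions. Clamping the time
avoids any condition outside `[0, S]`. -/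
theorem GreenMeasures.isGreenFamily [NeZero N] (hg : GreenMeasures N M a b T g μ γp γm)
    (hhat : GreenHatTempered N M a b T) (hS0 : 0 ≤ S) (hS : (S : EReal) < T) :
    ∃ C, IsGreenFamily N M a b S C fun n t => g n (max 0 (min t S)) := by
  have hcont : ∀ n, ∀ f : Space d →ᵇ ℝ,
      Continuous fun q : ℝ × Space d => signedConv (g n (max 0 (min q.1 S))) f q.2 := fun n f =>
    (hg.continuous_conv n f).comp_continuous
      (f := fun q : ℝ × Space d => (max 0 (min q.1 S), q.2)) (by fun_prop)
      fun q => ⟨mem_timeSet_of_mem_Icc hS (clamp_mem_Icc hS0 q.1), mem_univ _⟩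
  obtain ⟨C, hC0, hC⟩ := exists_signedIntegral_bound
    (fun i : Fin N × ℝ => g i.1 (max 0 (min i.2 S))) fun f => by
      -- An integral is the convolution with the reflected function at the origin, so the continuity
      -- hypothesis on convolutions applies to it.
      have h1 : ∀ n t, signedConv (g n t) (reflected f 0) 0 = signedIntegral (g n t) f := by
        intro n t
        have : (fun z => reflected f 0 (0 - z)) = f := by
          funext z
          change f (0 - (0 - z)) = f z
          rw [zero_sub, zero_sub, neg_neg]
        rw [signedConv, this]
      have h2 : ∀ n, ∃ C, ∀ t ∈ Icc 0 S, |signedIntegral (g n (max 0 (min t S))) f| ≤ C :=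
        fun n => by
          refine isCompact_Icc.exists_bound_of_continuousOn
            (f := fun t => signedIntegral (g n (max 0 (min t S))) f) (Continuous.continuousOn ?_)
          have := (hcont n (reflected f 0)).comp (by fun_prop : Continuous fun t : ℝ => (t, (0 : Space d)))
          simpa only [Function.comp_def, h1] using this
      choose c hc using h2
      refine ⟨∑ n, |c n|, fun i => ?_⟩
      have h3 := hc i.1 _ (clamp_mem_Icc hS0 i.2)
      rw [clamp_eq_self (clamp_mem_Icc hS0 i.2)] at h3
      exact h3.trans ((le_abs_self _).trans
        (Finset.single_le_sum (f := fun n => |c n|) (fun n _ => abs_nonneg _) (Finset.mem_univ i.1)))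
  refine ⟨C, hS0, hC0, fun n t f => hC (n, t) f, hcont, fun n t ht ξ => ?_, fun n t => ?_⟩
  · have htT := mem_timeSet_of_mem_Icc hS ht
    rw [clamp_eq_self ht]
    exact greenExp_eq_signedChar (hhat n t htT) (hg.represents n t htT) ξ
  · rw [clamp_eq_self (clamp_mem_Icc hS0 t)]

theorem duhamel_clamp [NeZero N] {f : Fin N → Space d →ᵇ ℝ} {Φ : ℝ → Space d →ᵇ ℝ} {t : ℝ}
    (ht : t ∈ Icc 0 S) (x : Space d) :
    duhamel (fun n t => g n (max 0 (min t S))) p f Φ t x = duhamel g p f Φ t x := by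
  simp only [duhamel, clamp_eq_self ht]
  congr 1
  refine intervalIntegral.integral_congr fun s hs => ?_
  rw [uIcc_of_le ht.1] at hs
  simp only [clamp_eq_self (S := S) ⟨hs.1, hs.2.trans ht.2⟩]

theorem IsBoundedSolution.congr {f : Fin N → Space d → ℝ} {F v w : ℝ → Space d → ℝ} (hS : 0 < S)
    (hv : IsBoundedSolution N M a b p f F S v) (h : ∀ t ∈ Icc 0 S, ∀ x, w t x = v t x) :
    IsBoundedSolution N M a b p f F S w := by
  have hp : ∀ φ : 𝓢(Space d, ℝ), EqOn (pairing w φ) (pairing v φ) (Icc 0 S) := fun φ t ht => by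
    simp only [pairing, h t ht]
  have hd : ∀ (φ : 𝓢(Space d, ℝ)) (n : ℕ), ∀ t ∈ Icc 0 S,
      iteratedDerivWithin n (pairing w φ) (Icc 0 S) t =
        iteratedDerivWithin n (pairing v φ) (Icc 0 S) t := fun φ n t ht =>
    iteratedDerivWithin_congr (hp φ) ht
  refine ⟨hv.continuousOn.congr fun q hq => h q.1 hq.1 q.2, ?_, fun φ =>
    (hv.contDiffOn φ).congr (hp φ), fun φ t ht => ?_, fun φ n => ?_⟩
  · obtain ⟨C, hC⟩ := hv.bounded
    exact ⟨C, fun t ht x => by rw [h t ht]; exact hC t ht x⟩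
  · simp only [hd φ _ t ht, hp _ ht]
    exact hv.equation φ t ht
  · rw [hd φ n 0 ⟨le_rfl, hS.le⟩, hv.initial φ n]

variable [NeZero N] {Ω : Type*} [mΩ : MeasurableSpace Ω] {P : Measure Ω} [IsProbabilityMeasure P]
  {ρ : ℝ → ℝ} {τ : Ω → ℝ} {I : Ω → Fin N} {Z : Fin N → ℝ → Ω → Space d}

theorem sample_expectation (hp : ∀ n, 0 < p n) (hg : GreenMeasures N M a b T g μ γp γm)
    (hsamp : IsSampling P T p ρ μ τ I Z) (f : Fin N → Space d →ᵇ ℝ) {F : ℝ → Space d → ℝ}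
    {Φ : ℝ → Space d →ᵇ ℝ} (hΦ : Continuous fun q : ℝ × Space d => Φ q.1 q.2) {B : ℝ}
    (hB : ∀ r, ‖Φ r‖ ≤ B) (hF : ∀ r, 0 ≤ r → ∀ x, F r x = Φ r x) {t : ℝ} (ht : t ∈ timeSet T)
    (x : Space d) :
    Integrable (sample (density γp γm) ρ (fun n => f n) F τ I Z t x) P ∧
      ∫ ω, sample (density γp γm) ρ (fun n => f n) F τ I Z t x ω ∂P = duhamel g p f Φ t x := by
  have hlaw := hsamp.displacements.1
  have hdens : ∀ n, ∀ s ∈ timeSet T, ∀ φ : Space d →ᵇ ℝ,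
      Integrable (fun z => density γp γm n s z * φ z) (P.map (Z n s)) ∧
      signedIntegral (g n s) φ = ∫ z, density γp γm n s z * φ z ∂(P.map (Z n s)) ∧
      ∫ z, |density γp γm n s z * φ z| ∂(P.map (Z n s)) ≤
        ‖φ‖ * ((g n s).totalVariation univ).toReal := fun n s hs φ => by
    rw [(hlaw n s hs).2]
    exact signedIntegral_eq_integral_density (hg.measurable_pos n s hs) (hg.measurable_neg n s hs)
      (hg.pos_density n s hs) (hg.neg_density n s hs) φ
  have hdm : ∀ n, Measurable (density γp γm n t) := fun n =>
    (measurable_coe_nnreal_real.comp (hg.measurable_pos n t ht)).sub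
      (measurable_coe_nnreal_real.comp (hg.measurable_neg n t ht))
  have hm : ∀ n, Measurable fun z => density γp γm n t z * reflected (f n) x z := fun n =>
    (hdm n).mul (reflected (f n) x).continuous.measurable
  let V : Fin N → Ω → ℝ := fun n ω =>
    density γp γm n t (Z n t ω) * reflected (f n) x (Z n t ω)
  have hVi : ∀ n, Integrable (V n) P := fun n =>
    (integrable_map_measure (hm n).aestronglyMeasurable (hlaw n t ht).1.aemeasurable).1
      (hdens n t ht _).1
  have hVint : ∀ n, ∫ ω, V n ω ∂P = signedConv (g n t) (f n) x := fun n =>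
    (integral_map (hlaw n t ht).1.aemeasurable (hm n).aestronglyMeasurable).symm.trans
      (hdens n t ht (reflected (f n) x)).2.1.symm
  have hVind : ∀ n, IndepFun (fun ω => (I ω, τ ω)) (V n) P := fun n => by
    have h1 : IndepFun (fun ω => (I ω, τ ω)) (Z n t) P := by
      obtain ⟨𝒵, -, hind, hZ, -⟩ := hsamp.displacements.2
      exact (indep_of_indep_of_le_left hind (Measurable.comap_le (m₁ := 𝒵) (hZ n t ht))).symm
    exact h1.comp measurable_id (hm n)
  obtain ⟨i1, e1⟩ := expectation_fixed_part hp hsamp.continuousOn_density hsamp.density_pos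
    hsamp.measurable_time hsamp.law_time hsamp.measurable_index hsamp.law_index
    hsamp.indep_time_index hVi hVind ht.1
  have hrandom : Integrable (fun ω => if τ ω < t then
        density γp γm ⊤ (τ ω) (Z ⊤ (τ ω) ω) / ρ (τ ω) * Φ (t - τ ω) (x - Z ⊤ (τ ω) ω) else 0) P ∧
      ∫ ω, (if τ ω < t then density γp γm ⊤ (τ ω) (Z ⊤ (τ ω) ω) / ρ (τ ω) *
        Φ (t - τ ω) (x - Z ⊤ (τ ω) ω) else 0) ∂P =
        ∫ s in (0)..t, signedConv (g ⊤ s) (Φ (t - s)) x := by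
    -- The measurable structure is an explicit argument, so that the lemma can be applied to `Ω`
    -- itself with the sub-σ-algebra `𝒵` and `Y = id`. Independence of `τ` and `Y` is then
    -- independence of `τ` and `𝒵`.
    have key := fun (Ω' : Type _) (m : MeasurableSpace Ω') (Y : Ω → Ω') =>
      expectation_random_part (Y := Y) (T := T) (d := d) hsamp.continuousOn_density
        hsamp.density_pos hsamp.measurable_time hsamp.law_time
    obtain ⟨𝒵, h𝒵, hind, -, hZT⟩ := hsamp.displacements.2
    have hτ : @IndepFun Ω ℝ Ω mΩ _ 𝒵 τ id P := by
      rw [IndepFun_iff_Indep, MeasurableSpace.comap_id]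
      refine (indep_of_indep_of_le_right hind ?_).symm
      rw [show τ = Prod.snd ∘ fun ω => (I ω, τ ω) from rfl, ← MeasurableSpace.comap_comp]
      exact MeasurableSpace.comap_mono measurable_snd.comap_le
    exact key Ω 𝒵 id (measurable_id'' h𝒵) hτ hZT hg.measurable_last (hdens ⊤) ht
      (hg.integrable_mass t ht) hΦ hB x
  obtain ⟨i2, e2⟩ := hrandom
  have he : sample (density γp γm) ρ (fun n => f n) F τ I Z t x = fun ω =>
      (if t ≤ τ ω then V (I ω) ω / tail ρ t else 0) +
      (if τ ω < t then density γp γm ⊤ (τ ω) (Z ⊤ (τ ω) ω) / ρ (τ ω) *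
        Φ (t - τ ω) (x - Z ⊤ (τ ω) ω) else 0) := by
    funext ω
    rw [sample]
    congr 1
    · by_cases h : t ≤ τ ω
      · simp only [h, if_true, V]
        rw [div_mul_eq_mul_div]
        rfl
      · simp only [h, if_false]
    · by_cases h : τ ω < t
      · simp only [h, if_true, hF _ (sub_nonneg.2 h.le)]
      · simp only [h, if_false]
  rw [he]
  refine ⟨i1.add i2, ?_⟩
  rw [integral_add i1 i2, e1, e2, duhamel]
  simp only [hVint]

/-- The bounded continuous extension of a bounded continuous source on `[0, ∞) × ℝ^d`. -/
theorem exists_source_extension {F : ℝ → Space d → ℝ}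
    (hF : ContinuousOn (fun q : ℝ × Space d => F q.1 q.2) (Ici 0 ×ˢ univ))
    (hF' : ∃ C, ∀ t, 0 ≤ t → ∀ x, |F t x| ≤ C) :
    ∃ (Φ : ℝ → Space d →ᵇ ℝ) (B : ℝ), (Continuous fun q : ℝ × Space d => Φ q.1 q.2) ∧
      (∀ r, ‖Φ r‖ ≤ B) ∧ ∀ r, 0 ≤ r → ∀ x, F r x = Φ r x := by
  obtain ⟨C, hC⟩ := hF'
  have hc : Continuous fun q : ℝ × Space d => F (max q.1 0) q.2 :=
    hF.comp_continuous (f := fun q : ℝ × Space d => (max q.1 0, q.2)) (by fun_prop)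
      fun q => ⟨mem_Ici.2 (le_max_right _ _), mem_univ _⟩
  have hb : ∀ r x, ‖F (max r 0) x‖ ≤ C := fun r x => hC _ (le_max_right _ _) x
  refine ⟨fun r => BoundedContinuousFunction.ofNormedAddCommGroup (fun x => F (max r 0) x)
    (hc.comp (by fun_prop : Continuous fun x => (r, x))) C (hb r), C, hc, fun r => ?_,
    fun r hr x => ?_⟩
  · exact (BoundedContinuousFunction.norm_le ((norm_nonneg _).trans (hb 0 0))).2 (hb r)
  · change F r x = F (max r 0) x
    rw [max_eq_left hr]

end Representation

end CauchyProblem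

end

open CauchyProblem

theorem mainTheorem5
    (d N M : ℕ) [NeZero N] (hM : 1 ≤ M)
    (a : ℕ → ℝ) (ha : a N = 1)
    (b : (Fin d → ℕ) → ℝ) (hb : ∃ α : Fin d → ℕ, multiLength α = M ∧ b α ≠ 0)
    (p : Fin N → ℝ) (hp : ∀ n, 0 < p n) (hp1 : ∑ n, p n = 1)
    (f : Fin N → Space d → ℝ) (hf : ∀ n, Continuous (f n)) (hf' : ∀ n, ∃ C, ∀ x, |f n x| ≤ C)
    (F : ℝ → Space d → ℝ)
    (hF : ContinuousOn (fun q : ℝ × Space d => F q.1 q.2) (Set.Ici 0 ×ˢ Set.univ))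
    (hF' : ∃ C, ∀ t, 0 ≤ t → ∀ x, |F t x| ≤ C)
    (T : EReal) (hT : 0 < T) (hhat : GreenHatTempered N M a b T)
    (g : Fin N → ℝ → MeasureTheory.SignedMeasure (Space d))
    (μ : Fin N → ℝ → MeasureTheory.Measure (Space d))
    (γp γm : Fin N → ℝ → Space d → NNReal)
    (hg : GreenMeasures N M a b T g μ γp γm)
    {Ω : Type*} [MeasurableSpace Ω] (P : MeasureTheory.Measure Ω)
    [MeasureTheory.IsProbabilityMeasure P]
    (ρ : ℝ → ℝ) (τ : Ω → ℝ) (I : Ω → Fin N) (Z : Fin N → ℝ → Ω → Space d)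
    (hsamp : IsSampling P T p ρ μ τ I Z) :
    -- the random variable is integrable, and its expectation is, on every `[0, S]` with `S < T`,
    -- the unique bounded continuous solution of the Cauchy problem
    (∀ t ∈ timeSet T, ∀ x : Space d,
      MeasureTheory.Integrable (sample (density γp γm) ρ f F τ I Z t x) P) ∧
    ∀ S : ℝ, 0 < S → (S : EReal) < T →
      IsBoundedSolution N M a b p f F S
        (fun t x => ∫ ω, sample (density γp γm) ρ f F τ I Z t x ω ∂P) ∧
      ∀ v : ℝ → Space d → ℝ, IsBoundedSolution N M a b p f F S v →
        ∀ t ∈ Set.Icc 0 S, ∀ x : Space d,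
          v t x = ∫ ω, sample (density γp γm) ρ f F τ I Z t x ω ∂P := by
  choose Cf hCf using hf'
  let fb : Fin N → Space d →ᵇ ℝ := fun n =>
    BoundedContinuousFunction.ofNormedAddCommGroup (f n) (hf n) (Cf n) (hCf n)
  obtain ⟨Φ, B, hΦ, hB, hFΦ⟩ := exists_source_extension hF hF'
  have hsample := fun t (ht : t ∈ timeSet T) x =>
    sample_expectation hp hg hsamp fb hΦ hB hFΦ ht x
  refine ⟨fun t ht x => (hsample t ht x).1, fun S hS hST => ?_⟩
  obtain ⟨C, hK⟩ := hg.isGreenFamily hhat hS.le hST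
  have hsol := hK.isBoundedSolution_duhamel hS ha p fb hΦ hB (F := F) fun t ht x => hFΦ t ht.1 x
  have hu : IsBoundedSolution N M a b p f F S
      (fun t x => ∫ ω, sample (density γp γm) ρ f F τ I Z t x ω ∂P) :=
    hsol.congr hS fun t ht x => by
      rw [duhamel_clamp ht]
      exact (hsample t (mem_timeSet_of_mem_Icc hST ht) x).2
  exact ⟨hu, fun v hv t ht x => hv.unique hS ha hu t ht x⟩
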